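/- **Setting.** Let $\Omega\subset\mathbb R^3$ be a bounded polyhedral domain with a conforming triangulation $\mathcal T_h$ into finitely many closed tetrahedra; $\Omega$ is the interior of their union and $\mathcal E_h$ is the set of interior triangular faces. Let $s,m\ge 0$ be integers, let $H_0(\operatorname{div},\Omega)$ and $H_0(\operatorname{curl},\Omega)$ be the $L^2$ fields with $L^2$ divergence (curl) and vanishing trace $u\cdot n$ ($u\times n$) on $\partial\Omega$, and put $$U_h^{\rm div}=\{u\in H_0(\operatorname{div},\Omega): u|_K\in P_s(K)^3+xP_s(K)\ \forall K\in\mathcal T_h\},\qquad U_h^{\rm curl}=\{u\in H_0(\operatorname{curl},\Omega): u|_K\in P_s(K)^3+x\times P_s(K)^3\ \forall K\in\mathcal T_h\},$$ $$F_h=\{f: f|_K\in P_m(K)\ \forall K\in\mathcal T_h\},\qquad Q_h=\{f: f|_K\in P_s(K)\ \forall K\in\mathcal T_h,\ \textstyle\int_\Omega f\,dx=0\}.$$ Let $\langle\cdot,\cdot\rangle$ be the $L^2(\Omega)$ inner product. On a face $e=K_1\cap K_2\in\mathcal E_h$ let $[\![f]\!]=f_1n_1+f_2n_2$ and $\{f\}=\tfrac12(f_1+f_2)$,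 where $f_i$ is the trace of $f$ from $K_i$ and $n_i$ is the unit normal to $e$ pointing out of $K_i$; $n$ denotes either unit normal to $e$. For each $e\in\mathcal E_h$ and each $u \in U_h^{\rm div}$ let $\beta_e(u)\ge 0$ be a function on $e$ (e.g. $c|u\cdot n|$ with $c\ge0$) such that the face integrals below exist. For $f,g\in F_h$ and $u,v\in U_h^{\rm div}$ let $$\widetilde b_h(u;f,g,v)=-\sum_{K\in\mathcal T_h}\int_K (v\cdot\nabla f)\,g\,dx+\sum_{e\in\mathcal E_h}\int_e v\cdot[\![f]\!]\,\{g\}\,ds+\sum_{e\in\mathcal E_h}\int_e\beta_e(u)\,\frac{v\cdot n}{u\cdot n}\,[\![f]\!]\cdot[\![g]\!]\,ds,$$ where the quotient is read as $0$ where $u\cdot n=0$. **Scheme.** Let $\Delta t>0$ and $N\ge0$. Write $u_{k+1/2}=\tfrac12(u_k+u_{k+1})$, likewise for $B$ and $\rho$, and $(\rho u)_{k+1/2}=\tfrac12(\rho_ku_k+\rho_{k+1}u_{k+1})$. Suppose that $u_k,B_k\in U_h^{\rm div}$ and $\rho_k\in F_h$ ($0\le k\le N$) and $p_k\in Q_h$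 ($1\le k\le N$) are such that for each $0\le k<N$ there are $w,J,H,U,E,\alpha\in U_h^{\rm curl}$ and $\theta\in F_h$ with $$\Big\langle\frac{\rho_{k+1}u_{k+1}-\rho_ku_k}{\Delta t},v\Big\rangle+\langle\alpha,v\rangle+\widetilde b_h(u_{k+1/2};\theta,\rho_{k+1/2},v)-\langle p_{k+1},\operatorname{div}v\rangle=0\quad\forall v\in U_h^{\rm div},$$ $$\Big\langle\frac{B_{k+1}-B_k}{\Delta t},C\Big\rangle+\langle\nabla\times E,C\rangle=0\quad\forall C\in U_h^{\rm div},$$ $$\Big\langle\frac{\rho_{k+1}-\rho_k}{\Delta t},\sigma\Big\rangle+\widetilde b_h(u_{k+1/2};\sigma,\rho_{k+1/2},u_{k+1/2})=0\quad\forall \sigma\in F_h,$$ $$\langle\operatorname{div}u_{k+1},q\rangle=0\quad\forall q\in Q_h,$$ and, for all $z,K,G,V,F,\gamma\in U_h^{\rm curl}$ and $\tau\in F_h$, $$\langle w,z\rangle=\langle(\rho u)_{k+1/2},\nabla\times z\rangle,\quad \langle J,K\rangle=\langle B_{k+1/2},\nabla\times K\rangle,\quad \langle\theta,\tau\rangle=\tfrac12\langle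 u_k\cdot u_{k+1},\tau\rangle,$$ $$\langle H,G\rangle=\langle B_{k+1/2},G\rangle,\quad \langle U,V\rangle=\langle u_{k+1/2},V\rangle,\quad \langle E,F\rangle=-\langle U\times H,F\rangle,\quad \langle\alpha,\gamma\rangle=\langle w\times U-J\times H,\gamma\rangle.$$ **Proposition.** If $\operatorname{div}u_0\equiv0$ and $\operatorname{div}B_0\equiv0$, then for every $0\le k<N$: 1. $\int_\Omega\rho_{k+1}\,dx=\int_\Omega\rho_k\,dx$; 2. $\int_\Omega\rho_{k+1}^2\,dx\le\int_\Omega\rho_k^2\,dx$, with equality if $\beta_e(u_{k+1/2})=0$ on $e$ for all $e\in\mathcal E_h$; 3. $\int_\Omega\big(\rho_{k+1}u_{k+1}\cdot u_{k+1}+B_{k+1}\cdot B_{k+1}\big)dx=\int_\Omega\big(\rho_ku_k\cdot u_k+B_k\cdot B_k\big)dx$; 4. if $\rho_0\equiv1$, then $\int_\Omega u_{k+1}\cdot B_{k+1}\,dx=\int_\Omega u_k\cdot B_k\,dx$; 5. $\int_\Omega A_{k+1}\cdot B_{k+1}\,dx=\int_\Omega A_k\cdot B_k\,dx$, where $A_k$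 and $A_{k+1}$ are any fields in $H_0(\operatorname{curl},\Omega)$ with $\nabla\times A_k=B_k$ and $\nabla\times A_{k+1}=B_{k+1}$. Moreover $\operatorname{div}u_k\equiv0$ and $\operatorname{div}B_k\equiv0$ for every $0\le k\le N$. -/

import Mathlib

open MeasureTheory
open scoped Matrix ContDiff

noncomputable section

namespace MHD

/-- Points of three-dimensional Euclidean space. Values of vector fields are written as
coordinate vectors `Fin 3 → ℝ`, with the dot product `⬝ᵥ` and the cross product `⨯₃`. -/
abbrev E3 : Type := EuclideanSpace ℝ (Fin 3)

/-! ### Weak divergence and curl with vanishing boundary traces -/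

/-- Partial derivative of a function on space. -/
def partialD (i : Fin 3) (φ : E3 → ℝ) (x : E3) : ℝ :=
  fderiv ℝ φ x (EuclideanSpace.single i 1)

/-- Gradient of a function on space. -/
def gradient (φ : E3 → ℝ) (x : E3) : Fin 3 → ℝ := fun i => partialD i φ x

/-- Curl of a vector field on space. -/
def rot (φ : E3 → Fin 3 → ℝ) (x : E3) : Fin 3 → ℝ :=
  ![partialD 1 (fun y => φ y 2) x - partialD 2 (fun y => φ y 1) x,
    partialD 2 (fun y => φ y 0) x - partialD 0 (fun y => φ y 2) x,
    partialD 0 (fun y => φ y 1) x - partialD 1 (fun y => φ y 0) x]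

/-- `d` is the weak divergence of `u` in `Ω` and `u · n = 0` on `∂Ω`: Green's formula holds
without boundary term for all test functions that are smooth up to the boundary. -/
def HasDivZeroTrace (Ω : Set E3) (u : E3 → Fin 3 → ℝ) (d : E3 → ℝ) : Prop :=
  ∀ φ : E3 → ℝ, ContDiff ℝ ∞ φ →
    ∫ x in Ω, u x ⬝ᵥ gradient φ x = -∫ x in Ω, d x * φ x

/-- `c` is the weak curl of `u` in `Ω` and `u × n = 0` on `∂Ω`: Green's formula holds
without boundary term for all test fields that are smooth up to the boundary. -/
def HasCurlZeroTrace (Ω : Set E3) (u c : E3 → Fin 3 → ℝ) : Prop :=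
  ∀ φ : E3 → Fin 3 → ℝ, ContDiff ℝ ∞ φ →
    ∫ x in Ω, u x ⬝ᵥ rot φ x = ∫ x in Ω, c x ⬝ᵥ φ x

/-- The space `H₀(div, Ω)`. -/
def HZeroDiv (Ω : Set E3) : Set (E3 → Fin 3 → ℝ) :=
  {u | MemLp u 2 (volume.restrict Ω) ∧
    ∃ d : E3 → ℝ, MemLp d 2 (volume.restrict Ω) ∧ HasDivZeroTrace Ω u d}

/-- The space `H₀(curl, Ω)`. -/
def HZeroCurl (Ω : Set E3) : Set (E3 → Fin 3 → ℝ) :=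
  {u | MemLp u 2 (volume.restrict Ω) ∧
    ∃ c : E3 → Fin 3 → ℝ, MemLp c 2 (volume.restrict Ω) ∧ HasCurlZeroTrace Ω u c}

/-! ### Tetrahedral meshes -/

/-- A finite conforming tetrahedral mesh: a finite geometric simplicial complex in which every
simplex is a face of a tetrahedron. Simplices are given by their vertex sets. -/
structure TetMesh extends Geometry.SimplicialComplex ℝ E3 where
  finite_faces : faces.Finite
  pure_three : ∀ s ∈ faces, ∃ t ∈ faces, s ⊆ t ∧ t.card = 4

namespace TetMesh

variable (M : TetMesh)

/-- The open set that is triangulated by the mesh. -/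
def domain : Set E3 := interior M.toSimplicialComplex.space

/-- The tetrahedra of the mesh. -/
def cells : Finset (Finset E3) := {t ∈ M.finite_faces.toFinset | t.card = 4}

open Classical in
/-- The interior triangles of the mesh: those shared by exactly two tetrahedra. -/
def interiorFaces : Finset (Finset E3) :=
  {e ∈ M.finite_faces.toFinset | e.card = 3 ∧ {K ∈ M.cells | e ⊆ K}.card = 2}

/-! ### Piecewise polynomial fields -/

/-- A piecewise polynomial function: one polynomial for each tetrahedron, with no continuity.
Sums and products are taken tetrahedron by tetrahedron. -/
abbrev Scalar : Type := M.cells → MvPolynomial (Fin 3) ℝ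

/-- A piecewise polynomial vector field. -/
abbrev Vec : Type := Fin 3 → M.Scalar

variable {M}

open Classical in
/-- The value of a piecewise polynomial function at a point in the interior of a tetrahedron
(and, by convention, `0` at the points, of measure zero, that lie in no such interior). -/
def val (f : M.Scalar) (x : E3) : ℝ :=
  if h : ∃ K : M.cells, x ∈ interior (convexHull ℝ (K.1 : Set E3)) then
    MvPolynomial.eval x.ofLp (f h.choose)
  else 0

/-- The values of a piecewise polynomial vector field. -/
def vval (u : M.Vec) (x : E3) : Fin 3 → ℝ := fun i => val (u i) x

/-- Product of a piecewise polynomial function with a piecewise polynomial vector field. -/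
def scale (ρ : M.Scalar) (u : M.Vec) : M.Vec := fun i => ρ * u i

/-- The `L²(Ω)` inner product of functions. -/
def ip (f g : M.Scalar) : ℝ := ∫ x in M.domain, val f x * val g x

/-- The `L²(Ω)` inner product of vector fields. -/
def vip (u v : M.Vec) : ℝ := ∫ x in M.domain, vval u x ⬝ᵥ vval v x

/-- Partial derivative, tetrahedron by tetrahedron. -/
def pd (i : Fin 3) (f : M.Scalar) : M.Scalar := fun K => MvPolynomial.pderiv i (f K)

/-- Gradient, tetrahedron by tetrahedron. -/
def grad (f : M.Scalar) : M.Vec := fun i => pd i f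

/-- Divergence, tetrahedron by tetrahedron. For a field in `H₀(div, Ω)` this is its weak
divergence. -/
def div (u : M.Vec) : M.Scalar := ∑ i, pd i (u i)

/-- Curl, tetrahedron by tetrahedron. For a field in `H₀(curl, Ω)` this is its weak curl. -/
def curl (w : M.Vec) : M.Vec :=
  ![pd 1 (w 2) - pd 2 (w 1), pd 2 (w 0) - pd 0 (w 2), pd 0 (w 1) - pd 1 (w 0)]

variable (M)

/-! ### The finite element spaces -/

/-- Discontinuous Galerkin space of degree `m`. -/
def DG (m : ℕ) : Set M.Scalar := {f | ∀ K, (f K).totalDegree ≤ m}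

/-- The functions of mean zero in the discontinuous Galerkin space of degree `s`. -/
def DGZeroMean (s : ℕ) : Set M.Scalar := {f | f ∈ M.DG s ∧ ∫ x in M.domain, val f x = 0}

/-- Raviart-Thomas space: fields in `H₀(div, Ω)` that lie in `P_s(K)³ + x P_s(K)` on each `K`. -/
def RT (s : ℕ) : Set M.Vec :=
  {u | vval u ∈ HZeroDiv M.domain ∧
    ∀ K, ∃ (a : Fin 3 → MvPolynomial (Fin 3) ℝ) (b : MvPolynomial (Fin 3) ℝ),
      (∀ i, (a i).totalDegree ≤ s) ∧ b.totalDegree ≤ s ∧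
        ∀ i, u i K = a i + MvPolynomial.X i * b}

/-- Nedelec space of the first kind: fields in `H₀(curl, Ω)` that lie in
`P_s(K)³ + x × P_s(K)³` on each `K`. -/
def NED (s : ℕ) : Set M.Vec :=
  {w | vval w ∈ HZeroCurl M.domain ∧
    ∀ K, ∃ a b : Fin 3 → MvPolynomial (Fin 3) ℝ,
      (∀ i, (a i).totalDegree ≤ s) ∧ (∀ i, (b i).totalDegree ≤ s) ∧
        (fun i => w i K) = a + MvPolynomial.X ⨯₃ b}

variable {M}

/-- The field is divergence-free in `Ω` with vanishing normal component on `∂Ω`. Fields in `RT s`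
satisfy the boundary condition anyway. -/
def DivFree (u : M.Vec) : Prop := HasDivZeroTrace M.domain (vval u) 0

/-! ### Jumps, averages and the trilinear forms -/

/-- `n` is a unit vector orthogonal to the plane through the triangle `e`. -/
def IsUnitNormal (e : Finset E3) (n : Fin 3 → ℝ) : Prop :=
  n ⬝ᵥ n = 1 ∧ ∀ a ∈ e, ∀ b ∈ e, n ⬝ᵥ (b - a).ofLp = 0

/-- `n` is the unit normal of the triangle `e` that points out of the tetrahedron `K`. -/
def IsOuterNormal (K e : Finset E3) (n : Fin 3 → ℝ) : Prop :=
  IsUnitNormal e n ∧ ∀ a ∈ e, ∀ b ∈ K, b ∉ e → n ⬝ᵥ (b - a).ofLp < 0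

/-- A unit normal of the triangle `e` (one of the two, chosen arbitrarily). -/
def faceNormal (e : Finset E3) : Fin 3 → ℝ := Classical.epsilon (IsUnitNormal e)

/-- The unit normal of the face `e` of the tetrahedron `K` that points out of `K`. -/
def outerNormal (K e : Finset E3) : Fin 3 → ℝ := Classical.epsilon (IsOuterNormal K e)

open Classical in
/-- The jump `f₁ n₁ + f₂ n₂` at a point of an interior face `e = K₁ ∩ K₂`, where `fᵢ` is the
trace from `Kᵢ` and `nᵢ` the unit normal pointing out of `Kᵢ`. -/
def jump (f : M.Scalar) (e : Finset E3) (x : E3) : Fin 3 → ℝ :=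
  ∑ K : M.cells with e ⊆ K.1, MvPolynomial.eval x.ofLp (f K) • outerNormal K.1 e

open Classical in
/-- The average `(f₁ + f₂) / 2` at a point of an interior face. -/
def avg (f : M.Scalar) (e : Finset E3) (x : E3) : ℝ :=
  (∑ K : M.cells with e ⊆ K.1, MvPolynomial.eval x.ofLp (f K)) / 2

/-- The average of a vector field at a point of an interior face. It is only used through its
normal component, which for fields in `H₀(div, Ω)` is the common normal component of the two
one-sided traces. -/
def vavg (u : M.Vec) (e : Finset E3) (x : E3) : Fin 3 → ℝ := fun i => avg (u i) e x

/-- The discrete advection form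
`-∑_K ∫_K (v · ∇f) g dx + ∑_e ∫_e v · ⟦f⟧ {g} ds` on piecewise polynomials. -/
def bForm (f g : M.Scalar) (v : M.Vec) : ℝ :=
  (-∑ K : M.cells, ∫ x in convexHull ℝ (K.1 : Set E3),
      MvPolynomial.eval x.ofLp (((v ⬝ᵥ grad f) * g) K)) +
    ∑ e ∈ M.interiorFaces, (∫ x in convexHull ℝ (e : Set E3),
        (vavg v e x ⬝ᵥ jump f e x) * avg g e x ∂μHE[2])

variable (M) in
/-- Upwinding parameters: for each face `e` and each advecting field `u`, a function
`β_e(u)` on `e`, for example `c |u · n|`. -/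
abbrev Upwinding : Type := Finset E3 → M.Vec → E3 → ℝ

/-- The upwinded form
`b(f, g, v) + ∑_e ∫_e β_e(u) ((v · n) / (u · n)) ⟦f⟧ · ⟦g⟧ ds`. The quotient is read as `0` where
`u · n = 0` (this changes nothing for parameters that vanish there, such as `c |u · n|`); it does not depend on the orientation of the normal. -/
def bUpwind (β : M.Upwinding) (u : M.Vec) (f g : M.Scalar) (v : M.Vec) : ℝ :=
  bForm f g v + ∑ e ∈ M.interiorFaces, (∫ x in convexHull ℝ (e : Set E3),
    β e u x * ((vavg v e x ⬝ᵥ faceNormal e) / (vavg u e x ⬝ᵥ faceNormal e)) *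
      (jump f e x ⬝ᵥ jump g e x) ∂μHE[2])

/-! ### The time-stepping scheme -/

/-- Midpoint average of two consecutive values. -/
def mid {V : Type*} [AddCommGroup V] [Module ℝ V] (a b : V) : V := (2⁻¹ : ℝ) • (a + b)

/-- Difference quotient of two consecutive values. -/
def diffQuot {V : Type*} [AddCommGroup V] [Module ℝ V] (Δt : ℝ) (a b : V) : V :=
  Δt⁻¹ • (b - a)

/-- One time step from `(u, B, ρ)` to `(u', B', ρ')`, with pressure `p'` at the new time level and
auxiliary variables `w, J, θ, H, U, E, α`. The spaces are `RT s` for velocity and magnetic field,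
`DG m` for the density, `DGZeroMean s` for the pressure, and `NED s`. -/
structure IsStep (s m : ℕ) (β : M.Upwinding) (Δt : ℝ) (u B : M.Vec) (ρ : M.Scalar)
    (u' B' : M.Vec) (ρ' p' : M.Scalar) (w J : M.Vec) (θ : M.Scalar) (H U E α : M.Vec) :
    Prop where
  u_mem : u ∈ M.RT s
  B_mem : B ∈ M.RT s
  ρ_mem : ρ ∈ M.DG m
  u_mem' : u' ∈ M.RT s
  B_mem' : B' ∈ M.RT s
  ρ_mem' : ρ' ∈ M.DG m
  p_mem' : p' ∈ M.DGZeroMean s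
  w_mem : w ∈ M.NED s
  J_mem : J ∈ M.NED s
  θ_mem : θ ∈ M.DG m
  H_mem : H ∈ M.NED s
  U_mem : U ∈ M.NED s
  E_mem : E ∈ M.NED s
  α_mem : α ∈ M.NED s
  momentum : ∀ v ∈ M.RT s,
    vip (diffQuot Δt (scale ρ u) (scale ρ' u')) v + vip α v
      + bUpwind β (mid u u') θ (mid ρ ρ') v - ip p' (div v) = 0
  induction : ∀ C ∈ M.RT s, vip (diffQuot Δt B B') C + vip (curl E) C = 0
  density : ∀ σ ∈ M.DG m,
    ip (diffQuot Δt ρ ρ') σ + bUpwind β (mid u u') σ (mid ρ ρ') (mid u u') = 0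
  incompressible : ∀ q ∈ M.DGZeroMean s, ip (div u') q = 0
  w_eq : ∀ z ∈ M.NED s, vip w z = vip (mid (scale ρ u) (scale ρ' u')) (curl z)
  J_eq : ∀ K ∈ M.NED s, vip J K = vip (mid B B') (curl K)
  θ_eq : ∀ τ ∈ M.DG m, ip θ τ = 1 / 2 * ip (u ⬝ᵥ u') τ
  H_eq : ∀ G ∈ M.NED s, vip H G = vip (mid B B') G
  U_eq : ∀ V ∈ M.NED s, vip U V = vip (mid u u') V
  E_eq : ∀ F ∈ M.NED s, vip E F = -vip (U ⨯₃ H) F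
  α_eq : ∀ γ ∈ M.NED s, vip α γ = vip (w ⨯₃ U - J ⨯₃ H) γ

/-- `A` is a magnetic potential of `B`: `∇ × A = B` in `Ω` and `A × n = 0` on `∂Ω`. -/
def IsPotential (B : M.Vec) (A : E3 → Fin 3 → ℝ) : Prop :=
  MemLp A 2 (volume.restrict M.domain) ∧ HasCurlZeroTrace M.domain A (vval B)

end TetMesh

end MHD

end

open MHD MHD.TetMesh

/-! Every law comes from testing the scheme with a suitable discrete function, so the work lies in
making these tests admissible and in integrating by parts over the mesh.

Incompressibility and magnetic Gauss law. A Raviart-Thomas field with zero normal trace has a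
divergence of degree at most `s` and of mean zero, so `div u'` may test its own equation and
vanishes (`IsStep.div_eq_zero`). Curls of Nedelec fields lie in `RT s` (`curl_mem_RT`), so the
residual of the induction equation may test itself; hence `B' = B - Δt curl E` holds exactly and
`div B` stays zero (`IsStep.magnetic_eq`).

Density. For a divergence-free `u` in `RT s` the normal components match across interior faces and
vanish on the boundary. Cellwise integration by parts (`sum_setIntegral_dotProduct_grad`) then gives
`b(f, f, u) = 0` and `b(f, 1, u) = 0`, so only the nonnegative upwind term survives in `b(f, f, u)`.
Testing with `1` gives conservation of mass, testing with the midpoint density gives decay of the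
square.

Energy and cross helicity. The auxiliary variables are `L²` projections. They allow the midpoint
fields to be replaced by their Nedelec projections `U` and `H` when paired with `α`; then the cross
products either vanish or cancel by the symmetries of the triple product. The variable `θ` turns the
advection term of the momentum equation into the one of the density equation. For cross helicity the
density remains `1`, by conservation of mass and decay of the square.

Magnetic helicity. The curl is symmetric on `H₀(curl)` (`setIntegral_dotProduct_curl_comm`, by
mollification). The change of helicity is then a multiple of `⟨B_{k+1/2}, E⟩ = ⟨H, E⟩ = -⟨U × H, H⟩
= 0`.

The geometric foundation is the divergence theorem on a tetrahedron, together with the fact that two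
tetrahedra sharing a face have opposite outer normals there. -/

namespace MHD

/-! ### Parametrized simplices -/

/-- The solid standard simplex. -/
def solidSimplex (n : ℕ) : Set (EuclideanSpace ℝ (Fin n)) :=
  {z | (∀ i, 0 ≤ z i) ∧ ∑ i, z i ≤ 1}

/-- The linear map that sends the standard basis to `w`. -/
noncomputable def frameMap {n : ℕ} (w : Fin n → E3) : EuclideanSpace ℝ (Fin n) →ₗ[ℝ] E3 :=
  Fintype.linearCombination ℝ w ∘ₗ (WithLp.linearEquiv 2 ℝ (Fin n → ℝ)).toLinearMap

lemma frameMap_apply {n : ℕ} (w : Fin n → E3) (z : EuclideanSpace ℝ (Fin n)) :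
    frameMap w z = ∑ i, z i • w i := by
  simp [frameMap, Fintype.linearCombination_apply]

lemma frameMap_single {n : ℕ} (w : Fin n → E3) (i : Fin n) :
    frameMap w (EuclideanSpace.single i 1) = w i := by
  simp [frameMap_apply]

lemma frameMap_injective {n : ℕ} {w : Fin n → E3} (hw : LinearIndependent ℝ w) :
    Function.Injective (frameMap w) := by
  simp only [frameMap, LinearMap.coe_comp]
  exact hw.fintypeLinearCombination_injective.comp (LinearEquiv.injective _)

lemma convex_solidSimplex (n : ℕ) : Convex ℝ (solidSimplex n) := by
  rintro x ⟨hx0, hx1⟩ y ⟨hy0, hy1⟩ a b ha hb hab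
  refine ⟨fun i => ?_, ?_⟩
  · have := hx0 i
    have := hy0 i
    simp only [PiLp.add_apply, PiLp.smul_apply, smul_eq_mul]
    positivity
  · simp only [PiLp.add_apply, PiLp.smul_apply, smul_eq_mul, Finset.sum_add_distrib,
      ← Finset.mul_sum]
    nlinarith

lemma isClosed_solidSimplex (n : ℕ) : IsClosed (solidSimplex n) := by
  refine IsClosed.inter (s₁ := {z : EuclideanSpace ℝ (Fin n) | ∀ i, 0 ≤ z i})
    (s₂ := {z : EuclideanSpace ℝ (Fin n) | ∑ i, z i ≤ 1}) ?_ ?_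
  · rw [Set.ofPred_forall]
    exact isClosed_iInter fun i => isClosed_le continuous_const (by fun_prop)
  · exact isClosed_le (by fun_prop) continuous_const

lemma isBounded_solidSimplex (n : ℕ) : Bornology.IsBounded (solidSimplex n) := by
  refine (Metric.isBounded_iff_subset_closedBall 0).2 ⟨√n, fun z hz => ?_⟩
  have h1 : ∀ i, z i ≤ 1 := fun i =>
    (Finset.single_le_sum (fun j _ => hz.1 j) (Finset.mem_univ i)).trans hz.2
  rw [mem_closedBall_zero_iff, EuclideanSpace.norm_eq]
  refine Real.sqrt_le_sqrt ?_
  calc ∑ i, ‖z i‖ ^ 2 ≤ ∑ _i : Fin n, (1 : ℝ) := Finset.sum_le_sum fun i _ => by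
        rw [Real.norm_of_nonneg (hz.1 i)]
        exact pow_le_one₀ (hz.1 i) (h1 i)
    _ = n := by simp

lemma isCompact_solidSimplex (n : ℕ) : IsCompact (solidSimplex n) :=
  Metric.isCompact_of_isClosed_isBounded (isClosed_solidSimplex n) (isBounded_solidSimplex n)

lemma convexHull_eq_image_solidSimplex {n : ℕ} (a : E3) (w : Fin n → E3) :
    convexHull ℝ (insert a (Set.range fun i => a + w i)) =
      (fun z => a + frameMap w z) '' solidSimplex n := by
  apply Set.Subset.antisymm
  · refine convexHull_min ?_ ?_
    · rintro x (rfl | ⟨i, rfl⟩)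
      · exact ⟨0, ⟨fun i => le_rfl, by simp⟩, by simp⟩
      · refine ⟨EuclideanSpace.single i 1, ⟨fun j => ?_, ?_⟩, by simp [frameMap_single]⟩
        · by_cases h : j = i <;> simp [h]
        · simp
    · have h1 : (fun z => a + frameMap w z) '' solidSimplex n
          = (fun x => a + x) '' (frameMap w '' solidSimplex n) := by
        rw [Set.image_image]
      rw [h1]
      exact ((convex_solidSimplex n).linear_image _).translate a
  · rintro x ⟨z, hz, rfl⟩
    have hc := convex_convexHull ℝ (insert a (Set.range fun i => a + w i))
    -- Barycentric coordinates: the index `none` stands for the vertex `a`, which receives the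
    -- remaining weight `1 - ∑ z i`.
    have key : a + frameMap w z =
        ∑ o : Option (Fin n), (o.elim (1 - ∑ i, z i) fun i => z i) •
          (o.elim a fun i => a + w i) := by
      simp only [Fintype.sum_option, Option.elim, frameMap_apply, smul_add,
        Finset.sum_add_distrib, ← Finset.sum_smul, sub_smul, one_smul]
      abel
    simp only [key]
    refine hc.sum_mem ?_ ?_ ?_
    · rintro (_ | i) -
      · simpa using hz.2
      · exact hz.1 i
    · simp [Fintype.sum_option]
    · rintro (_ | i) -
      · exact subset_convexHull _ _ (Set.mem_insert _ _)
      · exact subset_convexHull _ _ (Set.mem_insert_of_mem _ ⟨i, rfl⟩)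

/-! ### Integrals over parametrized simplices -/

lemma measurableEmbedding_frame {n : ℕ} (a : E3) {w : Fin n → E3} (hw : LinearIndependent ℝ w) :
    MeasurableEmbedding (fun z => a + frameMap w z) := by
  refine Continuous.measurableEmbedding ?_ ?_
  · exact continuous_const.add (frameMap w).continuous_of_finiteDimensional
  · exact (add_right_injective a).comp (frameMap_injective hw)

lemma euclideanHausdorffMeasure_restrict_range_frame {n : ℕ} (a : E3) {w : Fin n → E3}
    (hw : LinearIndependent ℝ w) :
    (μHE[n] : Measure E3).restrict (Set.range fun z => a + frameMap w z) =
      ENNReal.ofReal (frameMap w).normDet • Measure.map (fun z => a + frameMap w z) volume := by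
  have hemb := measurableEmbedding_frame a hw
  ext t ht
  rw [Measure.restrict_apply ht, Measure.smul_apply, hemb.map_apply, smul_eq_mul]
  have h1 : t ∩ Set.range (fun z => a + frameMap w z) =
      (fun x => a + x) '' (frameMap w '' ((fun z => a + frameMap w z) ⁻¹' t)) := by
    rw [Set.image_image, Set.image_preimage_eq_inter_range]
  have h2 := (frameMap w).euclideanHausdorffMeasure_image_eq_normDet_mul_volume
    ((fun z => a + frameMap w z) ⁻¹' t)
  rw [finrank_euclideanSpace_fin] at h2
  rw [h1, (isometry_add_left a).euclideanHausdorffMeasure_image, h2]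

/-- The change of variables with constant Jacobian `normDet`. It serves tetrahedra (`n = 3`) and
their faces (`n = 2`) alike; `S` and `g` are arbitrary because the parametrization is a measurable
embedding. -/
lemma setIntegral_image_frame {n : ℕ} (a : E3) {w : Fin n → E3} (hw : LinearIndependent ℝ w)
    (S : Set (EuclideanSpace ℝ (Fin n))) (g : E3 → ℝ) :
    ∫ x in (fun z => a + frameMap w z) '' S, g x ∂μHE[n] =
      (frameMap w).normDet * ∫ z in S, g (a + frameMap w z) := by
  have hemb := measurableEmbedding_frame a hw
  have h1 : (μHE[n] : Measure E3).restrict ((fun z => a + frameMap w z) '' S) =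
      ((μHE[n] : Measure E3).restrict (Set.range fun z => a + frameMap w z)).restrict
        ((fun z => a + frameMap w z) '' S) := by
    rw [Measure.restrict_restrict_of_subset (Set.image_subset_range _ _)]
  rw [h1, euclideanHausdorffMeasure_restrict_range_frame a hw, Measure.restrict_smul,
    integral_smul_measure, hemb.setIntegral_map, Set.preimage_image_eq _ hemb.injective,
    ENNReal.toReal_ofReal (LinearMap.normDet_nonneg _), smul_eq_mul]

lemma euclideanHausdorffMeasure_convexHull_lt_top {n : ℕ} (a : E3) (w : Fin n → E3) :
    (μHE[n] : Measure E3) (convexHull ℝ (insert a (Set.range fun i => a + w i))) < ⊤ := by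
  have h1 : (fun z => a + frameMap w z) '' solidSimplex n =
      (fun x => a + x) '' (frameMap w '' solidSimplex n) := by
    rw [Set.image_image]
  have h2 := (frameMap w).euclideanHausdorffMeasure_image_eq_normDet_mul_volume (solidSimplex n)
  rw [finrank_euclideanSpace_fin] at h2
  rw [convexHull_eq_image_solidSimplex, h1,
    (isometry_add_left a).euclideanHausdorffMeasure_image, h2]
  exact ENNReal.mul_lt_top ENNReal.ofReal_lt_top (isCompact_solidSimplex n).measure_lt_top

/-- Prepending a coordinate. -/
noncomputable def consE {n : ℕ} (x : ℝ) (y : EuclideanSpace ℝ (Fin n)) :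
    EuclideanSpace ℝ (Fin (n + 1)) :=
  WithLp.toLp 2 (Fin.cons x y.ofLp)

/-- The slices of the simplex in the first coordinate are intervals, as needed for Fubini. -/
lemma consE_mem_solidSimplex {n : ℕ} (x : ℝ) (y : EuclideanSpace ℝ (Fin n)) :
    consE x y ∈ solidSimplex (n + 1) ↔ y ∈ solidSimplex n ∧ x ∈ Set.Icc 0 (1 - ∑ i, y i) := by
  simp only [solidSimplex, consE, Set.mem_ofPred_eq, Fin.forall_fin_succ, Fin.sum_univ_succ,
    Fin.cons_zero, Fin.cons_succ, Set.mem_Icc]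
  constructor
  · rintro ⟨⟨h0, h1⟩, h2⟩
    exact ⟨⟨h1, by linarith⟩, h0, by linarith⟩
  · rintro ⟨⟨h1, h2⟩, h0, h3⟩
    exact ⟨⟨h0, h1⟩, by linarith⟩

lemma measurePreserving_consE (n : ℕ) :
    MeasurePreserving (fun p : ℝ × EuclideanSpace ℝ (Fin n) => consE p.1 p.2) volume volume := by
  have h1 := (EuclideanSpace.volume_preserving_symm_measurableEquiv_toLp (Fin (n + 1))).symm
  have h2 := (volume_preserving_piFinSuccAbove (fun _ : Fin (n + 1) => ℝ) 0).symm
  have h3 := EuclideanSpace.volume_preserving_symm_measurableEquiv_toLp (Fin n)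
  have h4 := (MeasurePreserving.id (volume : Measure ℝ)).prod h3
  have := h1.comp (h2.comp h4)
  have heq : (fun p : ℝ × EuclideanSpace ℝ (Fin n) => consE p.1 p.2) =
      (MeasurableEquiv.toLp 2 (Fin (n + 1) → ℝ)).symm.symm ∘
        (MeasurableEquiv.piFinSuccAbove (fun _ => ℝ) 0).symm ∘
          Prod.map id (MeasurableEquiv.toLp 2 (Fin n → ℝ)).symm := by
    funext p
    exact congrArg (WithLp.toLp 2) (Fin.insertNth_zero' p.1 p.2.ofLp).symm
  rw [heq]
  exact this

lemma measurableEmbedding_consE (n : ℕ) :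
    MeasurableEmbedding (fun p : ℝ × EuclideanSpace ℝ (Fin n) => consE p.1 p.2) := by
  refine Continuous.measurableEmbedding ?_ ?_
  · refine (PiLp.continuous_toLp 2 _).comp ?_
    refine continuous_pi fun i => ?_
    refine Fin.cases ?_ (fun j => ?_) i
    · simpa using continuous_fst
    · simp only [Fin.cons_succ]
      fun_prop
  · rintro ⟨x, y⟩ ⟨x', y'⟩ h
    have h' := congrArg WithLp.ofLp h
    simp only [consE] at h'
    obtain ⟨h1, h2⟩ := Fin.cons_injective2 h'
    exact Prod.ext h1 (WithLp.ofLp_injective 2 h2)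

lemma hasDerivAt_consE {n : ℕ} (y : EuclideanSpace ℝ (Fin n)) (x : ℝ) :
    HasDerivAt (fun x => consE x y) (EuclideanSpace.single 0 1) x := by
  have h : (fun x => consE x y) = fun x => consE 0 y + x • EuclideanSpace.single 0 1 := by
    funext t
    ext i
    refine Fin.cases ?_ (fun j => ?_) i <;> simp [consE]
  rw [h]
  simpa using ((hasDerivAt_id x).smul_const
    (EuclideanSpace.single (0 : Fin (n + 1)) (1 : ℝ))).const_add (consE 0 y)

/-- The fundamental theorem of calculus on the solid standard simplex. -/
lemma setIntegral_fderiv_solidSimplex {n : ℕ} {g : EuclideanSpace ℝ (Fin (n + 1)) → ℝ}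
    (hg : ContDiff ℝ 1 g) :
    ∫ z in solidSimplex (n + 1), fderiv ℝ g z (EuclideanSpace.single 0 1) =
      ∫ y in solidSimplex n, (g (consE (1 - ∑ i, y i) y) - g (consE 0 y)) := by
  set h : EuclideanSpace ℝ (Fin (n + 1)) → ℝ :=
    fun z => fderiv ℝ g z (EuclideanSpace.single 0 1) with hh
  have hcont : Continuous h := (hg.continuous_fderiv one_ne_zero).clm_apply continuous_const
  set S := (fun p : ℝ × EuclideanSpace ℝ (Fin n) => consE p.1 p.2) ⁻¹' solidSimplex (n + 1)
  have hS : MeasurableSet S :=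
    (measurableEmbedding_consE n).measurable (isClosed_solidSimplex _).measurableSet
  -- After the first coordinate is split off, Fubini puts its integral innermost. Over each `y` in
  -- the lower simplex it runs from `0` to `1 - ∑ y i`, where the one-dimensional theorem applies.
  rw [← (measurePreserving_consE n).setIntegral_preimage_emb (measurableEmbedding_consE n) h,
    ← integral_indicator hS, Measure.volume_eq_prod, integral_prod_symm,
    ← integral_indicator (isClosed_solidSimplex _).measurableSet]
  · refine integral_congr_ae (Filter.Eventually.of_forall fun y => ?_)
    by_cases hy : y ∈ solidSimplex n
    · have h1 : (fun x => S.indicator (fun p => h (consE p.1 p.2)) (x, y)) =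
          (Set.Icc 0 (1 - ∑ i, y i)).indicator fun x => h (consE x y) := by
        funext x
        by_cases hx : x ∈ Set.Icc 0 (1 - ∑ i, y i)
        · rw [Set.indicator_of_mem hx, Set.indicator_of_mem]
          exact (consE_mem_solidSimplex x y).2 ⟨hy, hx⟩
        · rw [Set.indicator_of_notMem hx, Set.indicator_of_notMem]
          exact fun hm => hx ((consE_mem_solidSimplex x y).1 hm).2
      have h2 : (0 : ℝ) ≤ 1 - ∑ i, y i := by linarith [hy.2]
      simp only [h1]
      rw [Set.indicator_of_mem hy, integral_indicator measurableSet_Icc,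
        integral_Icc_eq_integral_Ioc, ← intervalIntegral.integral_of_le h2]
      refine intervalIntegral.integral_eq_sub_of_hasDerivAt (f := fun x => g (consE x y))
        (fun x _ => ?_) ?_
      · exact ((hg.differentiable one_ne_zero).differentiableAt.hasFDerivAt).comp_hasDerivAt x
          (hasDerivAt_consE y x)
      · refine Continuous.intervalIntegrable (hcont.comp ?_) _ _
        exact continuous_iff_continuousAt.2 fun x => (hasDerivAt_consE y x).continuousAt
    · have h1 : (fun x => S.indicator (fun p => h (consE p.1 p.2)) (x, y)) = fun _ => 0 := by
        funext x
        rw [Set.indicator_of_notMem]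
        exact fun hm => hy ((consE_mem_solidSimplex x y).1 hm).1
      simp only [h1]
      rw [Set.indicator_of_notMem hy, integral_zero]
  · rw [integrable_indicator_iff hS]
    refine ((measurePreserving_consE n).integrableOn_comp_preimage
      (measurableEmbedding_consE n) (f := h)).2 ?_
    exact hcont.continuousOn.integrableOn_compact (isCompact_solidSimplex _)

/-! ### The divergence theorem on a tetrahedron -/

lemma inner_eq_dotProduct (x y : E3) : inner ℝ x y = y.ofLp ⬝ᵥ x.ofLp := by
  simp [PiLp.inner_apply, dotProduct]

lemma normDet_frameMap_sq {n : ℕ} (w : Fin n → E3) :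
    (frameMap w).normDet ^ 2 = (Matrix.gram ℝ w).det := by
  have h := (frameMap w).normDet_sq_eq_det_gram (EuclideanSpace.basisFun (Fin n) ℝ)
  simpa [frameMap_single] using h

/-- The Gram determinant of three vectors is the square of their triple product. -/
lemma normDet_frameMap_three (x y z : E3) :
    (frameMap ![x, y, z]).normDet = |x.ofLp ⬝ᵥ (y.ofLp ⨯₃ z.ofLp)| := by
  rw [← sq_eq_sq₀ (LinearMap.normDet_nonneg _) (abs_nonneg _), sq_abs, normDet_frameMap_sq,
    Matrix.det_fin_three]
  simp only [Matrix.gram_apply, inner_eq_dotProduct]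
  simp [dotProduct, Fin.sum_univ_three, cross_apply]
  ring

/-- This is Lagrange's identity `|x × y|² = |x|²|y|² - (x · y)²`. -/
lemma normDet_frameMap_two_sq (x y : E3) :
    (frameMap ![x, y]).normDet ^ 2 = (x.ofLp ⨯₃ y.ofLp) ⬝ᵥ (x.ofLp ⨯₃ y.ofLp) := by
  rw [normDet_frameMap_sq, Matrix.det_fin_two]
  simp only [Matrix.gram_apply, inner_eq_dotProduct]
  simp [dotProduct, Fin.sum_univ_three, cross_apply]
  ring

/-- A unit vector `n` decomposes any `v` as `(n · v) n - n × (n × v)`. For `v = x × y` the last term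
vanishes since `n × (x × y) = (n · y) x - (n · x) y = 0`. -/
lemma cross_eq_smul_of_orthogonal {x y n : Fin 3 → ℝ} (hn : n ⬝ᵥ n = 1) (hx : n ⬝ᵥ x = 0)
    (hy : n ⬝ᵥ y = 0) : x ⨯₃ y = (n ⬝ᵥ (x ⨯₃ y)) • n := by
  simp only [dotProduct, Fin.sum_univ_three] at hn hx hy
  ext i
  fin_cases i <;>
    simp [cross_apply, dotProduct, Fin.sum_univ_three]
  · linear_combination (x 2 * y 1 - x 1 * y 2) * hn -
      (n 2 * y 1 - n 1 * y 2) * hx - (n 1 * x 2 - n 2 * x 1) * hy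
  · linear_combination (x 0 * y 2 - x 2 * y 0) * hn -
      (n 0 * y 2 - n 2 * y 0) * hx - (n 2 * x 0 - n 0 * x 2) * hy
  · linear_combination (x 1 * y 0 - x 0 * y 1) * hn -
      (n 1 * y 0 - n 0 * y 1) * hx - (n 0 * x 1 - n 1 * x 0) * hy

/-- The volume of a parallelepiped is base times height. -/
lemma normDet_frameMap_two_mul_abs {x y : E3} {n : Fin 3 → ℝ} (hn : n ⬝ᵥ n = 1)
    (hx : n ⬝ᵥ x.ofLp = 0) (hy : n ⬝ᵥ y.ofLp = 0) (z : E3) :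
    (frameMap ![x, y]).normDet * |n ⬝ᵥ z.ofLp| = |z.ofLp ⬝ᵥ (x.ofLp ⨯₃ y.ofLp)| := by
  have hc := cross_eq_smul_of_orthogonal hn hx hy
  rw [← sq_eq_sq₀ (mul_nonneg (LinearMap.normDet_nonneg _) (abs_nonneg _)) (abs_nonneg _),
    mul_pow, sq_abs, sq_abs, normDet_frameMap_two_sq, hc]
  simp only [dotProduct_smul, smul_dotProduct, smul_eq_mul, hn]
  rw [dotProduct_comm z.ofLp n]
  ring

lemma dotProduct_cross_ne_zero_of_linearIndependent {x y z : E3}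
    (h : LinearIndependent ℝ ![x, y, z]) : x.ofLp ⬝ᵥ (y.ofLp ⨯₃ z.ofLp) ≠ 0 := by
  intro h0
  have h1 := normDet_frameMap_three x y z
  rw [h0, abs_zero] at h1
  exact LinearMap.normDet_eq_zero_iff_ker_ne_bot.1 h1 (LinearMap.ker_eq_bot.2 (frameMap_injective h))

lemma linearIndependent_vsub_of_affineIndependent {K : Finset E3}
    (hK : AffineIndependent ℝ ((↑) : K → E3)) {n : ℕ} {p : Fin (n + 1) → E3}
    (hp : Function.Injective p) (hpK : ∀ i, p i ∈ K) :
    LinearIndependent ℝ fun i : Fin n => p i.succ - p 0 := by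
  let q : Fin (n + 1) ↪ K := ⟨fun i => ⟨p i, hpK i⟩, fun i j h => hp (congrArg Subtype.val h)⟩
  have h1 : AffineIndependent ℝ p := hK.comp_embedding q
  have h2 := (affineIndependent_iff_linearIndependent_vsub ℝ p 0).1 h1
  exact h2.comp (fun i : Fin n => (⟨i.succ, Fin.succ_ne_zero i⟩ : {x : Fin (n + 1) // x ≠ 0}))
    fun i j h => Fin.succ_injective _ (congrArg Subtype.val h)

/-- A tetrahedron with nonzero volume. -/
structure IsTet (K : Finset E3) : Prop where
  card_eq : K.card = 4
  indep : AffineIndependent ℝ ((↑) : K → E3)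

lemma linearIndependent_two {K : Finset E3} (hK : AffineIndependent ℝ ((↑) : K → E3))
    {a b c : E3} (ha : a ∈ K) (hb : b ∈ K) (hc : c ∈ K) (hab : a ≠ b) (hac : a ≠ c)
    (hbc : b ≠ c) : LinearIndependent ℝ ![b - a, c - a] := by
  have := linearIndependent_vsub_of_affineIndependent hK (p := ![a, b, c]) ?_ ?_
  · convert this using 1
    ext i : 1
    fin_cases i <;> rfl
  · intro i j
    fin_cases i <;> fin_cases j <;> simp [*, Ne.symm]
  · intro i
    fin_cases i <;> simpa

lemma linearIndependent_three {K : Finset E3} (hK : AffineIndependent ℝ ((↑) : K → E3))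
    {a b c d : E3} (ha : a ∈ K) (hb : b ∈ K) (hc : c ∈ K) (hd : d ∈ K)
    (hab : a ≠ b) (hac : a ≠ c) (had : a ≠ d) (hbc : b ≠ c) (hbd : b ≠ d) (hcd : c ≠ d) :
    LinearIndependent ℝ ![b - a, c - a, d - a] := by
  have := linearIndependent_vsub_of_affineIndependent hK (p := ![a, b, c, d]) ?_ ?_
  · convert this using 1
    ext i : 1
    fin_cases i <;> rfl
  · intro i j
    fin_cases i <;> fin_cases j <;> simp
    all_goals grind
  · intro i
    fin_cases i <;> simpa

lemma IsTet.exists_eq_insert {K : Finset E3} (hK : IsTet K) {a b : E3} (ha : a ∈ K) (hb : b ∈ K)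
    (hab : a ≠ b) : ∃ c d, a ≠ c ∧ a ≠ d ∧ b ≠ c ∧ b ≠ d ∧ c ≠ d ∧
      K = {a, b, c, d} := by
  classical
  have h1 : ((K.erase a).erase b).card = 2 := by
    rw [Finset.card_erase_of_mem (Finset.mem_erase.2 ⟨hab.symm, hb⟩), Finset.card_erase_of_mem ha,
      hK.card_eq]
  obtain ⟨c, d, hcd, h⟩ := Finset.card_eq_two.1 h1
  have hc : c ∈ (K.erase a).erase b := by simp [h]
  have hd : d ∈ (K.erase a).erase b := by simp [h]
  simp only [Finset.mem_erase] at hc hd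
  refine ⟨c, d, hc.2.1.symm, hd.2.1.symm, hc.1.symm, hd.1.symm, hcd, ?_⟩
  rw [← h, Finset.insert_erase (Finset.mem_erase.2 ⟨hab.symm, hb⟩), Finset.insert_erase ha]

lemma frameMap_two (x y : E3) (z : EuclideanSpace ℝ (Fin 2)) :
    frameMap ![x, y] z = z 0 • x + z 1 • y := by
  simp [frameMap_apply, Fin.sum_univ_two]

lemma frameMap_three (x y v : E3) (z : EuclideanSpace ℝ (Fin 3)) :
    frameMap ![x, y, v] z = z 0 • x + z 1 • y + z 2 • v := by
  simp [frameMap_apply, Fin.sum_univ_three]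

lemma convexHull_three_eq_image (a b c : E3) :
    convexHull ℝ ({a, b, c} : Set E3) =
      (fun z => a + frameMap ![b - a, c - a] z) '' solidSimplex 2 := by
  rw [← convexHull_eq_image_solidSimplex]
  congr 2
  ext x
  simp [Fin.exists_fin_two, eq_comm]

lemma convexHull_four_eq_image (a b c d : E3) :
    convexHull ℝ ({a, b, c, d} : Set E3) =
      (fun z => a + frameMap ![b - a, c - a, d - a] z) '' solidSimplex 3 := by
  rw [← convexHull_eq_image_solidSimplex]
  congr 2
  ext x
  simp [Fin.exists_fin_succ, eq_comm]

/-- With `b - a` as first frame vector the derivative along the edge is the first partial derivative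
in the parameters, and the fundamental theorem leaves the two ends of each slice. These ends sweep
out the faces `bcd` and `acd`; base times height converts the volume Jacobian into the area
Jacobians, with heights `n · (b - a)` and `-m · (b - a)`. -/
lemma setIntegral_fderiv_edge_tetrahedron {K : Finset E3}
    (hK : AffineIndependent ℝ ((↑) : K → E3)) {a b c d : E3}
    (ha : a ∈ K) (hb : b ∈ K) (hc : c ∈ K) (hd : d ∈ K)
    (hab : a ≠ b) (hac : a ≠ c) (had : a ≠ d) (hbc : b ≠ c) (hbd : b ≠ d) (hcd : c ≠ d)
    {f : E3 → ℝ} (hf : ContDiff ℝ 1 f) {m n : Fin 3 → ℝ}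
    (hn1 : n ⬝ᵥ n = 1) (hnc : n ⬝ᵥ (c - b).ofLp = 0) (hnd : n ⬝ᵥ (d - b).ofLp = 0)
    (hnb : 0 ≤ n ⬝ᵥ (b - a).ofLp)
    (hm1 : m ⬝ᵥ m = 1) (hmc : m ⬝ᵥ (c - a).ofLp = 0) (hmd : m ⬝ᵥ (d - a).ofLp = 0)
    (hmb : m ⬝ᵥ (b - a).ofLp ≤ 0) :
    ∫ x in convexHull ℝ ({a, b, c, d} : Set E3), fderiv ℝ f x (b - a) =
      (n ⬝ᵥ (b - a).ofLp) * (∫ x in convexHull ℝ ({b, c, d} : Set E3), f x ∂μHE[2]) +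
      (m ⬝ᵥ (b - a).ofLp) * (∫ x in convexHull ℝ ({a, c, d} : Set E3), f x ∂μHE[2]) := by
  have li3 := linearIndependent_three hK ha hb hc hd hab hac had hbc hbd hcd
  have lib := linearIndependent_two hK hb hc hd hbc hbd hcd
  have lia := linearIndependent_two hK ha hc hd hac had hcd
  have e1 : (frameMap ![b - a, c - a, d - a]).normDet =
      (frameMap ![c - b, d - b]).normDet * (n ⬝ᵥ (b - a).ofLp) := by
    rw [← abs_of_nonneg hnb, normDet_frameMap_two_mul_abs hn1 hnc hnd, normDet_frameMap_three]
    congr 1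
    simp [dotProduct, Fin.sum_univ_three, cross_apply]
    ring
  have e2 : (frameMap ![b - a, c - a, d - a]).normDet =
      -((frameMap ![c - a, d - a]).normDet * (m ⬝ᵥ (b - a).ofLp)) := by
    rw [← mul_neg, ← abs_of_nonpos hmb, normDet_frameMap_two_mul_abs hm1 hmc hmd,
      normDet_frameMap_three]
  rw [← EuclideanSpace.euclideanHausdorffMeasure_eq_volume, convexHull_four_eq_image,
    convexHull_three_eq_image,
    convexHull_three_eq_image, setIntegral_image_frame _ li3, setIntegral_image_frame _ lib,
    setIntegral_image_frame _ lia]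
  have hg : ContDiff ℝ 1 fun z => f (a + frameMap ![b - a, c - a, d - a] z) :=
    hf.comp (contDiff_const.add (frameMap _).toContinuousLinearMap.contDiff)
  have e3 : ∀ z : EuclideanSpace ℝ (Fin 3),
      fderiv ℝ f (a + frameMap ![b - a, c - a, d - a] z) (b - a) =
        fderiv ℝ (fun z => f (a + frameMap ![b - a, c - a, d - a] z)) z
          (EuclideanSpace.single 0 1) := by
    intro z
    have h1 : HasFDerivAt (fun z => a + frameMap ![b - a, c - a, d - a] z)
        (frameMap ![b - a, c - a, d - a]).toContinuousLinearMap z :=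
      (frameMap ![b - a, c - a, d - a]).toContinuousLinearMap.hasFDerivAt.const_add a
    have h2 := ((hf.differentiable one_ne_zero).differentiableAt
      (x := a + frameMap ![b - a, c - a, d - a] z)).hasFDerivAt.comp z h1
    have h3 : fderiv ℝ (fun z => f (a + frameMap ![b - a, c - a, d - a] z)) z = _ := h2.fderiv
    rw [h3]
    simp [frameMap_single]
  have e4 : ∀ y : EuclideanSpace ℝ (Fin 2),
      a + frameMap ![b - a, c - a, d - a] (consE (1 - ∑ i, y i) y) =
        b + frameMap ![c - b, d - b] y := by
    intro y
    simp only [frameMap_two, frameMap_three, consE, Fin.sum_univ_two]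
    change a + ((1 - (y 0 + y 1)) • (b - a) + y 0 • (c - a) + y 1 • (d - a)) = _
    module
  have e5 : ∀ y : EuclideanSpace ℝ (Fin 2),
      a + frameMap ![b - a, c - a, d - a] (consE 0 y) =
        a + frameMap ![c - a, d - a] y := by
    intro y
    simp only [frameMap_two, frameMap_three, consE]
    change a + ((0 : ℝ) • (b - a) + y 0 • (c - a) + y 1 • (d - a)) = _
    module
  have hfc := hf.continuous
  have int : ∀ (p : E3) (w : Fin 2 → E3),
      IntegrableOn (fun z => f (p + frameMap w z)) (solidSimplex 2) volume := fun p w =>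
    (hfc.comp (continuous_const.add
      (frameMap w).continuous_of_finiteDimensional)).continuousOn.integrableOn_compact
      (isCompact_solidSimplex 2)
  simp only [e3]
  rw [setIntegral_fderiv_solidSimplex hg]
  simp only [e4, e5]
  rw [integral_sub (int _ _) (int _ _), mul_sub]
  nth_rewrite 1 [e1]
  rw [e2]
  ring

lemma exists_isOuterNormal_of_eq_insert {K : Finset E3} (hK : IsTet K) {a b c d : E3}
    (hab : a ≠ b) (hac : a ≠ c) (had : a ≠ d) (hbc : b ≠ c) (hbd : b ≠ d) (hcd : c ≠ d)
    (h : K = {a, b, c, d}) : ∃ n, IsOuterNormal K {b, c, d} n := by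
  have li := linearIndependent_three hK.indep (a := b) (b := a) (c := c) (d := d)
    (by simp [h]) (by simp [h]) (by simp [h]) (by simp [h]) hab.symm hbc hbd hac had hcd
  have hdet := dotProduct_cross_ne_zero_of_linearIndependent li
  set x := (c - b).ofLp
  set y := (d - b).ofLp
  set z := (a - b).ofLp
  have hr0 : 0 ≤ (x ⨯₃ y) ⬝ᵥ (x ⨯₃ y) := by
    simp only [dotProduct, Fin.sum_univ_three]
    exact add_nonneg (add_nonneg (mul_self_nonneg _) (mul_self_nonneg _)) (mul_self_nonneg _)
  have hr : (x ⨯₃ y) ⬝ᵥ (x ⨯₃ y) ≠ 0 := fun h0 => hdet (by rw [dotProduct_self_eq_zero.1 h0]; simp)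
  set r := √((x ⨯₃ y) ⬝ᵥ (x ⨯₃ y))
  have hrr : r * r = (x ⨯₃ y) ⬝ᵥ (x ⨯₃ y) := Real.mul_self_sqrt hr0
  have hrpos : 0 < r := Real.sqrt_pos.2 (lt_of_le_of_ne hr0 (Ne.symm hr))
  have hxx : (x ⨯₃ y) ⬝ᵥ x = 0 := by rw [dotProduct_comm]; exact dot_self_cross x y
  have hyy : (x ⨯₃ y) ⬝ᵥ y = 0 := by rw [dotProduct_comm]; exact dot_cross_self x y
  -- The sign `t` orients the cross product of two edges of the face away from the opposite vertex
  -- `a`.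
  obtain ⟨t, ht2, htneg⟩ : ∃ t : ℝ, t * t = 1 ∧ t * (z ⬝ᵥ (x ⨯₃ y)) < 0 := by
    rcases lt_or_gt_of_ne hdet with hneg | hpos
    · exact ⟨1, by norm_num, by linarith⟩
    · exact ⟨-1, by norm_num, by linarith⟩
  have dotb : ∀ p ∈ ({b, c, d} : Finset E3), (x ⨯₃ y) ⬝ᵥ (p - b).ofLp = 0 := by
    intro p hp
    simp only [Finset.mem_insert, Finset.mem_singleton] at hp
    rcases hp with rfl | rfl | rfl
    · simp
    · exact hxx
    · exact hyy
  refine ⟨(t / r) • (x ⨯₃ y), ⟨?_, ?_⟩, ?_⟩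
  · simp only [smul_dotProduct, dotProduct_smul, smul_eq_mul, ← hrr]
    field_simp
    linarith
  · intro p hp q hq
    have : (q - p).ofLp = (q - b).ofLp - (p - b).ofLp := by ext i; simp
    rw [smul_dotProduct, this, dotProduct_sub, dotb p hp, dotb q hq]
    simp
  · intro p hp q hq hqe
    have hqa : q = a := by
      rw [h, Finset.mem_insert] at hq
      exact hq.resolve_right hqe
    subst hqa
    have : (q - p).ofLp = z - (p - b).ofLp := by ext i; simp [z]
    rw [smul_dotProduct, this, dotProduct_sub, dotb p hp, sub_zero, smul_eq_mul, dotProduct_comm,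
      div_mul_eq_mul_div]
    exact div_neg_of_neg_of_pos htneg hrpos

lemma exists_opposite_vertex {K e : Finset E3} (hK : IsTet K) (he : e ⊆ K) (hc : e.card = 3) :
    ∃ a b c d, a ≠ b ∧ a ≠ c ∧ a ≠ d ∧ b ≠ c ∧ b ≠ d ∧ c ≠ d ∧ K = {a, b, c, d} ∧
      e = {b, c, d} := by
  obtain ⟨b, c, d, hbc, hbd, hcd, rfl⟩ := Finset.card_eq_three.1 hc
  have h1 : (K \ {b, c, d}).card = 1 := by
    rw [Finset.card_sdiff_of_subset he, hK.card_eq, hc]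
  obtain ⟨a, ha⟩ := Finset.card_eq_one.1 h1
  have ha' : a ∈ K \ {b, c, d} := by simp [ha]
  simp only [Finset.mem_sdiff, Finset.mem_insert, Finset.mem_singleton, not_or] at ha'
  refine ⟨a, b, c, d, ha'.2.1, ha'.2.2.1, ha'.2.2.2, hbc, hbd, hcd, ?_, rfl⟩
  rw [← Finset.sdiff_union_of_subset he, ha]
  rfl

lemma isOuterNormal_outerNormal {K e : Finset E3} (hK : IsTet K) (he : e ⊆ K) (hc : e.card = 3) :
    IsOuterNormal K e (outerNormal K e) := by
  obtain ⟨a, b, c, d, hab, hac, had, hbc, hbd, hcd, h, rfl⟩ := exists_opposite_vertex hK he hc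
  exact Classical.epsilon_spec
    (exists_isOuterNormal_of_eq_insert hK hab hac had hbc hbd hcd h)

lemma powersetCard_three_eq {a b c d : E3}
    (hab : a ≠ b) (hac : a ≠ c) (had : a ≠ d) (hbc : b ≠ c) (hbd : b ≠ d) (hcd : c ≠ d) :
    Finset.powersetCard 3 ({a, b, c, d} : Finset E3) =
      {{b, c, d}, {a, c, d}, {a, b, d}, {a, b, c}} := by
  ext e
  simp only [Finset.mem_powersetCard, Finset.mem_insert, Finset.mem_singleton]
  constructor
  · rintro ⟨he, hc⟩
    have h4 : ({a, b, c, d} : Finset E3).card = 4 := by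
      rw [Finset.card_insert_of_notMem, Finset.card_eq_three.2 ⟨b, c, d, hbc, hbd, hcd, rfl⟩]
      simp [hab, hac, had]
    obtain ⟨p, hp⟩ := Finset.card_eq_one.1
      (show (({a, b, c, d} : Finset E3) \ e).card = 1 by
        rw [Finset.card_sdiff_of_subset he, h4, hc])
    have he' : e = ({a, b, c, d} : Finset E3).erase p := by
      rw [← Finset.sdiff_singleton_eq_erase, ← hp, Finset.sdiff_sdiff_eq_self he]
    have hpm : p ∈ ({a, b, c, d} : Finset E3) := by
      have : p ∈ ({a, b, c, d} : Finset E3) \ e := by simp [hp]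
      exact (Finset.mem_sdiff.1 this).1
    simp only [Finset.mem_insert, Finset.mem_singleton] at hpm
    rcases hpm with rfl | rfl | rfl | rfl
    · left; rw [he']; ext x; simp; grind
    · right; left; rw [he']; ext x; simp; grind
    · right; right; left; rw [he']; ext x; simp; grind
    · right; right; right; rw [he']; ext x; simp; grind
  · rintro (rfl | rfl | rfl | rfl)
    · exact ⟨by grind, Finset.card_eq_three.2 ⟨_, _, _, hbc, hbd, hcd, rfl⟩⟩
    · exact ⟨by grind, Finset.card_eq_three.2 ⟨_, _, _, hac, had, hcd, rfl⟩⟩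
    · exact ⟨by grind, Finset.card_eq_three.2 ⟨_, _, _, hab, had, hbd, rfl⟩⟩
    · exact ⟨by grind, Finset.card_eq_three.2 ⟨_, _, _, hab, hac, hbc, rfl⟩⟩

/-- The two faces that contain the edge from `a` to `b` have normals orthogonal to `b - a`, so they
can be added to the formula for the other two faces at no cost. -/
lemma setIntegral_fderiv_sub_tetrahedron {K : Finset E3} (hK : IsTet K) {f : E3 → ℝ}
    (hf : ContDiff ℝ 1 f) {a b : E3} (ha : a ∈ K) (hb : b ∈ K) :
    ∫ x in convexHull ℝ (K : Set E3), fderiv ℝ f x (b - a) =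
      ∑ e ∈ K.powersetCard 3, (outerNormal K e ⬝ᵥ (b - a).ofLp) *
        ∫ x in convexHull ℝ (e : Set E3), f x ∂μHE[2] := by
  by_cases hab : a = b
  · subst hab; simp
  replace hab : a ≠ b := hab
  obtain ⟨c, d, hac, had, hbc, hbd, hcd, rfl⟩ := hK.exists_eq_insert ha hb hab
  have ea := isOuterNormal_outerNormal hK (e := {b, c, d}) (by grind)
    (Finset.card_eq_three.2 ⟨_, _, _, hbc, hbd, hcd, rfl⟩)
  have eb := isOuterNormal_outerNormal hK (e := {a, c, d}) (by grind)
    (Finset.card_eq_three.2 ⟨_, _, _, hac, had, hcd, rfl⟩)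
  have ec := isOuterNormal_outerNormal hK (e := {a, b, d}) (by grind)
    (Finset.card_eq_three.2 ⟨_, _, _, hab, had, hbd, rfl⟩)
  have ed := isOuterNormal_outerNormal hK (e := {a, b, c}) (by grind)
    (Finset.card_eq_three.2 ⟨_, _, _, hab, hac, hbc, rfl⟩)
  have main := setIntegral_fderiv_edge_tetrahedron hK.indep (a := a) (b := b) (c := c) (d := d)
    (by simp) (by simp) (by simp) (by simp) hab hac had hbc hbd hcd hf
    ea.1.1 (ea.1.2 b (by simp) c (by simp)) (ea.1.2 b (by simp) d (by simp)) ?_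
    eb.1.1 (eb.1.2 a (by simp) c (by simp)) (eb.1.2 a (by simp) d (by simp))
    (eb.2 a (by simp) b (by simp) (by simp [hab.symm, hbc, hbd])).le
  · rw [powersetCard_three_eq hab hac had hbc hbd hcd]
    rw [Finset.sum_insert, Finset.sum_insert, Finset.sum_insert, Finset.sum_singleton,
      ec.1.2 a (by simp) b (by simp), ed.1.2 a (by simp) b (by simp)]
    · push_cast
      rw [main]
      ring
    · intro h
      rw [Finset.mem_singleton] at h
      have : d ∈ ({a, b, c} : Finset E3) := h ▸ (by simp)
      simp [had.symm, hbd.symm, hcd.symm] at this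
    · intro h
      have : ∀ e ∈ ({{a, b, d}, {a, b, c}} : Finset (Finset E3)), b ∈ e := by simp
      have := this _ h
      simp [hab.symm, hbc, hbd] at this
    · intro h
      have : ∀ e ∈ ({{a, c, d}, {a, b, d}, {a, b, c}} : Finset (Finset E3)), a ∈ e := by simp
      have := this _ h
      simp [hab, hac, had] at this
  · have := ea.2 b (by simp) a (by simp) (by simp [hab, hac, had])
    have h2 : (b - a).ofLp = -(a - b).ofLp := by ext i; simp
    rw [h2, dotProduct_neg]
    linarith

lemma IsTet.span_eq_top {K : Finset E3} (hK : IsTet K) {a : E3} (ha : a ∈ K) :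
    Submodule.span ℝ {v | ∃ b ∈ K, v = b - a} = ⊤ := by
  obtain ⟨b, hb, hba⟩ := Finset.exists_mem_ne (s := K) (by rw [hK.card_eq]; norm_num) a
  obtain ⟨c, d, hac, had, hbc, hbd, hcd, h⟩ := hK.exists_eq_insert ha hb hba.symm
  have li := linearIndependent_three hK.indep (a := a) (b := b) (c := c) (d := d) ha hb
    (by simp [h]) (by simp [h]) hba.symm hac had hbc hbd hcd
  rw [eq_top_iff, ← li.span_eq_top_of_card_eq_finrank' (by simp)]
  refine Submodule.span_mono ?_
  rintro _ ⟨i, rfl⟩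
  fin_cases i
  · exact ⟨b, hb, rfl⟩
  · exact ⟨c, by simp [h], rfl⟩
  · exact ⟨d, by simp [h], rfl⟩

lemma isCompact_convexHull_finset (K : Finset E3) : IsCompact (convexHull ℝ (K : Set E3)) :=
  K.finite_toSet.isCompact_convexHull ℝ

/-- Both sides are linear in `v`, and the edges from a single vertex span the space. -/
lemma setIntegral_fderiv_tetrahedron {K : Finset E3} (hK : IsTet K) {f : E3 → ℝ}
    (hf : ContDiff ℝ 1 f) (v : E3) :
    ∫ x in convexHull ℝ (K : Set E3), fderiv ℝ f x v =
      ∑ e ∈ K.powersetCard 3, (outerNormal K e ⬝ᵥ v.ofLp) *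
        ∫ x in convexHull ℝ (e : Set E3), f x ∂μHE[2] := by
  obtain ⟨a, ha⟩ : K.Nonempty := Finset.card_pos.1 (by rw [hK.card_eq]; norm_num)
  have hv : v ∈ Submodule.span ℝ {v | ∃ b ∈ K, v = b - a} := by rw [hK.span_eq_top ha]; trivial
  have hint : ∀ v, IntegrableOn (fun x => fderiv ℝ f x v) (convexHull ℝ (K : Set E3)) volume :=
    fun v => ((hf.continuous_fderiv one_ne_zero).clm_apply
      continuous_const).continuousOn.integrableOn_compact (isCompact_convexHull_finset K)
  induction hv using Submodule.span_induction with
  | mem x h =>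
    obtain ⟨b, hb, rfl⟩ := h
    exact setIntegral_fderiv_sub_tetrahedron hK hf ha hb
  | zero => simp
  | add x y _ _ hx hy =>
    simp only [map_add, WithLp.ofLp_add, dotProduct_add, add_mul, Finset.sum_add_distrib]
    rw [integral_add (hint x) (hint y), hx, hy]
  | smul c x _ hx =>
    simp only [map_smul, WithLp.ofLp_smul, dotProduct_smul, smul_eq_mul, mul_assoc,
      ← Finset.mul_sum]
    rw [integral_const_mul, hx]

lemma euclideanHausdorffMeasure_triangle_lt_top {e : Finset E3} (he : e.card = 3) :
    (μHE[2] : Measure E3) (convexHull ℝ (e : Set E3)) < ⊤ := by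
  obtain ⟨a, b, c, -, -, -, rfl⟩ := Finset.card_eq_three.1 he
  have := euclideanHausdorffMeasure_convexHull_lt_top a ![b - a, c - a]
  convert this using 3
  ext x
  simp [Fin.exists_fin_two, eq_comm]

lemma integrableOn_triangle {e : Finset E3} (he : e.card = 3) {g : E3 → ℝ} (hg : Continuous g) :
    IntegrableOn g (convexHull ℝ (e : Set E3)) μHE[2] :=
  hg.continuousOn.integrableOn_of_subset_isCompact (isCompact_convexHull_finset e)
    (isCompact_convexHull_finset e).measurableSet subset_rfl
    (euclideanHausdorffMeasure_triangle_lt_top he).ne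

/-- **Divergence theorem** on a tetrahedron. -/
theorem setIntegral_divergence_tetrahedron {K : Finset E3} (hK : IsTet K)
    {F : Fin 3 → E3 → ℝ} (hF : ∀ i, ContDiff ℝ 1 (F i)) :
    ∫ x in convexHull ℝ (K : Set E3), ∑ i, partialD i (F i) x =
      ∑ e ∈ K.powersetCard 3, ∫ x in convexHull ℝ (e : Set E3),
        (fun i => F i x) ⬝ᵥ outerNormal K e ∂μHE[2] := by
  rw [integral_finsetSum]
  · simp only [partialD, setIntegral_fderiv_tetrahedron hK (hF _)]
    rw [Finset.sum_comm]
    refine Finset.sum_congr rfl fun e he => ?_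
    simp only [dotProduct]
    rw [integral_finsetSum]
    · refine Finset.sum_congr rfl fun i _ => ?_
      rw [integral_mul_const, mul_comm]
      congr 1
      simp
    · intro i _
      exact (integrableOn_triangle (Finset.mem_powersetCard.1 he).2 (hF i).continuous).mul_const _
  · intro i _
    exact (((hF i).continuous_fderiv one_ne_zero).clm_apply
      continuous_const).continuousOn.integrableOn_compact (isCompact_convexHull_finset K)

/-! ### Geometry of tetrahedral meshes -/

namespace TetMesh

variable {M : TetMesh}

lemma mem_cells {K : Finset E3} : K ∈ M.cells ↔ K ∈ M.faces ∧ K.card = 4 := by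
  simp [cells]

lemma isTet_of_mem_cells {K : Finset E3} (hK : K ∈ M.cells) : IsTet K :=
  ⟨(mem_cells.1 hK).2, M.indep (mem_cells.1 hK).1⟩

/-- By conformity the intersection lies in the hull of the common vertices. There are at most three
of these, so their affine span is a proper, hence null, subspace. -/
lemma measure_convexHull_inter {K L : Finset E3} (hK : K ∈ M.cells) (hL : L ∈ M.cells)
    (h : K ≠ L) : volume (convexHull ℝ (K : Set E3) ∩ convexHull ℝ (L : Set E3)) = 0 := by
  have h1 := M.inter_subset_convexHull (mem_cells.1 hK).1 (mem_cells.1 hL).1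
  rw [← Finset.coe_inter] at h1
  refine measure_mono_null (h1.trans (convexHull_subset_affineSpan _)) ?_
  refine Measure.addHaar_affineSubspace _ _ fun htop => ?_
  have hcard : (K ∩ L).card ≤ 3 := by
    have hss : K ∩ L ⊂ K := by
      refine Finset.ssubset_iff_subset_ne.2 ⟨Finset.inter_subset_left, fun he => h ?_⟩
      exact Finset.eq_of_subset_of_card_le (Finset.inter_eq_left.1 he)
        (by rw [(mem_cells.1 hK).2, (mem_cells.1 hL).2])
    have := Finset.card_lt_card hss
    rw [(mem_cells.1 hK).2] at this
    omega
  have hpos : 0 < (K ∩ L).card := by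
    rcases Finset.eq_empty_or_nonempty (K ∩ L) with h0 | h0
    · rw [h0] at htop
      simp at htop
    · exact Finset.card_pos.2 h0
  obtain ⟨n, hn⟩ : ∃ n, (K ∩ L).card = n + 1 := ⟨(K ∩ L).card - 1, by omega⟩
  have h2 := finrank_vectorSpan_image_finset_le ℝ (id : E3 → E3) (K ∩ L) hn
  rw [Finset.coe_image, Set.image_id, ← direction_affineSpan, htop, AffineSubspace.direction_top,
    finrank_top, finrank_euclideanSpace_fin] at h2
  omega

/-- A nonempty open set has positive measure. This makes the choice of a tetrahedron in `val`
unambiguous. -/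
lemma eq_of_mem_interior_convexHull {K L : Finset E3} (hK : K ∈ M.cells) (hL : L ∈ M.cells)
    {x : E3} (hxK : x ∈ interior (convexHull ℝ (K : Set E3)))
    (hxL : x ∈ interior (convexHull ℝ (L : Set E3))) : K = L := by
  by_contra h
  have h0 : volume (interior (convexHull ℝ (K : Set E3)) ∩ interior (convexHull ℝ (L : Set E3)))
      = 0 := measure_mono_null (Set.inter_subset_inter interior_subset interior_subset)
        (measure_convexHull_inter hK hL h)
  exact ((isOpen_interior.inter isOpen_interior).measure_pos volume ⟨x, hxK, hxL⟩).ne' h0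

lemma val_of_mem_interior (f : M.Scalar) (K : M.cells) {x : E3}
    (hx : x ∈ interior (convexHull ℝ (K.1 : Set E3))) :
    val f x = MvPolynomial.eval x.ofLp (f K) := by
  have h : ∃ K : M.cells, x ∈ interior (convexHull ℝ (K.1 : Set E3)) := ⟨K, hx⟩
  have h1 : h.choose = K :=
    Subtype.ext (eq_of_mem_interior_convexHull h.choose.2 K.2 h.choose_spec hx)
  rw [val, dif_pos h, h1]

lemma ae_mem_interior_convexHull (K : Finset E3) :
    ∀ᵐ x ∂volume.restrict (convexHull ℝ (K : Set E3)),
      x ∈ interior (convexHull ℝ (K : Set E3)) := by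
  have hf := (convex_convexHull ℝ (K : Set E3)).addHaar_frontier volume
  have hm : MeasurableSet (convexHull ℝ (K : Set E3)) :=
    (isCompact_convexHull_finset K).measurableSet
  rw [ae_restrict_iff' hm]
  filter_upwards [compl_mem_ae_iff.2 hf] with x hx hxK
  by_contra hxi
  exact hx ⟨subset_closure hxK, hxi⟩

lemma space_eq_iUnion : M.toSimplicialComplex.space =
    ⋃ K : M.cells, convexHull ℝ (K.1 : Set E3) := by
  apply Set.Subset.antisymm
  · intro x hx
    obtain ⟨s, hs, hxs⟩ := Geometry.SimplicialComplex.mem_space_iff.1 hx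
    obtain ⟨t, ht, hst, htc⟩ := M.pure_three s hs
    exact Set.mem_iUnion.2 ⟨⟨t, mem_cells.2 ⟨ht, htc⟩⟩,
      convexHull_mono (by exact_mod_cast hst) hxs⟩
  · refine Set.iUnion_subset fun K => ?_
    exact Geometry.SimplicialComplex.convexHull_subset_space (mem_cells.1 K.2).1

lemma isCompact_space : IsCompact M.toSimplicialComplex.space := by
  rw [space_eq_iUnion]
  exact isCompact_iUnion fun K => isCompact_convexHull_finset K.1

lemma interior_convexHull_subset_domain (K : M.cells) :
    interior (convexHull ℝ (K.1 : Set E3)) ⊆ M.domain :=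
  interior_mono (Geometry.SimplicialComplex.convexHull_subset_space (mem_cells.1 K.2).1)

lemma isOpen_domain : IsOpen M.domain := isOpen_interior

lemma isBounded_domain : Bornology.IsBounded M.domain :=
  isCompact_space.isBounded.subset interior_subset

lemma measure_domain_lt_top : volume M.domain < ⊤ := isBounded_domain.measure_lt_top

instance : IsFiniteMeasure (volume.restrict M.domain) :=
  ⟨by rw [Measure.restrict_apply_univ]; exact measure_domain_lt_top⟩

/-- Frontiers of convex sets are null, so almost every point of a tetrahedron is interior to it and
therefore interior to the union. -/
lemma domain_ae_eq_iUnion : M.domain =ᵐ[volume] ⋃ K : M.cells, convexHull ℝ (K.1 : Set E3) := by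
  rw [← space_eq_iUnion]
  refine Filter.EventuallyLE.antisymm (Filter.Eventually.of_forall interior_subset) ?_
  have h : ∀ K : M.cells, ∀ᵐ x ∂volume, x ∈ convexHull ℝ (K.1 : Set E3) →
      x ∈ interior (convexHull ℝ (K.1 : Set E3)) := fun K =>
    (ae_restrict_iff' (isCompact_convexHull_finset K.1).measurableSet).1
      (ae_mem_interior_convexHull K.1)
  filter_upwards [ae_all_iff.2 h] with x hx hxs
  rw [space_eq_iUnion] at hxs
  obtain ⟨K, hK⟩ := Set.mem_iUnion.1 hxs
  exact interior_convexHull_subset_domain K (hx K hK)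

lemma ae_domain_iff {p : E3 → Prop} : (∀ᵐ x ∂volume.restrict M.domain, p x) ↔
    ∀ K : M.cells, ∀ᵐ x ∂volume.restrict (convexHull ℝ (K.1 : Set E3)), p x := by
  rw [Measure.restrict_congr_set domain_ae_eq_iUnion, ae_restrict_iUnion_iff]

lemma val_ae_eq (f : M.Scalar) (K : M.cells) :
    ∀ᵐ x ∂volume.restrict (convexHull ℝ (K.1 : Set E3)),
      val f x = MvPolynomial.eval x.ofLp (f K) := by
  filter_upwards [ae_mem_interior_convexHull K.1] with x hx using val_of_mem_interior f K hx

lemma integrableOn_domain_iff {E : Type*} [NormedAddCommGroup E] {g : E3 → E} :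
    IntegrableOn g M.domain ↔
      ∀ K : M.cells, IntegrableOn g (convexHull ℝ (K.1 : Set E3)) := by
  rw [integrableOn_congr_set_ae domain_ae_eq_iUnion, integrableOn_finite_iUnion]

lemma setIntegral_domain {g : E3 → ℝ} (hg : IntegrableOn g M.domain) :
    ∫ x in M.domain, g x = ∑ K : M.cells, ∫ x in convexHull ℝ (K.1 : Set E3), g x := by
  rw [setIntegral_congr_set domain_ae_eq_iUnion, integral_iUnion_ae]
  · exact tsum_fintype _
  · exact fun K => (isCompact_convexHull_finset K.1).measurableSet.nullMeasurableSet
  · intro K L hKL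
    exact measure_convexHull_inter K.2 L.2 fun h => hKL (Subtype.ext h)
  · rwa [← integrableOn_congr_set_ae domain_ae_eq_iUnion]

/-! ### Interior faces -/

/-- Both normals are parallel to the nonzero cross product of two edges, and unit length leaves only
the sign free. -/
lemma eq_or_eq_neg_of_isUnitNormal {e : Finset E3} (he : e.card = 3)
    (hi : AffineIndependent ℝ ((↑) : e → E3)) {n n' : Fin 3 → ℝ} (hn : IsUnitNormal e n)
    (hn' : IsUnitNormal e n') : n' = n ∨ n' = -n := by
  obtain ⟨b, c, d, hbc, hbd, hcd, rfl⟩ := Finset.card_eq_three.1 he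
  have li := linearIndependent_two hi (a := b) (b := c) (c := d) (by simp) (by simp) (by simp)
    hbc hbd hcd
  set x := (c - b).ofLp
  set y := (d - b).ofLp
  have h1 := cross_eq_smul_of_orthogonal hn.1 (hn.2 b (by simp) c (by simp))
    (hn.2 b (by simp) d (by simp))
  have h2 := cross_eq_smul_of_orthogonal hn'.1 (hn'.2 b (by simp) c (by simp))
    (hn'.2 b (by simp) d (by simp))
  have h0 : x ⨯₃ y ≠ 0 := by
    intro h0
    have h3 := normDet_frameMap_two_sq (c - b) (d - b)
    change _ = (x ⨯₃ y) ⬝ᵥ (x ⨯₃ y) at h3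
    rw [h0, zero_dotProduct, sq_eq_zero_iff] at h3
    exact LinearMap.normDet_eq_zero_iff_ker_ne_bot.1 h3
      (LinearMap.ker_eq_bot.2 (frameMap_injective li))
  change x ⨯₃ y = (n ⬝ᵥ (x ⨯₃ y)) • n at h1
  change x ⨯₃ y = (n' ⬝ᵥ (x ⨯₃ y)) • n' at h2
  set l := n ⬝ᵥ (x ⨯₃ y)
  set l' := n' ⬝ᵥ (x ⨯₃ y)
  have h4 : l • n = l' • n' := h1.symm.trans h2
  have h5 : l ^ 2 = l' ^ 2 := by
    have := congrArg (fun v => v ⬝ᵥ v) h4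
    simp only [smul_dotProduct, dotProduct_smul, hn.1, hn'.1, smul_eq_mul] at this
    linarith
  have hl' : l' ≠ 0 := fun h => h0 (by rw [h2, h, zero_smul])
  rcases sq_eq_sq_iff_eq_or_eq_neg.1 h5 with h | h
  · left
    rw [h] at h4
    exact (smul_right_injective _ hl' h4).symm
  · right
    rw [h, neg_smul, ← smul_neg] at h4
    exact (smul_right_injective _ hl' h4).symm

lemma dotProduct_convexHull_eq_zero {e : Finset E3} {n : Fin 3 → ℝ} {b : E3}
    (h : ∀ p ∈ e, n ⬝ᵥ (p - b).ofLp = 0) {x : E3} (hx : x ∈ convexHull ℝ (e : Set E3)) :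
    n ⬝ᵥ (x - b).ofLp = 0 := by
  have hc : Convex ℝ {x : E3 | n ⬝ᵥ (x - b).ofLp = 0} := by
    intro p hp q hq s t _ _ hst
    simp only [Set.mem_ofPred_eq] at hp hq ⊢
    have : s • p + t • q - b = s • (p - b) + t • (q - b) := by
      have hb : b = (s + t) • b := by rw [hst, one_smul]
      nth_rewrite 1 [hb]
      module
    rw [this]
    simp only [WithLp.ofLp_add, WithLp.ofLp_smul, dotProduct_add, dotProduct_smul, hp, hq,
      smul_zero, add_zero]
  exact convexHull_min (fun p hp => h p hp) hc hx

/-- Two tetrahedra that share a face lie on opposite sides of it. -/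
lemma outerNormal_eq_neg {K L e : Finset E3} (hK : K ∈ M.cells) (hL : L ∈ M.cells) (hKL : K ≠ L)
    (heK : e ⊆ K) (heL : e ⊆ L) (he : e.card = 3) : outerNormal L e = -outerNormal K e := by
  have tK := isTet_of_mem_cells hK
  have tL := isTet_of_mem_cells hL
  have nK := isOuterNormal_outerNormal tK heK he
  have nL := isOuterNormal_outerNormal tL heL he
  have hi : AffineIndependent ℝ ((↑) : e → E3) := tK.indep.mono (by exact_mod_cast heK)
  -- If the normals agreed, the opposite vertices `a'` of `K` and `a` of `L` would lie on the same
  -- side of `e`. A point slightly off the centroid of `e` towards `a'` would then lie in both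
  -- tetrahedra but not in the plane of `e`, although the two meet only in the hull of `e`.
  refine (eq_or_eq_neg_of_isUnitNormal he hi nK.1 nL.1).resolve_left fun heq => ?_
  have hint : K ∩ L = e := by
    refine (Finset.eq_of_subset_of_card_le (Finset.subset_inter heK heL) ?_).symm
    have hss : K ∩ L ⊂ K := by
      refine Finset.ssubset_iff_subset_ne.2 ⟨Finset.inter_subset_left, fun he => hKL ?_⟩
      exact Finset.eq_of_subset_of_card_le (Finset.inter_eq_left.1 he)
        (by rw [tK.card_eq, tL.card_eq])
    have := Finset.card_lt_card hss
    rw [tK.card_eq] at this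
    omega
  obtain ⟨a', b', c', d', -, -, -, -, -, -, hKeq, heq'⟩ := exists_opposite_vertex tK heK he
  obtain ⟨a, b, c, d, hab, hac, had, hbc, hbd, hcd, hLeq, rfl⟩ := exists_opposite_vertex tL heL he
  have ha'K : a' ∈ K := by simp [hKeq]
  have ha'e : a' ∉ ({b, c, d} : Finset E3) := by
    intro h
    have hK4 := tK.card_eq
    rw [hKeq, Finset.insert_eq_of_mem (heq' ▸ h), ← heq', he] at hK4
    omega
  have hae : a ∉ ({b, c, d} : Finset E3) := by simp [hab, hac, had]
  set n := outerNormal K {b, c, d}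
  have hna' : n ⬝ᵥ (a' - b).ofLp < 0 := nK.2 b (by simp) a' ha'K ha'e
  have hna : n ⬝ᵥ (a - b).ofLp < 0 := heq ▸ nL.2 b (by simp) a (by simp [hLeq]) hae
  have hnc : n ⬝ᵥ (c - b).ofLp = 0 := nK.1.2 b (by simp) c (by simp)
  have hnd : n ⬝ᵥ (d - b).ofLp = 0 := nK.1.2 b (by simp) d (by simp)
  have li := linearIndependent_three tL.indep (a := b) (b := a) (c := c) (d := d)
    (by simp [hLeq]) (by simp [hLeq]) (by simp [hLeq]) (by simp [hLeq]) hab.symm hbc hbd hac had hcd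
  set q : E3 := (1 / 3 : ℝ) • b + (1 / 3 : ℝ) • c + (1 / 3 : ℝ) • d with hq
  have hspan : a' - q ∈ Submodule.span ℝ (Set.range ![a - b, c - b, d - b]) := by
    rw [li.span_eq_top_of_card_eq_finrank' (by simp)]
    trivial
  obtain ⟨k, hk⟩ := (Submodule.mem_span_range_iff_exists_fun ℝ).1 hspan
  simp only [Fin.sum_univ_three, Matrix.cons_val_zero, Matrix.cons_val_one, Matrix.cons_val] at hk
  have hqb : n ⬝ᵥ (q - b).ofLp = 0 := by
    have : q - b = (1 / 3 : ℝ) • (c - b) + (1 / 3 : ℝ) • (d - b) := by rw [hq]; module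
    rw [this]
    simp only [WithLp.ofLp_add, WithLp.ofLp_smul, dotProduct_add, dotProduct_smul, hnc, hnd,
      smul_zero, add_zero]
  -- Taking the component along `n` gives `n · (a' - b) = k 0 * (n · (a - b))`, with both inner
  -- products negative.
  have hk0 : 0 < k 0 := by
    have h1 : n ⬝ᵥ (a' - q).ofLp = n ⬝ᵥ (a' - b).ofLp := by
      have : a' - q = (a' - b) - (q - b) := by abel
      rw [this, WithLp.ofLp_sub, dotProduct_sub, hqb, sub_zero]
    rw [← hk] at h1
    simp only [WithLp.ofLp_add, WithLp.ofLp_smul, dotProduct_add, dotProduct_smul, hnc, hnd,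
      smul_eq_mul, mul_zero, add_zero] at h1
    by_contra hneg
    nlinarith
  -- The centroid `q` has weights `1/3` at `b`, `c`, `d`. Since `S` dominates each `|k i|` and `|k 0
  -- + k 1 + k 2|`, the step `t = 1 / (3 * S)` changes these weights by at most `1/3` and keeps them
  -- nonnegative.
  set S := 1 + |k 0| + |k 1| + |k 2| with hS
  have hSpos : 0 < S := by positivity
  set t := 1 / (3 * S) with ht
  have htpos : 0 < t := by positivity
  have htS : t * S = 1 / 3 := by rw [ht]; field_simp
  have ht1 : t ≤ 1 := by
    have : 1 ≤ S := by rw [hS]; linarith [abs_nonneg (k 0), abs_nonneg (k 1), abs_nonneg (k 2)]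
    nlinarith
  have hbound : ∀ r : ℝ, |r| ≤ S → |t * r| ≤ 1 / 3 := by
    intro r hr
    rw [abs_mul, abs_of_pos htpos, ← htS]
    exact mul_le_mul_of_nonneg_left hr htpos.le
  set x := q + t • (a' - q) with hx
  have hqe : ∀ s : Set E3, Convex ℝ s → b ∈ s → c ∈ s → d ∈ s → q ∈ s := by
    intro s hs h1 h2 h3
    have := hs.sum_mem (t := Finset.univ) (w := ![1 / 3, 1 / 3, 1 / 3]) (z := ![b, c, d])
      (by intro i _; fin_cases i <;> norm_num) (by simp [Fin.sum_univ_three]; norm_num)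
      (by intro i _; fin_cases i <;> simpa)
    simpa [Fin.sum_univ_three, hq] using this
  have hxK : x ∈ convexHull ℝ (K : Set E3) := by
    have hs := subset_convexHull ℝ (K : Set E3)
    have h1 := hqe _ (convex_convexHull ℝ (K : Set E3)) (hs (heK (by simp))) (hs (heK (by simp)))
      (hs (heK (by simp)))
    have h2 : a' ∈ convexHull ℝ (K : Set E3) := hs ha'K
    have : x = (1 - t) • q + t • a' := by rw [hx]; module
    rw [this]
    exact (convex_convexHull ℝ (K : Set E3)) h1 h2 (by linarith) htpos.le (by ring)
  have hxL : x ∈ convexHull ℝ (L : Set E3) := by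
    have hs := subset_convexHull ℝ (L : Set E3)
    have := (convex_convexHull ℝ (L : Set E3)).sum_mem (t := Finset.univ)
      (w := ![t * k 0, 1 / 3 - t * (k 0 + k 1 + k 2), 1 / 3 + t * k 1, 1 / 3 + t * k 2])
      (z := ![a, b, c, d]) ?_ ?_ ?_
    · convert this using 1
      simp only [Fin.sum_univ_four, Matrix.cons_val_zero, Matrix.cons_val_one, Matrix.cons_val]
      rw [hx, ← hk, hq]
      module
    · have e1 := abs_le.1 (hbound (k 0 + k 1 + k 2)
        (by rw [hS]; linarith [abs_add_three (k 0) (k 1) (k 2)]))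
      have e2 := abs_le.1 (hbound (k 1) (by rw [hS]; linarith [abs_nonneg (k 0), abs_nonneg (k 2)]))
      have e3 := abs_le.1 (hbound (k 2) (by rw [hS]; linarith [abs_nonneg (k 0), abs_nonneg (k 1)]))
      intro i _
      fin_cases i
      · exact (mul_pos htpos hk0).le
      · change 0 ≤ 1 / 3 - t * (k 0 + k 1 + k 2)
        linarith
      · change 0 ≤ 1 / 3 + t * k 1
        linarith
      · change 0 ≤ 1 / 3 + t * k 2
        linarith
    · simp only [Fin.sum_univ_four, Matrix.cons_val_zero, Matrix.cons_val_one, Matrix.cons_val]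
      ring
    · intro i _
      fin_cases i <;> exact hs (by simp [hLeq])
  have hxe := M.inter_subset_convexHull (mem_cells.1 hK).1 (mem_cells.1 hL).1 ⟨hxK, hxL⟩
  rw [← Finset.coe_inter, hint] at hxe
  have h0 := dotProduct_convexHull_eq_zero (n := n) (b := b)
    (fun p hp => nK.1.2 b (by simp) p hp) hxe
  have h1 : x - b = (1 - t) • (q - b) + t • (a' - b) := by rw [hx]; module
  rw [h1] at h0
  simp only [WithLp.ofLp_add, WithLp.ofLp_smul, dotProduct_add, dotProduct_smul, hqb,
    smul_eq_mul, mul_zero, zero_add] at h0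
  exact (mul_neg_of_pos_of_neg htpos hna').ne h0

open Classical in
/-- A triangle lies in at most two tetrahedra. -/
lemma card_filter_subset_le_two (e : Finset E3) (he : e.card = 3) :
    (Finset.univ.filter fun K : M.cells => e ⊆ K.1).card ≤ 2 := by
  by_contra h
  obtain ⟨K, L, P, hK, hL, hP, hKL, hKP, hLP⟩ := Finset.two_lt_card_iff.1 (not_le.1 h)
  simp only [Finset.mem_filter, Finset.mem_univ, true_and] at hK hL hP
  -- Three unit normals cannot be pairwise opposite: the one of `K` would equal its own negative.
  have h1 := outerNormal_eq_neg K.2 L.2 (fun h => hKL (Subtype.ext h)) hK hL he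
  have h2 := outerNormal_eq_neg K.2 P.2 (fun h => hKP (Subtype.ext h)) hK hP he
  have h3 := outerNormal_eq_neg L.2 P.2 (fun h => hLP (Subtype.ext h)) hL hP he
  have h4 := (isOuterNormal_outerNormal (isTet_of_mem_cells K.2) hK he).1.1
  rw [h2, h1, neg_neg] at h3
  have h5 : outerNormal K.1 e = 0 := by
    ext i
    have := congrFun h3 i
    simp only [Pi.neg_apply] at this
    simp only [Pi.zero_apply]
    linarith
  rw [h5] at h4
  simp at h4

/-- Distinct triangles share at most two vertices, so they meet within a segment; its length is
finite and its area therefore zero. -/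
lemma measure_convexHull_inter_triangle {e e' : Finset E3} (he : e ∈ M.faces) (he' : e' ∈ M.faces)
    (hc : e.card = 3) (hc' : e'.card = 3) (h : e ≠ e') :
    (μHE[2] : Measure E3) (convexHull ℝ (e : Set E3) ∩ convexHull ℝ (e' : Set E3)) = 0 := by
  have h1 := M.inter_subset_convexHull he he'
  rw [← Finset.coe_inter] at h1
  refine measure_mono_null h1 ?_
  have hcard : (e ∩ e').card ≤ 2 := by
    have hss : e ∩ e' ⊂ e := by
      refine Finset.ssubset_iff_subset_ne.2 ⟨Finset.inter_subset_left, fun he => h ?_⟩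
      exact Finset.eq_of_subset_of_card_le (Finset.inter_eq_left.1 he) (by rw [hc, hc'])
    have := Finset.card_lt_card hss
    omega
  have hseg : ∃ x y : E3, convexHull ℝ ((e ∩ e' : Finset E3) : Set E3) ⊆ segment ℝ x y := by
    have : (e ∩ e').card = 0 ∨ (e ∩ e').card = 1 ∨ (e ∩ e').card = 2 := by omega
    rcases this with h0 | h0 | h0
    · rw [Finset.card_eq_zero] at h0
      exact ⟨0, 0, by simp [h0]⟩
    · obtain ⟨x, hx⟩ := Finset.card_eq_one.1 h0
      exact ⟨x, x, by simp [hx]⟩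
    · obtain ⟨x, y, -, hx⟩ := Finset.card_eq_two.1 h0
      exact ⟨x, y, by rw [hx, Finset.coe_pair, convexHull_pair]⟩
  obtain ⟨x, y, hxy⟩ := hseg
  refine measure_mono_null hxy ?_
  rcases Measure.euclideanHausdorffMeasure_zero_or_top (show 1 < 2 by norm_num)
    (segment ℝ x y) with h0 | h0
  · exact h0
  · exfalso
    rw [Measure.euclideanHausdorffMeasure_def, Measure.smul_apply] at h0
    simp only [Nat.cast_one, hausdorffMeasure_segment] at h0
    exact ENNReal.mul_ne_top ENNReal.coe_ne_top (edist_ne_top x y) h0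

end TetMesh

/-! ### Polynomial functions on space -/

lemma contDiff_eval (p : MvPolynomial (Fin 3) ℝ) {n : WithTop ℕ∞} :
    ContDiff ℝ n fun x : E3 => MvPolynomial.eval x.ofLp p := by
  induction p using MvPolynomial.induction_on with
  | C a => simpa using contDiff_const
  | add p q hp hq => simpa using hp.add hq
  | mul_X p i hp =>
    simp only [map_mul, MvPolynomial.eval_X]
    exact hp.mul (contDiff_piLp_apply 2)

lemma continuous_eval_ofLp (p : MvPolynomial (Fin 3) ℝ) :
    Continuous fun x : E3 => MvPolynomial.eval x.ofLp p :=
  (contDiff_eval p (n := 0)).continuous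

lemma partialD_add {f g : E3 → ℝ} {x : E3} (hf : DifferentiableAt ℝ f x)
    (hg : DifferentiableAt ℝ g x) (i : Fin 3) :
    partialD i (fun y => f y + g y) x = partialD i f x + partialD i g x := by
  simp [partialD, fderiv_fun_add hf hg]

lemma partialD_mul {f g : E3 → ℝ} {x : E3} (hf : DifferentiableAt ℝ f x)
    (hg : DifferentiableAt ℝ g x) (i : Fin 3) :
    partialD i (fun y => f y * g y) x = f x * partialD i g x + partialD i f x * g x := by
  simp [partialD, fderiv_fun_mul hf hg]
  ring

lemma partialD_const (c : ℝ) (i : Fin 3) (x : E3) : partialD i (fun _ => c) x = 0 := by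
  simp [partialD]

lemma partialD_eval (p : MvPolynomial (Fin 3) ℝ) (i : Fin 3) (x : E3) :
    partialD i (fun y => MvPolynomial.eval y.ofLp p) x =
      MvPolynomial.eval x.ofLp (MvPolynomial.pderiv i p) := by
  have hd : ∀ q : MvPolynomial (Fin 3) ℝ,
      DifferentiableAt ℝ (fun y : E3 => MvPolynomial.eval y.ofLp q) x := fun q =>
    ((contDiff_eval q (n := 1)).differentiable one_ne_zero).differentiableAt
  induction p using MvPolynomial.induction_on with
  | C a => simp [partialD_const]
  | add p q hp hq =>
    simp only [map_add]
    rw [partialD_add (hd p) (hd q), hp, hq]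
  | mul_X p j hp =>
    have hX : partialD i (fun y : E3 => y.ofLp j) x = (Pi.single j (1 : ℝ) : Fin 3 → ℝ) i := by
      have : (fun y : E3 => y.ofLp j) = (EuclideanSpace.proj j : E3 →L[ℝ] ℝ) := rfl
      rw [partialD, this, ContinuousLinearMap.fderiv]
      simp [Pi.single_apply, eq_comm]
    have hXd : DifferentiableAt ℝ (fun y : E3 => y.ofLp j) x :=
      ((contDiff_piLp_apply (n := 1) 2).differentiable one_ne_zero).differentiableAt
    simp only [map_mul, MvPolynomial.eval_X]
    rw [partialD_mul (hd p) hXd, hp, hX, Derivation.leibniz, MvPolynomial.pderiv_X]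
    simp only [smul_eq_mul, map_add, map_mul, MvPolynomial.eval_X]
    by_cases hij : i = j
    · subst hij; simp; ring
    · simp [hij, Ne.symm hij]; ring

/-- An open set contains a box, that is, a product of infinite sets, and these determine a
polynomial. -/
lemma eq_zero_of_eval_eq_zero_of_isOpen {p : MvPolynomial (Fin 3) ℝ} {U : Set E3} (hU : IsOpen U)
    (hne : U.Nonempty) (h : ∀ x ∈ U, MvPolynomial.eval x.ofLp p = 0) : p = 0 := by
  obtain ⟨x, hx⟩ := hne
  have hV : IsOpen ((WithLp.toLp 2 : (Fin 3 → ℝ) → E3) ⁻¹' U) :=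
    hU.preimage (PiLp.continuous_toLp 2 _)
  obtain ⟨ε, hε, hball⟩ := Metric.isOpen_iff.1 hV x.ofLp hx
  refine MvPolynomial.funext_set (fun i => Metric.ball (x.ofLp i) ε) (fun i => ?_) fun y hy => ?_
  · rw [Real.ball_eq_Ioo]
    exact Set.Ioo_infinite (by linarith)
  · rw [← ball_pi _ hε] at hy
    simpa using h _ (hball hy)

namespace TetMesh

variable {M : TetMesh}

/-! ### Integrals of piecewise polynomials -/

lemma val_add (f g : M.Scalar) (x : E3) : val (f + g) x = val f x + val g x := by
  unfold val; split <;> simp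

lemma val_mul (f g : M.Scalar) (x : E3) : val (f * g) x = val f x * val g x := by
  unfold val; split <;> simp

lemma val_smul (c : ℝ) (f : M.Scalar) (x : E3) : val (c • f) x = c * val f x := by
  unfold val; split <;> simp [MvPolynomial.smul_eval]

lemma val_zero (x : E3) : val (0 : M.Scalar) x = 0 := by
  unfold val; split <;> simp

lemma val_dotProduct (u v : M.Vec) (x : E3) : val (u ⬝ᵥ v) x = vval u x ⬝ᵥ vval v x := by
  simp only [dotProduct, Fin.sum_univ_three, val_add, val_mul, vval]

lemma integrableOn_val (f : M.Scalar) : IntegrableOn (val f) M.domain := by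
  refine integrableOn_domain_iff.2 fun K => ?_
  refine IntegrableOn.congr_fun_ae ?_ (Filter.EventuallyEq.symm (val_ae_eq f K))
  exact (continuous_eval_ofLp (f K)).continuousOn.integrableOn_compact
    (isCompact_convexHull_finset K.1)

/-- The integral of a piecewise polynomial over the domain. -/
noncomputable def integ : M.Scalar →ₗ[ℝ] ℝ where
  toFun f := ∫ x in M.domain, val f x
  map_add' f g := by
    simp only [val_add]
    exact integral_add (integrableOn_val f) (integrableOn_val g)
  map_smul' c f := by
    simp only [val_smul, RingHom.id_apply, smul_eq_mul]
    exact integral_const_mul _ _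

lemma integ_def (f : M.Scalar) : integ f = ∫ x in M.domain, val f x := rfl

lemma ip_eq (f g : M.Scalar) : ip f g = integ (f * g) := by
  simp only [ip, integ_def, val_mul]

lemma vip_eq (u v : M.Vec) : vip u v = integ (u ⬝ᵥ v) := by
  simp only [vip, integ_def, val_dotProduct]

lemma integ_mul_self_nonneg (f : M.Scalar) : 0 ≤ integ (f * f) := by
  rw [integ_def]
  refine integral_nonneg fun x => ?_
  rw [val_mul]
  exact mul_self_nonneg _

lemma interior_convexHull_nonempty (K : M.cells) :
    (interior (convexHull ℝ (K.1 : Set E3))).Nonempty := by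
  have hK := isTet_of_mem_cells K.2
  refine interior_convexHull_nonempty_iff_affineSpan_eq_top.2 ?_
  have h := hK.indep.affineSpan_eq_top_iff_card_eq_finrank_add_one
  rw [Subtype.range_coe_subtype] at h
  simp only [Finset.setOfPred_mem] at h
  rw [h]
  simp [hK.card_eq]

/-- On each open cell continuity upgrades vanishing almost everywhere to vanishing everywhere. Thus
identities between values become identities between the polynomials themselves. -/
lemma eq_zero_of_val_ae_eq_zero {f : M.Scalar}
    (h : ∀ᵐ x ∂volume.restrict M.domain, val f x = 0) : f = 0 := by
  funext K
  have h1 := ae_domain_iff.1 h K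
  have h2 : ∀ᵐ x ∂volume.restrict (interior (convexHull ℝ (K.1 : Set E3))),
      MvPolynomial.eval x.ofLp (f K) = 0 := by
    refine ae_restrict_of_ae_restrict_of_subset interior_subset ?_
    filter_upwards [h1, val_ae_eq f K] with x hx hx'
    rw [← hx', hx]
  refine eq_zero_of_eval_eq_zero_of_isOpen isOpen_interior (interior_convexHull_nonempty K) ?_
  exact Measure.eqOn_open_of_ae_eq (g := fun _ => 0) h2 isOpen_interior
    (continuous_eval_ofLp (f K)).continuousOn continuousOn_const

lemma eq_zero_of_integ_mul_self {f : M.Scalar} (h : integ (f * f) = 0) : f = 0 := by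
  refine eq_zero_of_val_ae_eq_zero ?_
  have h1 := (setIntegral_eq_zero_iff_of_nonneg_ae
    (Filter.Eventually.of_forall fun x => by rw [val_mul]; exact mul_self_nonneg _)
    (integrableOn_val (f * f))).1 h
  filter_upwards [h1] with x hx
  simpa [val_mul] using hx

lemma eq_zero_of_vip_self {u : M.Vec} (h : vip u u = 0) : u = 0 := by
  rw [vip_eq] at h
  simp only [dotProduct, Fin.sum_univ_three, map_add] at h
  have h0 := integ_mul_self_nonneg (u 0)
  have h1 := integ_mul_self_nonneg (u 1)
  have h2 := integ_mul_self_nonneg (u 2)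
  funext i
  fin_cases i
  · exact eq_zero_of_integ_mul_self (f := u 0) (by linarith)
  · exact eq_zero_of_integ_mul_self (f := u 1) (by linarith)
  · exact eq_zero_of_integ_mul_self (f := u 2) (by linarith)

lemma integ_sub_one_mul_self (f : M.Scalar) :
    integ ((f - 1) * (f - 1)) = integ (f * f) - 2 * integ f + integ (1 : M.Scalar) := by
  have : (f - 1) * (f - 1) = f * f - (2 : ℝ) • f + 1 := by
    rw [ofNat_smul_eq_nsmul]
    ring
  rw [this]
  simp

lemma exists_bound_val (f : M.Scalar) : ∃ C, ∀ x, |val f x| ≤ C := by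
  have h : ∀ K : M.cells, ∃ C, ∀ x ∈ convexHull ℝ (K.1 : Set E3),
      |MvPolynomial.eval x.ofLp (f K)| ≤ C := fun K =>
    (isCompact_convexHull_finset K.1).exists_bound_of_continuousOn
      (continuous_eval_ofLp (f K)).continuousOn
  choose C hC using h
  refine ⟨∑ K, |C K|, fun x => ?_⟩
  by_cases hx : ∃ K : M.cells, x ∈ interior (convexHull ℝ (K.1 : Set E3))
  · obtain ⟨K, hK⟩ := hx
    rw [val_of_mem_interior f K hK]
    exact ((hC K x (interior_subset hK)).trans (le_abs_self _)).trans
      (Finset.single_le_sum (f := fun K => |C K|) (fun _ _ => abs_nonneg _) (Finset.mem_univ K))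
  · rw [val, dif_neg hx, abs_zero]
    exact Finset.sum_nonneg fun _ _ => abs_nonneg _

lemma aestronglyMeasurable_val (f : M.Scalar) :
    AEStronglyMeasurable (val f) (volume.restrict M.domain) :=
  (integrableOn_val f).aestronglyMeasurable

lemma memLp_vval (u : M.Vec) : MemLp (vval u) 2 (volume.restrict M.domain) := by
  rw [memLp_pi_iff]
  intro i
  obtain ⟨C, hC⟩ := exists_bound_val (u i)
  exact MemLp.of_bound (aestronglyMeasurable_val (u i)) C (Filter.Eventually.of_forall hC)

end TetMesh

/-! ### Weak derivatives -/

lemma contDiff_partialD {φ : E3 → ℝ} (hφ : ContDiff ℝ ∞ φ) (i : Fin 3) :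
    ContDiff ℝ ∞ (partialD i φ) :=
  (hφ.fderiv_right (m := ∞) (by simp)).clm_apply contDiff_const

lemma partialD_comm {φ : E3 → ℝ} (hφ : ContDiff ℝ ∞ φ) (i j : Fin 3) (x : E3) :
    partialD i (partialD j φ) x = partialD j (partialD i φ) x := by
  have hd : DifferentiableAt ℝ (fderiv ℝ φ) x :=
    ((hφ.fderiv_right (m := ∞) (by simp)).differentiable (by simp)).differentiableAt
  have key : ∀ i j : Fin 3, partialD i (partialD j φ) x =
      fderiv ℝ (fderiv ℝ φ) x (EuclideanSpace.single i 1) (EuclideanSpace.single j 1) := by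
    intro i j
    have h : partialD j φ = fun y => fderiv ℝ φ y (EuclideanSpace.single j 1) := rfl
    rw [partialD, h, fderiv_clm_apply hd (differentiableAt_const _)]
    simp
  rw [key, key]
  exact (hφ.contDiffAt.isSymmSndFDerivAt (by
    rw [minSmoothness_of_isRCLikeNormedField]
    exact WithTop.coe_le_coe.2 (le_top : (2 : ℕ∞) ≤ ⊤))).eq _ _

lemma rot_gradient {φ : E3 → ℝ} (hφ : ContDiff ℝ ∞ φ) (x : E3) : rot (gradient φ) x = 0 := by
  have h : ∀ i, (fun y => gradient φ y i) = partialD i φ := fun i => rfl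
  ext i
  fin_cases i <;> simp [rot, h, partialD_comm hφ 1 2, partialD_comm hφ 0 2, partialD_comm hφ 0 1]

lemma partialD_eq_zero_of_notMem_tsupport {φ : E3 → ℝ} {x : E3} (hx : x ∉ tsupport φ)
    (i : Fin 3) : partialD i φ x = 0 := by
  have : fderiv ℝ φ x = 0 :=
    Function.notMem_support.1 fun h => hx (support_fderiv_subset ℝ h)
  rw [partialD, this]
  rfl

lemma hasCompactSupport_partialD {φ : E3 → ℝ} (hφ : HasCompactSupport φ) (i : Fin 3) :
    HasCompactSupport (partialD i φ) :=
  HasCompactSupport.intro hφ fun _ hx => partialD_eq_zero_of_notMem_tsupport hx i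

lemma integral_eval_mul_partialD (p : MvPolynomial (Fin 3) ℝ) {φ : E3 → ℝ}
    (hφ : ContDiff ℝ ∞ φ) (hc : HasCompactSupport φ) (i : Fin 3) :
    ∫ x : E3, MvPolynomial.eval x.ofLp p * partialD i φ x =
      -∫ x : E3, MvPolynomial.eval x.ofLp (MvPolynomial.pderiv i p) * φ x := by
  simp only [← partialD_eval]
  refine integral_mul_fderiv_eq_neg_fderiv_mul_of_integrable ?_ ?_ ?_ ?_ ?_
  · refine Continuous.integrable_of_hasCompactSupport ?_ hc.mul_left
    exact (contDiff_partialD (contDiff_eval p) i).continuous.mul hφ.continuous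
  · refine Continuous.integrable_of_hasCompactSupport ?_
      (hasCompactSupport_partialD hc i).mul_left
    exact (continuous_eval_ofLp p).mul (contDiff_partialD hφ i).continuous
  · exact Continuous.integrable_of_hasCompactSupport
      ((continuous_eval_ofLp p).mul hφ.continuous) hc.mul_left
  · exact fun x _ => ((contDiff_eval p (n := 1)).differentiable one_ne_zero).differentiableAt
  · exact fun x _ => (hφ.differentiable (by simp)).differentiableAt

namespace TetMesh

variable {M : TetMesh}

lemma integrableOn_mul_continuous {f g : E3 → ℝ} (hf : IntegrableOn f M.domain)
    (hg : Continuous g) : IntegrableOn (fun x => f x * g x) M.domain :=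
  hf.mul_continuousOn_of_subset hg.continuousOn isOpen_domain.measurableSet
    isCompact_space interior_subset

lemma integrableOn_val_mul (f : M.Scalar) {g : E3 → ℝ} (hg : Continuous g) :
    IntegrableOn (fun x => val f x * g x) M.domain :=
  integrableOn_mul_continuous (integrableOn_val f) hg

/-- The test function sees a single cell, on which `val f` agrees with one global polynomial, so no
face terms appear. -/
lemma setIntegral_val_mul_partialD (f : M.Scalar) (K : M.cells) {φ : E3 → ℝ}
    (hφ : ContDiff ℝ ∞ φ) (hc : HasCompactSupport φ)
    (hs : tsupport φ ⊆ interior (convexHull ℝ (K.1 : Set E3))) (i : Fin 3) :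
    ∫ x in M.domain, val f x * partialD i φ x = -∫ x in M.domain, val (pd i f) x * φ x := by
  have key : ∀ (g : M.Scalar) (ψ : E3 → ℝ), (∀ x, x ∉ tsupport φ → ψ x = 0) →
      ∫ x in M.domain, val g x * ψ x = ∫ x : E3, MvPolynomial.eval x.ofLp (g K) * ψ x := by
    intro g ψ hψ
    have h1 : (fun x => val g x * ψ x) = fun x => MvPolynomial.eval x.ofLp (g K) * ψ x := by
      funext x
      by_cases hx : x ∈ tsupport φ
      · rw [val_of_mem_interior g K (hs hx)]
      · rw [hψ x hx, mul_zero, mul_zero]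
    rw [h1]
    refine setIntegral_eq_integral_of_forall_compl_eq_zero fun x hx => ?_
    rw [hψ x fun h => hx (interior_convexHull_subset_domain K (hs h)), mul_zero]
  rw [key f _ fun x hx => partialD_eq_zero_of_notMem_tsupport hx i,
    key (pd i f) _ fun x hx => image_eq_zero_of_notMem_tsupport hx,
    integral_eval_mul_partialD _ hφ hc]
  rfl

/-- The fundamental lemma of the calculus of variations, cell by cell: the open cells fill the
domain up to a null set, so test functions supported inside single cells suffice. -/
lemma ae_eq_of_forall_setIntegral_eq {f g : E3 → ℝ} (hf : IntegrableOn f M.domain)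
    (hg : IntegrableOn g M.domain)
    (h : ∀ (K : M.cells) (φ : E3 → ℝ), ContDiff ℝ ∞ φ → HasCompactSupport φ →
      tsupport φ ⊆ interior (convexHull ℝ (K.1 : Set E3)) →
      ∫ x in M.domain, f x * φ x = ∫ x in M.domain, g x * φ x) :
    f =ᵐ[volume.restrict M.domain] g := by
  refine ae_domain_iff.2 fun K => ?_
  have h1 := isOpen_interior.ae_eq_zero_of_integral_contDiff_smul_eq_zero
    (U := interior (convexHull ℝ (K.1 : Set E3))) (μ := volume.restrict M.domain)
    (f := fun x => f x - g x) ((hf.sub hg).integrable.locallyIntegrable.locallyIntegrableOn _) ?_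
  · have h2 : ∀ᵐ x ∂volume.restrict (interior (convexHull ℝ (K.1 : Set E3))),
        x ∈ interior (convexHull ℝ (K.1 : Set E3)) → f x - g x = 0 :=
      ae_restrict_of_ae_restrict_of_subset (interior_convexHull_subset_domain K) h1
    have h3 : volume.restrict (interior (convexHull ℝ (K.1 : Set E3))) =
        volume.restrict (convexHull ℝ (K.1 : Set E3)) := by
      refine Measure.restrict_congr_set ?_
      refine Filter.EventuallyLE.antisymm (Filter.Eventually.of_forall interior_subset) ?_
      exact (ae_restrict_iff' (isCompact_convexHull_finset K.1).measurableSet).1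
        (ae_mem_interior_convexHull K.1)
    rw [h3] at h2
    filter_upwards [h2, ae_mem_interior_convexHull K.1] with x hx hxK
    linarith [hx hxK]
  · intro φ hφ hc hs
    simp only [smul_eq_mul, mul_sub]
    rw [integral_sub]
    · have := h K φ hφ hc hs
      simp only [mul_comm (φ _)]
      linarith
    · simpa only [mul_comm (φ _)] using (integrableOn_mul_continuous hf hφ.continuous).integrable
    · simpa only [mul_comm (φ _)] using (integrableOn_mul_continuous hg hφ.continuous).integrable

lemma val_div (u : M.Vec) (x : E3) : val (div u) x = ∑ i, val (pd i (u i)) x := by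
  simp only [div, Fin.sum_univ_three, val_add]

lemma ae_eq_div_of_hasDivZeroTrace {u : M.Vec} {d : E3 → ℝ} (hd : IntegrableOn d M.domain)
    (h : HasDivZeroTrace M.domain (vval u) d) : d =ᵐ[volume.restrict M.domain] val (div u) := by
  refine ae_eq_of_forall_setIntegral_eq hd (integrableOn_val _) fun K φ hφ hc hs => ?_
  have h1 : ∫ x in M.domain, vval u x ⬝ᵥ gradient φ x = -∫ x in M.domain, val (div u) x * φ x := by
    simp only [dotProduct, gradient, vval, val_div, Finset.sum_mul]
    rw [integral_finsetSum, integral_finsetSum, ← Finset.sum_neg_distrib]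
    · exact Finset.sum_congr rfl fun i _ => setIntegral_val_mul_partialD (u i) K hφ hc hs i
    · exact fun i _ => integrableOn_val_mul _ hφ.continuous
    · exact fun i _ => integrableOn_val_mul _ (contDiff_partialD hφ i).continuous
  have h2 := h φ hφ
  linarith

lemma hasDivZeroTrace_congr {Ω : Set E3} {u : E3 → Fin 3 → ℝ} {d d' : E3 → ℝ}
    (h : HasDivZeroTrace Ω u d) (hd : d =ᵐ[volume.restrict Ω] d') : HasDivZeroTrace Ω u d' := by
  intro φ hφ
  rw [h φ hφ]
  congr 1
  exact integral_congr_ae (hd.mono fun x hx => by simp only [hx])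

/-- Test functions supported in single cells identify the abstract weak divergence with the cellwise
one, which may then be used against all test functions. -/
lemma hasDivZeroTrace_div {s : ℕ} {u : M.Vec} (hu : u ∈ M.RT s) :
    HasDivZeroTrace M.domain (vval u) (val (div u)) := by
  obtain ⟨d, hd, h⟩ := hu.1.2
  exact hasDivZeroTrace_congr h (ae_eq_div_of_hasDivZeroTrace (hd.integrable one_le_two) h)

lemma DivFree.div_eq_zero {u : M.Vec} (h : DivFree u) : div u = 0 := by
  have := ae_eq_div_of_hasDivZeroTrace (d := 0) (integrable_zero _ _ _) h
  exact eq_zero_of_val_ae_eq_zero (this.mono fun x hx => hx.symm)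

lemma divFree_of_div_eq_zero {s : ℕ} {u : M.Vec} (hu : u ∈ M.RT s) (h : div u = 0) :
    DivFree u := by
  have h1 := hasDivZeroTrace_div hu
  rw [h] at h1
  have h2 : val (0 : M.Scalar) = 0 := by
    funext x
    exact val_zero x
  rwa [h2] at h1

/-- The constant `1` is an admissible test function because test functions need not vanish on the
boundary. -/
lemma integ_div_eq_zero {s : ℕ} {u : M.Vec} (hu : u ∈ M.RT s) : integ (div u) = 0 := by
  have h := hasDivZeroTrace_div hu (fun _ => 1) contDiff_const
  have h1 : ∀ x, gradient (fun _ : E3 => (1 : ℝ)) x = 0 := fun x => by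
    ext i; exact partialD_const 1 i x
  simp only [h1, dotProduct_zero, integral_zero, mul_one] at h
  rw [integ_def]
  linarith

lemma ae_eq_curl_of_hasCurlZeroTrace {w : M.Vec} {c : E3 → Fin 3 → ℝ}
    (hc : ∀ i, IntegrableOn (fun x => c x i) M.domain)
    (h : HasCurlZeroTrace M.domain (vval w) c) :
    c =ᵐ[volume.restrict M.domain] vval (curl w) := by
  have hcomp : ∀ i, (fun x => c x i) =ᵐ[volume.restrict M.domain] val (curl w i) := by
    intro j
    refine ae_eq_of_forall_setIntegral_eq (hc j) (integrableOn_val _) fun K φ hφ hcs hs => ?_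
    have h1 := h (fun x => Pi.single j (φ x)) (by
      rw [contDiff_pi]
      intro i
      by_cases hij : i = j
      · subst hij; simpa using hφ
      · simpa [hij] using contDiff_const)
    have hz : ∀ i x, partialD i (fun _ : E3 => (0 : ℝ)) x = 0 := fun i x => partialD_const 0 i x
    have hr : ∀ x, c x ⬝ᵥ (Pi.single j (φ x) : Fin 3 → ℝ) = c x j * φ x := fun x => by simp
    -- The test field `φ e_j` isolates the component `j` of the curl; each component has the form
    -- `∂_a w_b - ∂_b w_a` with `(a, b)` cyclic.
    have hsub : ∀ (a b : Fin 3), ∫ x in M.domain,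
        (val (w a) x * partialD b φ x - val (w b) x * partialD a φ x) =
          ∫ x in M.domain, val (pd a (w b) - pd b (w a)) x * φ x := by
      intro a b
      have e1 := setIntegral_val_mul_partialD (w a) K hφ hcs hs b
      have e2 := setIntegral_val_mul_partialD (w b) K hφ hcs hs a
      have e3 : ∀ x, val (pd a (w b) - pd b (w a)) x * φ x =
          val (pd a (w b)) x * φ x - val (pd b (w a)) x * φ x := by
        intro x
        rw [sub_eq_add_neg, ← neg_one_smul ℝ (pd b (w a)), val_add, val_smul]
        ring
      simp only [e3]
      rw [integral_sub (integrableOn_val_mul _ (contDiff_partialD hφ b).continuous)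
        (integrableOn_val_mul _ (contDiff_partialD hφ a).continuous),
        integral_sub (integrableOn_val_mul _ hφ.continuous)
        (integrableOn_val_mul _ hφ.continuous), e1, e2]
      ring
    simp only [hr] at h1
    rw [← h1]
    fin_cases j
    · refine Eq.trans ?_ (hsub 1 2)
      refine integral_congr_ae (Filter.Eventually.of_forall fun x => ?_)
      simp [rot, dotProduct, Fin.sum_univ_three, vval, hz]
      ring
    · refine Eq.trans ?_ (hsub 2 0)
      refine integral_congr_ae (Filter.Eventually.of_forall fun x => ?_)
      simp [rot, dotProduct, Fin.sum_univ_three, vval, hz]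
      ring
    · refine Eq.trans ?_ (hsub 0 1)
      refine integral_congr_ae (Filter.Eventually.of_forall fun x => ?_)
      simp [rot, dotProduct, Fin.sum_univ_three, vval, hz]
      ring
  filter_upwards [hcomp 0, hcomp 1, hcomp 2] with x h0 h1 h2
  ext i
  fin_cases i <;> assumption

lemma hasCurlZeroTrace_curl {s : ℕ} {w : M.Vec} (hw : w ∈ M.NED s) :
    HasCurlZeroTrace M.domain (vval w) (vval (curl w)) := by
  obtain ⟨c, hc, h⟩ := hw.1.2
  have hi := memLp_pi_iff.1 hc
  have hae := ae_eq_curl_of_hasCurlZeroTrace (fun i => (hi i).integrable one_le_two) h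
  intro φ hφ
  rw [h φ hφ]
  exact integral_congr_ae (hae.mono fun x hx => by simp only [hx])

end TetMesh

/-! ### The finite element spaces -/

lemma totalDegree_pderiv_le {s : ℕ} {p : MvPolynomial (Fin 3) ℝ} (hp : p.totalDegree ≤ s)
    (i : Fin 3) : (MvPolynomial.pderiv i p).totalDegree ≤ s - 1 := by
  refine Finset.sup_le fun d hd => ?_
  rw [MvPolynomial.mem_support_iff, MvPolynomial.coeff_pderiv] at hd
  have h1 := (MvPolynomial.le_totalDegree
    (MvPolynomial.mem_support_iff.2 (left_ne_zero_of_mul hd))).trans hp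
  rw [Finsupp.sum_add_index' (fun _ => rfl) (fun _ _ _ => rfl), Finsupp.sum_single_index rfl] at h1
  exact Nat.le_sub_one_of_lt h1

/-- Differentiation lowers the degree by the one that `X i` adds; for `s = 0` the truncated bound `s
- 1` is not enough, but the derivative of a constant is zero. -/
lemma totalDegree_X_mul_pderiv_le {s : ℕ} {p : MvPolynomial (Fin 3) ℝ} (hp : p.totalDegree ≤ s)
    (i j : Fin 3) : (MvPolynomial.X i * MvPolynomial.pderiv j p).totalDegree ≤ s := by
  rcases Nat.eq_zero_or_pos s with rfl | hs
  · rw [MvPolynomial.totalDegree_eq_zero_iff_eq_C.1 (Nat.le_zero.1 hp), MvPolynomial.pderiv_C]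
    simp
  · refine (MvPolynomial.totalDegree_mul _ _).trans ?_
    rw [MvPolynomial.totalDegree_X]
    have := totalDegree_pderiv_le hp j
    omega

lemma pderiv_comm (i j : Fin 3) (p : MvPolynomial (Fin 3) ℝ) :
    MvPolynomial.pderiv i (MvPolynomial.pderiv j p) =
      MvPolynomial.pderiv j (MvPolynomial.pderiv i p) := by
  rcases eq_or_ne i j with rfl | hij
  · rfl
  · ext d
    simp only [MvPolynomial.coeff_pderiv, Finsupp.add_apply, Finsupp.single_apply, hij, hij.symm,
      if_false, add_zero, add_right_comm d]
    ring

namespace TetMesh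

variable {M : TetMesh} {s m : ℕ}

lemma add_mem_DG {f g : M.Scalar} (hf : f ∈ M.DG m) (hg : g ∈ M.DG m) : f + g ∈ M.DG m :=
  fun K => (MvPolynomial.totalDegree_add _ _).trans (max_le (hf K) (hg K))

lemma smul_mem_DG (c : ℝ) {f : M.Scalar} (hf : f ∈ M.DG m) : c • f ∈ M.DG m :=
  fun K => (MvPolynomial.totalDegree_smul_le _ _).trans (hf K)

lemma one_mem_DG : (1 : M.Scalar) ∈ M.DG m := fun _ => by simp

lemma pd_add (i : Fin 3) (f g : M.Scalar) : pd i (f + g) = pd i f + pd i g :=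
  funext fun _ => map_add _ _ _

lemma pd_smul (i : Fin 3) (c : ℝ) (f : M.Scalar) : pd i (c • f) = c • pd i f :=
  funext fun K => Derivation.map_smul _ c (f K)

lemma pd_mul (i : Fin 3) (f g : M.Scalar) : pd i (f * g) = f * pd i g + g * pd i f :=
  funext fun K => by simp [pd, Derivation.leibniz]

lemma pd_comm (i j : Fin 3) (f : M.Scalar) : pd i (pd j f) = pd j (pd i f) :=
  funext fun K => by
    exact pderiv_comm i j (f K)

lemma pd_sub (i : Fin 3) (f g : M.Scalar) : pd i (f - g) = pd i f - pd i g :=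
  funext fun _ => map_sub _ _ _

lemma div_add (u v : M.Vec) : div (u + v) = div u + div v := by
  simp only [div, Pi.add_apply, pd_add, Finset.sum_add_distrib]

lemma div_smul (c : ℝ) (u : M.Vec) : div (c • u) = c • div u := by
  simp only [div, Pi.smul_apply, pd_smul, Finset.smul_sum]

lemma div_curl (w : M.Vec) : div (curl w) = 0 := by
  simp only [div, Fin.sum_univ_three, curl, Matrix.cons_val_zero, Matrix.cons_val_one,
    Matrix.cons_val, pd_sub, pd_comm 1 0, pd_comm 2 0, pd_comm 2 1]
  ring

lemma vval_add (u v : M.Vec) (x : E3) : vval (u + v) x = vval u x + vval v x :=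
  funext fun i => val_add (u i) (v i) x

lemma vval_smul (c : ℝ) (u : M.Vec) (x : E3) : vval (c • u) x = c • vval u x :=
  funext fun i => val_smul c (u i) x

lemma integrableOn_vval_dotProduct (u : M.Vec) {g : E3 → Fin 3 → ℝ} (hg : Continuous g) :
    IntegrableOn (fun x => vval u x ⬝ᵥ g x) M.domain := by
  simp only [dotProduct]
  exact integrable_finsetSum _ fun i _ =>
    integrableOn_val_mul (u i) ((continuous_apply i).comp hg)

lemma continuous_gradient {φ : E3 → ℝ} (hφ : ContDiff ℝ ∞ φ) : Continuous (gradient φ) :=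
  continuous_pi fun i => (contDiff_partialD hφ i).continuous

lemma vval_mem_HZeroDiv {u : M.Vec} (h : HasDivZeroTrace M.domain (vval u) (val (div u))) :
    vval u ∈ HZeroDiv M.domain := by
  refine ⟨memLp_vval u, val (div u), ?_, h⟩
  obtain ⟨C, hC⟩ := exists_bound_val (div u)
  exact MemLp.of_bound (aestronglyMeasurable_val _) C (Filter.Eventually.of_forall hC)

lemma add_mem_RT {u v : M.Vec} (hu : u ∈ M.RT s) (hv : v ∈ M.RT s) : u + v ∈ M.RT s := by
  refine ⟨vval_mem_HZeroDiv fun φ hφ => ?_, fun K => ?_⟩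
  · have h1 := hasDivZeroTrace_div hu φ hφ
    have h2 := hasDivZeroTrace_div hv φ hφ
    simp only [vval_add, add_dotProduct, div_add, val_add, add_mul]
    rw [integral_add (integrableOn_vval_dotProduct u (continuous_gradient hφ))
      (integrableOn_vval_dotProduct v (continuous_gradient hφ)),
      integral_add (integrableOn_val_mul _ hφ.continuous) (integrableOn_val_mul _ hφ.continuous),
      h1, h2]
    ring
  · obtain ⟨a, b, ha, hb, h⟩ := hu.2 K
    obtain ⟨a', b', ha', hb', h'⟩ := hv.2 K
    refine ⟨a + a', b + b', fun i => ?_, ?_, fun i => ?_⟩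
    · exact (MvPolynomial.totalDegree_add _ _).trans (max_le (ha i) (ha' i))
    · exact (MvPolynomial.totalDegree_add _ _).trans (max_le hb hb')
    · simp only [Pi.add_apply, h, h']
      ring

lemma smul_mem_RT (c : ℝ) {u : M.Vec} (hu : u ∈ M.RT s) : c • u ∈ M.RT s := by
  refine ⟨vval_mem_HZeroDiv fun φ hφ => ?_, fun K => ?_⟩
  · have h1 := hasDivZeroTrace_div hu φ hφ
    simp only [vval_smul, smul_dotProduct, div_smul, val_smul, smul_eq_mul, mul_assoc]
    rw [integral_const_mul, integral_const_mul, h1]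
    ring
  · obtain ⟨a, b, ha, hb, h⟩ := hu.2 K
    refine ⟨c • a, c • b, fun i => ?_, ?_, fun i => ?_⟩
    · exact (MvPolynomial.totalDegree_smul_le _ _).trans (ha i)
    · exact (MvPolynomial.totalDegree_smul_le _ _).trans hb
    · simp only [Pi.smul_apply, h, smul_add, mul_smul_comm]

/-- The part `x b` has degree up to `s + 1`, but `∂_i (x_i b) = x_i ∂_i b + b` is again of degree at
most `s`. -/
lemma div_mem_DG {u : M.Vec} (hu : u ∈ M.RT s) : div u ∈ M.DG s := by
  intro K
  obtain ⟨a, b, ha, hb, h⟩ := hu.2 K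
  have h1 : div u K = ∑ i, MvPolynomial.pderiv i (u i K) := by
    simp [div, pd]
  rw [h1]
  refine MvPolynomial.totalDegree_finsetSum_le fun i _ => ?_
  rw [h i, map_add, Derivation.leibniz, MvPolynomial.pderiv_X_self]
  refine (MvPolynomial.totalDegree_add _ _).trans (max_le ?_ ?_)
  · exact (totalDegree_pderiv_le (ha i) i).trans (Nat.sub_le _ _)
  · rw [smul_eq_mul, smul_eq_mul, mul_one]
    exact (MvPolynomial.totalDegree_add _ _).trans
      (max_le (totalDegree_X_mul_pderiv_le hb i i) hb)

/-- A curl belongs to the Raviart-Thomas space. -/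
lemma curl_mem_RT {w : M.Vec} (hw : w ∈ M.NED s) : curl w ∈ M.RT s := by
  refine ⟨vval_mem_HZeroDiv fun φ hφ => ?_, fun K => ?_⟩
  -- The zero tangential trace of `w` allows `∇φ` as test field, and `rot ∇φ = 0`: so `curl w` has
  -- zero weak divergence and zero normal trace.
  · have hg : ContDiff ℝ ∞ (gradient φ) := contDiff_pi.2 fun i => contDiff_partialD hφ i
    rw [← hasCurlZeroTrace_curl hw _ hg]
    simp [rot_gradient hφ, div_curl, val_zero]
  · obtain ⟨a, b, ha, hb, h⟩ := hw.2 K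
    let D : Fin 3 → MvPolynomial (Fin 3) ℝ → MvPolynomial (Fin 3) ℝ :=
      fun i p => MvPolynomial.pderiv i p
    have hD : ∀ i (p : MvPolynomial (Fin 3) ℝ), p.totalDegree ≤ s → (D i p).totalDegree ≤ s :=
      fun i p hp => (totalDegree_pderiv_le hp i).trans (Nat.sub_le _ _)
    have hsub : ∀ p q : MvPolynomial (Fin 3) ℝ, p.totalDegree ≤ s → q.totalDegree ≤ s →
        (p - q).totalDegree ≤ s := fun p q hp hq =>
      (MvPolynomial.totalDegree_sub _ _).trans (max_le hp hq)
    have hadd : ∀ p q : MvPolynomial (Fin 3) ℝ, p.totalDegree ≤ s → q.totalDegree ≤ s →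
        (p + q).totalDegree ≤ s := fun p q hp hq =>
      (MvPolynomial.totalDegree_add _ _).trans (max_le hp hq)
    let c : Fin 3 → MvPolynomial (Fin 3) ℝ :=
      ![D 1 (a 2) - D 2 (a 1), D 2 (a 0) - D 0 (a 2), D 0 (a 1) - D 1 (a 0)]
    -- From `curl (x × b) = x div b - 2 b - (x · ∇) b`; here `c` is the curl of `a`, and only the
    -- term `x div b` exceeds degree `s`.
    refine ⟨fun i => c i - (b i + b i) - (MvPolynomial.X 0 * D 0 (b i) +
      MvPolynomial.X 1 * D 1 (b i) + MvPolynomial.X 2 * D 2 (b i)),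
      D 0 (b 0) + D 1 (b 1) + D 2 (b 2), fun i => ?_, ?_, fun i => ?_⟩
    · refine hsub _ _ (hsub _ _ ?_ (hadd _ _ (hb i) (hb i))) (hadd _ _ (hadd _ _ ?_ ?_) ?_)
      · fin_cases i
        · exact hsub _ _ (hD _ _ (ha 2)) (hD _ _ (ha 1))
        · exact hsub _ _ (hD _ _ (ha 0)) (hD _ _ (ha 2))
        · exact hsub _ _ (hD _ _ (ha 1)) (hD _ _ (ha 0))
      all_goals exact totalDegree_X_mul_pderiv_le (hb i) _ _
    · exact hadd _ _ (hadd _ _ (hD _ _ (hb 0)) (hD _ _ (hb 1))) (hD _ _ (hb 2))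
    · have h0 := congrFun h 0
      have h1 := congrFun h 1
      have h2 := congrFun h 2
      simp only [cross_apply, Pi.add_apply, Matrix.cons_val_zero, Matrix.cons_val_one,
        Matrix.cons_val] at h0 h1 h2
      fin_cases i <;>
        simp [curl, pd, h0, h1, h2, c, D, Derivation.leibniz, MvPolynomial.pderiv_X] <;> ring

lemma div_mem_DGZeroMean {u : M.Vec} (hu : u ∈ M.RT s) : div u ∈ M.DGZeroMean s :=
  ⟨div_mem_DG hu, integ_div_eq_zero hu⟩

end TetMesh

namespace TetMesh

variable {M : TetMesh} {s m : ℕ}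

/-! ### Normal traces -/

/-- The value of a piecewise polynomial vector field on one tetrahedron, extended to all points. -/
noncomputable def cellVal (u : M.Vec) (K : M.cells) (x : E3) : Fin 3 → ℝ :=
  fun i => MvPolynomial.eval x.ofLp (u i K)

variable (M) in
/-- All triangles of the mesh. -/
noncomputable def triangles : Finset (Finset E3) :=
  {e ∈ M.finite_faces.toFinset | e.card = 3}

lemma mem_triangles {e : Finset E3} : e ∈ M.triangles ↔ e ∈ M.faces ∧ e.card = 3 := by
  simp [triangles]

/-- The tetrahedra that contain a given triangle. -/
noncomputable def cellsAt (M : TetMesh) (e : Finset E3) : Finset M.cells :=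
  {K : M.cells | e ⊆ K.1}

lemma mem_cellsAt {e : Finset E3} {K : M.cells} : K ∈ M.cellsAt e ↔ e ⊆ K.1 := by
  simp [cellsAt]

open Classical in
lemma mem_interiorFaces {e : Finset E3} :
    e ∈ M.interiorFaces ↔ e ∈ M.triangles ∧ (M.cellsAt e).card = 2 := by
  have h : (M.cells.filter fun K => e ⊆ K).card = (M.cellsAt e).card := by
    refine Finset.card_bij' (fun K hK => ⟨K, (Finset.mem_filter.1 hK).1⟩) (fun K _ => K.1)
      ?_ ?_ ?_ ?_
    · intro K hK
      exact mem_cellsAt.2 (Finset.mem_filter.1 hK).2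
    · intro K hK
      exact Finset.mem_filter.2 ⟨K.2, mem_cellsAt.1 hK⟩
    · intro K hK; rfl
    · intro K hK; rfl
  rw [← h, mem_triangles, interiorFaces, Finset.mem_filter, Set.Finite.mem_toFinset, and_assoc]

lemma continuous_cellVal_dotProduct (u : M.Vec) (K : M.cells) (n : Fin 3 → ℝ) :
    Continuous fun x => cellVal u K x ⬝ᵥ n := by
  simp only [dotProduct, cellVal]
  exact continuous_finsetSum _ fun i _ => (continuous_eval_ofLp _).mul continuous_const

/-- The divergence theorem for `φ K • u` on each cell, with the sum over cells and their faces
regrouped by triangle. The multiplier may change from cell to cell, so that both global test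
functions and discontinuous piecewise polynomials are covered. -/
lemma sum_setIntegral_eq_sum_triangles (u : M.Vec) {φ : M.cells → E3 → ℝ}
    (hφ : ∀ K, ContDiff ℝ 1 (φ K)) :
    ∑ K : M.cells, ∫ x in convexHull ℝ (K.1 : Set E3),
        (cellVal u K x ⬝ᵥ gradient (φ K) x + MvPolynomial.eval x.ofLp (div u K) * φ K x) =
      ∑ e ∈ M.triangles, ∫ x in convexHull ℝ (e : Set E3),
        ∑ K ∈ M.cellsAt e, φ K x * (cellVal u K x ⬝ᵥ outerNormal K.1 e) ∂μHE[2] := by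
  have h1 : ∀ K : M.cells, ∫ x in convexHull ℝ (K.1 : Set E3),
      (cellVal u K x ⬝ᵥ gradient (φ K) x + MvPolynomial.eval x.ofLp (div u K) * φ K x) =
      ∑ e ∈ K.1.powersetCard 3, ∫ x in convexHull ℝ (e : Set E3),
        φ K x * (cellVal u K x ⬝ᵥ outerNormal K.1 e) ∂μHE[2] := by
    intro K
    have h2 := setIntegral_divergence_tetrahedron (isTet_of_mem_cells K.2)
      (F := fun i x => MvPolynomial.eval x.ofLp (u i K) * φ K x)
      fun i => (contDiff_eval _).mul (hφ K)
    have h3 : ∀ x, ∑ i, partialD i (fun x => MvPolynomial.eval x.ofLp (u i K) * φ K x) x =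
        cellVal u K x ⬝ᵥ gradient (φ K) x + MvPolynomial.eval x.ofLp (div u K) * φ K x := by
      intro x
      have h4 : ∀ i, partialD i (fun x => MvPolynomial.eval x.ofLp (u i K) * φ K x) x =
          MvPolynomial.eval x.ofLp (u i K) * partialD i (φ K) x +
            MvPolynomial.eval x.ofLp (MvPolynomial.pderiv i (u i K)) * φ K x := by
        intro i
        rw [partialD_mul
          ((contDiff_eval _ (n := 1)).differentiable one_ne_zero).differentiableAt
          ((hφ K).differentiable one_ne_zero).differentiableAt, partialD_eval]
      simp only [h4, Finset.sum_add_distrib, dotProduct, cellVal, gradient, ← Finset.sum_mul]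
      congr 2
      simp [div, pd]
    simp only [h3] at h2
    rw [h2]
    refine Finset.sum_congr rfl fun e _ => ?_
    refine integral_congr_ae (Filter.Eventually.of_forall fun x => ?_)
    simp only [dotProduct, cellVal, Finset.mul_sum]
    exact Finset.sum_congr rfl fun i _ => by ring
  simp only [h1]
  rw [Finset.sum_comm' (t' := M.triangles) (s' := fun e => M.cellsAt e)]
  · refine Finset.sum_congr rfl fun e he => (integral_finsetSum _ fun K _ => ?_).symm
    exact integrableOn_triangle (mem_triangles.1 he).2
      ((hφ K).continuous.mul (continuous_cellVal_dotProduct u K _))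
  · intro K e
    simp only [Finset.mem_univ, true_and, Finset.mem_powersetCard, mem_triangles, mem_cellsAt]
    constructor
    · rintro ⟨h, hc⟩
      exact ⟨h, M.down_closed (mem_cells.1 K.2).1 h (Finset.card_pos.1 (by omega)), hc⟩
    · rintro ⟨h, -, hc⟩
      exact ⟨h, hc⟩

/-- The normal components of a field in `H₀(div)` from the two sides of a face cancel, and they
vanish at the boundary. -/
lemma sum_cellVal_dotProduct_outerNormal_ae_eq_zero {u : M.Vec} (hu : u ∈ M.RT s) {e : Finset E3}
    (he : e ∈ M.triangles) :
    ∀ᵐ x ∂(μHE[2] : Measure E3).restrict (convexHull ℝ (e : Set E3)),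
      ∑ K ∈ M.cellsAt e, cellVal u K x ⬝ᵥ outerNormal K.1 e = 0 := by
  -- The weak divergence is the cellwise one, so the volume terms cancel for a global test function
  -- and only the sum over the triangles remains.
  have hweak : ∀ φ : E3 → ℝ, ContDiff ℝ ∞ φ → ∑ e ∈ M.triangles,
      ∫ x in convexHull ℝ (e : Set E3),
        φ x * ∑ K ∈ M.cellsAt e, cellVal u K x ⬝ᵥ outerNormal K.1 e ∂μHE[2] = 0 := by
    intro φ hφ
    simp only [Finset.mul_sum]
    rw [← sum_setIntegral_eq_sum_triangles u (φ := fun _ => φ) fun _ => hφ.of_le (by simp)]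
    have h1 : ∀ K : M.cells, ∫ x in convexHull ℝ (K.1 : Set E3),
        (cellVal u K x ⬝ᵥ gradient φ x + MvPolynomial.eval x.ofLp (div u K) * φ x) =
        ∫ x in convexHull ℝ (K.1 : Set E3),
          (vval u x ⬝ᵥ gradient φ x + val (div u) x * φ x) := by
      intro K
      refine integral_congr_ae ?_
      filter_upwards [ae_mem_interior_convexHull K.1] with x hx
      have : vval u x = cellVal u K x := funext fun i => val_of_mem_interior (u i) K hx
      rw [this, val_of_mem_interior _ K hx]
    simp only [h1]
    have i1 := integrableOn_vval_dotProduct u (continuous_gradient hφ)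
    have i2 := integrableOn_val_mul (div u) hφ.continuous
    refine (setIntegral_domain (i1.add i2)).symm.trans ?_
    refine (integral_add i1 i2).trans ?_
    rw [hasDivZeroTrace_div hu φ hφ]
    ring
  -- Test functions supported off the other triangles isolate `e`, and what is lost is a null set of
  -- `e`.
  set C : Set E3 := ⋃ e' ∈ M.triangles.erase e, convexHull ℝ (e' : Set E3) with hC
  have hCc : IsClosed C := Set.Finite.isClosed_biUnion (Finset.finite_toSet _)
    fun e' _ => (isCompact_convexHull_finset e').isClosed
  have hcont : Continuous fun x => ∑ K ∈ M.cellsAt e, cellVal u K x ⬝ᵥ outerNormal K.1 e :=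
    continuous_finsetSum _ fun K _ => continuous_cellVal_dotProduct u K _
  have hae := hCc.isOpen_compl.ae_eq_zero_of_integral_contDiff_smul_eq_zero
    (μ := (μHE[2] : Measure E3).restrict (convexHull ℝ (e : Set E3)))
    ((integrableOn_triangle (mem_triangles.1 he).2
      hcont).integrable.locallyIntegrable.locallyIntegrableOn _) fun φ hφ _ hs => by
    have h1 := hweak φ hφ
    rw [← Finset.add_sum_erase _ _ he, Finset.sum_eq_zero, add_zero] at h1
    · exact h1
    · intro e' he'
      refine setIntegral_eq_zero_of_forall_eq_zero fun x hx => ?_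
      rw [image_eq_zero_of_notMem_tsupport fun h => hs h (Set.mem_biUnion he' hx), zero_mul]
  have hnull : ∀ᵐ x ∂(μHE[2] : Measure E3).restrict (convexHull ℝ (e : Set E3)), x ∈ Cᶜ := by
    rw [ae_restrict_iff' (isCompact_convexHull_finset e).measurableSet]
    have h2 : ∀ e' ∈ M.triangles.erase e, ∀ᵐ x ∂(μHE[2] : Measure E3),
        x ∉ convexHull ℝ (e : Set E3) ∩ convexHull ℝ (e' : Set E3) := by
      intro e' he'
      have he'' := Finset.mem_erase.1 he'
      exact measure_eq_zero_iff_ae_notMem.1 (measure_convexHull_inter_triangle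
        (mem_triangles.1 he).1 (mem_triangles.1 he''.2).1 (mem_triangles.1 he).2
        (mem_triangles.1 he''.2).2 he''.1.symm)
    filter_upwards [(ae_ball_iff (Finset.countable_toSet _)).2 h2] with x hx hxe hxC
    obtain ⟨e', he', hxe'⟩ := Set.mem_iUnion₂.1 hxC
    exact hx e' he' ⟨hxe, hxe'⟩
  filter_upwards [hae, hnull] with x hx hxC using hx hxC

/-! ### The advection form -/

lemma exists_pair_of_mem_interiorFaces {e : Finset E3} (he : e ∈ M.interiorFaces) :
    ∃ K L : M.cells, K ≠ L ∧ M.cellsAt e = {K, L} ∧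
      outerNormal L.1 e = -outerNormal K.1 e := by
  obtain ⟨he, hc⟩ := mem_interiorFaces.1 he
  obtain ⟨K, L, hKL, h⟩ := Finset.card_eq_two.1 hc
  have hK : K ∈ M.cellsAt e := by simp [h]
  have hL : L ∈ M.cellsAt e := by simp [h]
  exact ⟨K, L, hKL, h, outerNormal_eq_neg K.2 L.2 (fun h => hKL (Subtype.ext h))
    (mem_cellsAt.1 hK) (mem_cellsAt.1 hL) (mem_triangles.1 he).2⟩

lemma jump_eq_of_pair {e : Finset E3} {K L : M.cells} (hKL : K ≠ L) (h : M.cellsAt e = {K, L})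
    (hn : outerNormal L.1 e = -outerNormal K.1 e) (f : M.Scalar) (x : E3) :
    jump f e x = (MvPolynomial.eval x.ofLp (f K) - MvPolynomial.eval x.ofLp (f L)) •
      outerNormal K.1 e := by
  have h1 : jump f e x = ∑ K ∈ M.cellsAt e, MvPolynomial.eval x.ofLp (f K) •
    outerNormal K.1 e := by rw [jump, cellsAt]
  rw [h1, h, Finset.sum_pair hKL, hn, smul_neg, sub_smul, sub_eq_add_neg]

lemma avg_eq_of_pair {e : Finset E3} {K L : M.cells} (hKL : K ≠ L) (h : M.cellsAt e = {K, L})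
    (f : M.Scalar) (x : E3) :
    avg f e x = (MvPolynomial.eval x.ofLp (f K) + MvPolynomial.eval x.ofLp (f L)) / 2 := by
  have h1 : avg f e x = (∑ K ∈ M.cellsAt e, MvPolynomial.eval x.ofLp (f K)) / 2 := by
    rw [avg, cellsAt]
  rw [h1, h, Finset.sum_pair hKL]

lemma vavg_eq_of_pair {e : Finset E3} {K L : M.cells} (hKL : K ≠ L) (h : M.cellsAt e = {K, L})
    (u : M.Vec) (x : E3) :
    vavg u e x = (2⁻¹ : ℝ) • (cellVal u K x + cellVal u L x) := by
  funext i
  simp only [vavg, avg_eq_of_pair hKL h, Pi.smul_apply, Pi.add_apply, cellVal, smul_eq_mul]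
  ring

/-- Integration by parts for divergence-free fields. -/
lemma sum_setIntegral_dotProduct_grad {u : M.Vec} (hu : u ∈ M.RT s) (hd : div u = 0)
    (h : M.Scalar) :
    ∑ K : M.cells, ∫ x in convexHull ℝ (K.1 : Set E3),
        MvPolynomial.eval x.ofLp ((u ⬝ᵥ grad h) K) =
      ∑ e ∈ M.interiorFaces, ∫ x in convexHull ℝ (e : Set E3),
        vavg u e x ⬝ᵥ jump h e x ∂μHE[2] := by
  have h1 := sum_setIntegral_eq_sum_triangles u
    (φ := fun K x => MvPolynomial.eval x.ofLp (h K)) fun K => contDiff_eval _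
  have h2 : ∀ (K : M.cells) (x : E3), cellVal u K x ⬝ᵥ
      gradient (fun x => MvPolynomial.eval x.ofLp (h K)) x +
        MvPolynomial.eval x.ofLp (div u K) * MvPolynomial.eval x.ofLp (h K) =
      MvPolynomial.eval x.ofLp ((u ⬝ᵥ grad h) K) := by
    intro K x
    simp [hd, dotProduct, cellVal, gradient, partialD_eval, grad, pd]
  simp only [h2] at h1
  rw [h1]
  have hsub : M.interiorFaces ⊆ M.triangles := fun e he => (mem_interiorFaces.1 he).1
  rw [← Finset.sum_subset hsub]
  · refine Finset.sum_congr rfl fun e he => ?_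
    obtain ⟨K, L, hKL, hp, hn⟩ := exists_pair_of_mem_interiorFaces he
    refine integral_congr_ae ?_
    filter_upwards [sum_cellVal_dotProduct_outerNormal_ae_eq_zero hu (hsub he)] with x hx
    rw [hp, Finset.sum_pair hKL, hn, dotProduct_neg] at hx
    rw [hp, Finset.sum_pair hKL, hn, dotProduct_neg, jump_eq_of_pair hKL hp hn,
      vavg_eq_of_pair hKL hp, dotProduct_smul, smul_dotProduct, add_dotProduct, smul_eq_mul,
      smul_eq_mul]
    -- The jump of a product is `{u}·n ⟦h⟧ + {h} ⟦u·n⟧`, and `hx` says that the jump of `u·n`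
    -- vanishes.
    linear_combination (MvPolynomial.eval x.ofLp (h K) + MvPolynomial.eval x.ofLp (h L)) / 2 * hx
  -- A triangle that is not interior lies in at most one cell, where the normal component itself
  -- vanishes almost everywhere.
  · intro e he hne
    have hle : (M.cellsAt e).card ≤ 2 := card_filter_subset_le_two e (mem_triangles.1 he).2
    have hlt : (M.cellsAt e).card ≤ 1 := by
      by_contra hgt
      exact hne (mem_interiorFaces.2 ⟨he, by omega⟩)
    rw [← integral_zero E3 ℝ (μ := (μHE[2] : Measure E3).restrict (convexHull ℝ (e : Set E3)))]
    refine integral_congr_ae ?_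
    filter_upwards [sum_cellVal_dotProduct_outerNormal_ae_eq_zero hu he] with x hx
    rcases Nat.le_one_iff_eq_zero_or_eq_one.1 hlt with h0 | h0
    · rw [Finset.card_eq_zero.1 h0, Finset.sum_empty]
    · obtain ⟨K, hK⟩ := Finset.card_eq_one.1 h0
      rw [hK, Finset.sum_singleton] at hx
      rw [hK, Finset.sum_singleton, hx, mul_zero]

/-- Integration by parts for `f²`, since `∇(f²) = 2 f ∇f` in the cells and `⟦f²⟧ = 2 {f} ⟦f⟧` on the
faces. -/
lemma bForm_self {u : M.Vec} (hu : u ∈ M.RT s) (hd : div u = 0) (f : M.Scalar) :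
    bForm f f u = 0 := by
  have h := sum_setIntegral_dotProduct_grad hu hd (f * f)
  have h1 : ∀ (K : M.cells) (x : E3), MvPolynomial.eval x.ofLp ((u ⬝ᵥ grad (f * f)) K) =
      2 * MvPolynomial.eval x.ofLp (((u ⬝ᵥ grad f) * f) K) := by
    intro K x
    have : u ⬝ᵥ grad (f * f) = 2 * ((u ⬝ᵥ grad f) * f) := by
      simp only [dotProduct, grad, pd_mul, Fin.sum_univ_three]
      ring
    rw [this]
    simp
  have h2 : ∀ e ∈ M.interiorFaces, ∀ x, vavg u e x ⬝ᵥ jump (f * f) e x =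
      2 * ((vavg u e x ⬝ᵥ jump f e x) * avg f e x) := by
    intro e he x
    obtain ⟨K, L, hKL, hp, hn⟩ := exists_pair_of_mem_interiorFaces he
    rw [jump_eq_of_pair hKL hp hn, jump_eq_of_pair hKL hp hn, avg_eq_of_pair hKL hp]
    simp only [dotProduct_smul, Pi.mul_apply, map_mul, smul_eq_mul]
    ring
  simp only [h1, integral_const_mul, ← Finset.mul_sum] at h
  rw [Finset.sum_congr rfl fun e he => integral_congr_ae (Filter.Eventually.of_forall (h2 e he))]
    at h
  simp only [integral_const_mul, ← Finset.mul_sum] at h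
  rw [bForm]
  linarith

/-- With `{1} = 1` the two parts of the form are the two sides of the integration by parts formula.
-/
lemma bForm_one_right {u : M.Vec} (hu : u ∈ M.RT s) (hd : div u = 0) (f : M.Scalar) :
    bForm f 1 u = 0 := by
  have h := sum_setIntegral_dotProduct_grad hu hd f
  have h2 : ∀ e ∈ M.interiorFaces, ∀ x, (vavg u e x ⬝ᵥ jump f e x) * avg (1 : M.Scalar) e x =
      vavg u e x ⬝ᵥ jump f e x := by
    intro e he x
    obtain ⟨K, L, hKL, hp, hn⟩ := exists_pair_of_mem_interiorFaces he
    rw [avg_eq_of_pair hKL hp]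
    simp
  rw [bForm, Finset.sum_congr rfl fun e he =>
    integral_congr_ae (Filter.Eventually.of_forall (h2 e he)), ← h]
  simp

lemma jump_one {e : Finset E3} (he : e ∈ M.interiorFaces) (x : E3) :
    jump (1 : M.Scalar) e x = 0 := by
  obtain ⟨K, L, hKL, hp, hn⟩ := exists_pair_of_mem_interiorFaces he
  rw [jump_eq_of_pair hKL hp hn]
  simp

lemma bUpwind_one_right {β : M.Upwinding} {u v : M.Vec} (hv : v ∈ M.RT s) (hd : div v = 0)
    (f : M.Scalar) : bUpwind β u f 1 v = 0 := by
  rw [bUpwind, bForm_one_right hv hd, zero_add]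
  refine Finset.sum_eq_zero fun e he => ?_
  simp [jump_one he]

lemma bUpwind_one_left {β : M.Upwinding} {u v : M.Vec} (g : M.Scalar) :
    bUpwind β u 1 g v = 0 := by
  have h1 : v ⬝ᵥ grad (1 : M.Scalar) = 0 := by
    have : grad (1 : M.Scalar) = 0 := by
      funext i K
      simp [grad, pd]
    rw [this, dotProduct_zero]
  rw [bUpwind, bForm, h1, Finset.sum_eq_zero, Finset.sum_eq_zero, Finset.sum_eq_zero]
  · simp
  · intro e he
    simp [jump_one he]
  · intro e he
    simp [jump_one he]
  · intro K _
    simp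

/-- The centred part drops out. When the advecting and the transported field coincide, the quotient
is `1`, or `0` where the normal component vanishes, which leaves `β |⟦f⟧|²` or zero. -/
lemma bUpwind_self_nonneg {β : M.Upwinding} {u : M.Vec} (hu : u ∈ M.RT s) (hd : div u = 0)
    (hβ : ∀ e ∈ M.interiorFaces, ∀ x ∈ convexHull ℝ (e : Set E3), 0 ≤ β e u x) (f : M.Scalar) :
    0 ≤ bUpwind β u f f u := by
  rw [bUpwind, bForm_self hu hd, zero_add]
  refine Finset.sum_nonneg fun e he => ?_
  refine setIntegral_nonneg (isCompact_convexHull_finset e).measurableSet fun x hx => ?_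
  have h1 : 0 ≤ jump f e x ⬝ᵥ jump f e x := Finset.sum_nonneg fun i _ => mul_self_nonneg _
  have h2 : ∀ r : ℝ, 0 ≤ r / r := fun r => by by_cases h : r = 0 <;> simp [h]
  exact mul_nonneg (mul_nonneg (hβ e he x hx) (h2 _)) h1

lemma bUpwind_self_eq_zero {β : M.Upwinding} {u : M.Vec} (hu : u ∈ M.RT s) (hd : div u = 0)
    (hβ : ∀ e ∈ M.interiorFaces, ∀ x ∈ convexHull ℝ (e : Set E3), β e u x = 0) (f : M.Scalar) :
    bUpwind β u f f u = 0 := by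
  rw [bUpwind, bForm_self hu hd, zero_add]
  refine Finset.sum_eq_zero fun e he => ?_
  refine setIntegral_eq_zero_of_forall_eq_zero fun x hx => ?_
  rw [hβ e he x hx, zero_mul, zero_mul]

end TetMesh

/-! ### Symmetry of the curl -/

section Mollification

open scoped Convolution

/-- Convolution over a domain. -/
noncomputable def moll (Ω : Set E3) (η g : E3 → ℝ) : E3 → ℝ :=
  η ⋆[ContinuousLinearMap.lsmul ℝ ℝ, volume] Ω.indicator g

variable {Ω : Set E3} {η g : E3 → ℝ}

lemma moll_eq (hΩ : MeasurableSet Ω) (x : E3) : moll Ω η g x = ∫ y in Ω, η (x - y) * g y := by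
  rw [moll, convolution_eq_swap, ← integral_indicator hΩ]
  refine integral_congr_ae (Filter.Eventually.of_forall fun y => ?_)
  by_cases hy : y ∈ Ω <;> simp [hy]

lemma locallyIntegrable_indicator (hΩ : MeasurableSet Ω) (hg : IntegrableOn g Ω) :
    LocallyIntegrable (Ω.indicator g) :=
  ((integrable_indicator_iff hΩ).2 hg).locallyIntegrable

lemma contDiff_moll (hΩ : MeasurableSet Ω) (hη : ContDiff ℝ ∞ η) (hc : HasCompactSupport η)
    (hg : IntegrableOn g Ω) : ContDiff ℝ ∞ (moll Ω η g) :=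
  hc.contDiff_convolution_left _ hη (locallyIntegrable_indicator hΩ hg)

lemma partialD_moll (hΩ : MeasurableSet Ω) (hη : ContDiff ℝ ∞ η) (hc : HasCompactSupport η)
    (hg : IntegrableOn g Ω) (j : Fin 3) (x : E3) :
    partialD j (moll Ω η g) x = moll Ω (partialD j η) g x := by
  have hl := locallyIntegrable_indicator hΩ hg
  have h := hc.hasFDerivAt_convolution_left (ContinuousLinearMap.lsmul ℝ ℝ) (μ := volume)
    (hη.of_le (by simp)) hl x
  have hex : ConvolutionExists (fderiv ℝ η) (Ω.indicator g)
      (ContinuousLinearMap.precompL E3 (ContinuousLinearMap.lsmul ℝ ℝ)) volume :=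
    (hc.fderiv ℝ).convolutionExists_left _ (hη.continuous_fderiv (by simp)) hl
  rw [partialD, moll, h.fderiv, moll, convolution_def, convolution_def,
    ContinuousLinearMap.integral_apply (hex x)]
  refine integral_congr_ae (Filter.Eventually.of_forall fun y => ?_)
  simp [partialD, ContinuousLinearMap.precompL_apply]

lemma partialD_comp_sub_left (hη : ContDiff ℝ ∞ η) (j : Fin 3) (x y : E3) :
    partialD j (fun y => η (x - y)) y = -partialD j η (x - y) := by
  have h1 : HasFDerivAt (fun y : E3 => x - y) (-ContinuousLinearMap.id ℝ E3) y :=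
    (hasFDerivAt_id y).const_sub x
  have h2 := ((hη.differentiable (by simp)).differentiableAt
    (x := x - y)).hasFDerivAt.comp y h1
  have h3 : fderiv ℝ (fun y => η (x - y)) y = _ := h2.fderiv
  rw [partialD, h3]
  simp [partialD]

lemma integrableOn_mul_of_continuous_of_hasCompactSupport {f ψ : E3 → ℝ} (hf : IntegrableOn f Ω)
    (hψ : Continuous ψ) (hc : HasCompactSupport ψ) : IntegrableOn (fun y => ψ y * f y) Ω := by
  obtain ⟨C, hC⟩ := hψ.bounded_above_of_compact_support hc
  exact Integrable.bdd_mul hf hψ.aestronglyMeasurable (Filter.Eventually.of_forall hC)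

lemma hasCompactSupport_comp_sub_left (hc : HasCompactSupport η) (x : E3) :
    HasCompactSupport fun y => η (x - y) :=
  hc.comp_homeomorph (Homeomorph.subLeft x)

/-- The translated kernel `η(x - ·) e_j` is an admissible test field even where it reaches across
`∂Ω`. Hence the extension of `A` by zero has the extension of `c` by zero as its curl, and
mollification commutes with the curl. -/
lemma rot_moll (hΩ : MeasurableSet Ω) (hη : ContDiff ℝ ∞ η) (hc : HasCompactSupport η)
    {A c : E3 → Fin 3 → ℝ} (hA : ∀ i, IntegrableOn (fun x => A x i) Ω)
    (h : HasCurlZeroTrace Ω A c) (x : E3) :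
    rot (fun x i => moll Ω η (fun y => A y i) x) x = fun i => moll Ω η (fun y => c y i) x := by
  have hφ : ContDiff ℝ ∞ fun y => η (x - y) := hη.comp (contDiff_const.sub contDiff_id)
  have hz : ∀ i x, partialD i (fun _ : E3 => (0 : ℝ)) x = 0 := fun i x => partialD_const 0 i x
  have htest : ∀ j, ∫ y in Ω, A y ⬝ᵥ rot (fun y => Pi.single j (η (x - y))) y =
      ∫ y in Ω, η (x - y) * c y j := by
    intro j
    rw [h _ ?_]
    · refine integral_congr_ae (Filter.Eventually.of_forall fun y => ?_)
      simp [mul_comm]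
    · rw [contDiff_pi]
      intro i
      by_cases hij : i = j
      · subst hij; simpa using hφ
      · simpa [hij] using contDiff_const
  have hsub : ∀ a b : Fin 3, partialD a (moll Ω η fun y => A y b) x -
      partialD b (moll Ω η fun y => A y a) x =
      ∫ y in Ω, (partialD a η (x - y) * A y b - partialD b η (x - y) * A y a) := by
    intro a b
    have hint : ∀ a b : Fin 3, IntegrableOn (fun y => partialD a η (x - y) * A y b) Ω :=
      fun a b => integrableOn_mul_of_continuous_of_hasCompactSupport (hA b)
        ((contDiff_partialD hη a).continuous.comp (continuous_const.sub continuous_id))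
        (hasCompactSupport_comp_sub_left (hasCompactSupport_partialD hc a) x)
    rw [partialD_moll hΩ hη hc (hA b), partialD_moll hΩ hη hc (hA a), moll_eq hΩ, moll_eq hΩ,
      ← integral_sub (hint a b) (hint b a)]
  ext j
  rw [moll_eq hΩ, ← htest]
  fin_cases j
  · refine (hsub 1 2).trans (integral_congr_ae (Filter.Eventually.of_forall fun y => ?_))
    simp [rot, dotProduct, Fin.sum_univ_three, hz, partialD_comp_sub_left hη]
    ring
  · refine (hsub 2 0).trans (integral_congr_ae (Filter.Eventually.of_forall fun y => ?_))
    simp [rot, dotProduct, Fin.sum_univ_three, hz, partialD_comp_sub_left hη]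
    ring
  · refine (hsub 0 1).trans (integral_congr_ae (Filter.Eventually.of_forall fun y => ?_))
    simp [rot, dotProduct, Fin.sum_univ_three, hz, partialD_comp_sub_left hη]
    ring

/-- Fubini, together with `η(x - y) = η(y - x)`. -/
lemma setIntegral_mul_moll_comm (hΩ : MeasurableSet Ω) (hη : Continuous η)
    (hc : HasCompactSupport η) (heven : ∀ x, η (-x) = η x) {f : E3 → ℝ} (hf : IntegrableOn f Ω)
    (hg : IntegrableOn g Ω) :
    ∫ x in Ω, f x * moll Ω η g x = ∫ x in Ω, moll Ω η f x * g x := by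
  have hint : Integrable (Function.uncurry fun x y => f x * (η (x - y) * g y))
      ((volume.restrict Ω).prod (volume.restrict Ω)) := by
    obtain ⟨C, hC⟩ := hη.bounded_above_of_compact_support hc
    have h1 := hf.integrable.mul_prod hg.integrable
    have h2 : Continuous fun z : E3 × E3 => η (z.1 - z.2) :=
      hη.comp (continuous_fst.sub continuous_snd)
    have h3 := Integrable.bdd_mul h1 h2.aestronglyMeasurable
      (Filter.Eventually.of_forall fun z => hC (z.1 - z.2))
    refine h3.congr (Filter.Eventually.of_forall fun z => ?_)
    simp only [Function.uncurry]
    ring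
  simp only [moll_eq hΩ, ← integral_const_mul, ← integral_mul_const]
  rw [integral_integral_swap hint]
  refine integral_congr_ae (Filter.Eventually.of_forall fun x => ?_)
  refine integral_congr_ae (Filter.Eventually.of_forall fun y => ?_)
  simp only
  rw [← heven (x - y), neg_sub]
  ring

/-- A sequence of bumps that shrink to the origin. -/
noncomputable def shrinkingBump (n : ℕ) : ContDiffBump (0 : E3) where
  rIn := 1 / (n + 1)
  rOut := 2 / (n + 1)
  rIn_pos := by positivity
  rIn_lt_rOut := by gcongr; norm_num

lemma tendsto_setIntegral_mul_moll (hΩ : MeasurableSet Ω) {f : E3 → ℝ} (hf : IntegrableOn f Ω)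
    (hg : IntegrableOn g Ω) {C : ℝ} (hC : ∀ x, |g x| ≤ C) :
    Filter.Tendsto (fun n => ∫ x in Ω, f x * moll Ω ((shrinkingBump n).normed volume) g x)
      Filter.atTop (nhds (∫ x in Ω, f x * g x)) := by
  have hl := locallyIntegrable_indicator hΩ hg
  have hind : ∀ x, |Ω.indicator g x| ≤ C := by
    intro x
    by_cases hx : x ∈ Ω
    · simpa [hx] using hC x
    · simpa [hx] using (abs_nonneg _).trans (hC x)
  have hrOut : Filter.Tendsto (fun n => (shrinkingBump n).rOut) Filter.atTop (nhds 0) :=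
    tendsto_const_div_atTop_nhds_zero_nat 2 |>.comp (Filter.tendsto_add_atTop_nat 1) |>.congr
      fun n => by simp [shrinkingBump]
  -- Lebesgue differentiation needs a bounded ratio of outer to inner radius; here it is exactly
  -- `2`.
  have hlim := ContDiffBump.ae_convolution_tendsto_right_of_locallyIntegrable (K := 2) hrOut
    (Filter.Eventually.of_forall fun n => by simp [shrinkingBump]; ring_nf; rfl) hl
  -- The mollification differs from the extension of `g` by at most `2 * C`, the extension itself is
  -- bounded by `C`, hence the factor `3 * C`.
  refine tendsto_integral_of_dominated_convergence (fun x => ‖f x‖ * (3 * C)) (fun n => ?_) ?_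
    (fun n => ?_) ?_
  · exact hf.aestronglyMeasurable.mul (contDiff_moll hΩ (shrinkingBump n).contDiff_normed
      (shrinkingBump n).hasCompactSupport_normed hg).continuous.aestronglyMeasurable
  · exact hf.integrable.norm.mul_const _
  · refine Filter.Eventually.of_forall fun x => ?_
    rw [norm_mul]
    refine mul_le_mul_of_nonneg_left ?_ (norm_nonneg _)
    have h1 := (shrinkingBump n).dist_normed_convolution_le (μ := volume) (x₀ := x)
      (g := Ω.indicator g) (ε := 2 * C) hl.aestronglyMeasurable fun y _ => by
        rw [Real.dist_eq]
        have := abs_sub (Ω.indicator g y) (Ω.indicator g x)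
        linarith [hind x, hind y]
    rw [Real.dist_eq] at h1
    have h2 := hind x
    rw [Real.norm_eq_abs, moll]
    rw [abs_le] at h1 h2 ⊢
    constructor <;> linarith
  · refine (ae_restrict_iff' hΩ).2 ?_
    filter_upwards [hlim] with x hx hxΩ
    rw [Set.indicator_of_mem hxΩ] at hx
    exact hx.const_mul (f x)

/-- The curl is symmetric on fields with vanishing tangential trace and bounded curl. -/
theorem setIntegral_dotProduct_curl_comm (hΩ : MeasurableSet Ω) {A A' c c' : E3 → Fin 3 → ℝ}
    (hA : ∀ i, IntegrableOn (fun x => A x i) Ω) (hA' : ∀ i, IntegrableOn (fun x => A' x i) Ω)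
    (hc : ∀ i, IntegrableOn (fun x => c x i) Ω) (hc' : ∀ i, IntegrableOn (fun x => c' x i) Ω)
    {C C' : ℝ} (hC : ∀ x i, |c x i| ≤ C) (hC' : ∀ x i, |c' x i| ≤ C')
    (h : HasCurlZeroTrace Ω A c) (h' : HasCurlZeroTrace Ω A' c') :
    ∫ x in Ω, A x ⬝ᵥ c' x = ∫ x in Ω, c x ⬝ᵥ A' x := by
  have hbdd : ∀ {f g : E3 → ℝ} {C : ℝ}, IntegrableOn f Ω → IntegrableOn g Ω → (∀ x, |g x| ≤ C) →
      IntegrableOn (fun x => f x * g x) Ω := fun hf hg hC =>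
    hf.integrable.mul_bdd hg.aestronglyMeasurable (Filter.Eventually.of_forall hC)
  have e1 : Filter.Tendsto
      (fun n => ∑ i, ∫ x in Ω, A x i * moll Ω ((shrinkingBump n).normed volume)
        (fun y => c' y i) x) Filter.atTop (nhds (∫ x in Ω, A x ⬝ᵥ c' x)) := by
    have : ∫ x in Ω, A x ⬝ᵥ c' x = ∑ i, ∫ x in Ω, A x i * c' x i :=
      integral_finsetSum _ fun i _ => hbdd (hA i) (hc' i) fun x => hC' x i
    rw [this]
    exact tendsto_finsetSum _ fun i _ =>
      tendsto_setIntegral_mul_moll hΩ (hA i) (hc' i) fun x => hC' x i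
  have e2 : Filter.Tendsto
      (fun n => ∑ i, ∫ x in Ω, A' x i * moll Ω ((shrinkingBump n).normed volume)
        (fun y => c y i) x) Filter.atTop (nhds (∫ x in Ω, c x ⬝ᵥ A' x)) := by
    have : ∫ x in Ω, c x ⬝ᵥ A' x = ∑ i, ∫ x in Ω, A' x i * c x i := by
      simp only [dotProduct_comm (c _)]
      exact integral_finsetSum _ fun i _ => hbdd (hA' i) (hc i) fun x => hC x i
    rw [this]
    exact tendsto_finsetSum _ fun i _ =>
      tendsto_setIntegral_mul_moll hΩ (hA' i) (hc i) fun x => hC x i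
  refine tendsto_nhds_unique e1 (e2.congr fun n => ?_)
  set η := (shrinkingBump n).normed (volume : Measure E3)
  have hη : ContDiff ℝ ∞ η := (shrinkingBump n).contDiff_normed
  have hηc : HasCompactSupport η := (shrinkingBump n).hasCompactSupport_normed
  have hmb : ∀ {g : E3 → ℝ}, IntegrableOn g Ω → Continuous (moll Ω η g) := fun hg =>
    (contDiff_moll hΩ hη hηc hg).continuous
  have hmc : ∀ {g : E3 → ℝ}, IntegrableOn g Ω → ∃ D, ∀ x, |moll Ω η g x| ≤ D := by
    intro g hg
    obtain ⟨D, hD⟩ := hη.continuous.bounded_above_of_compact_support hηc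
    refine ⟨∫ y in Ω, D * ‖g y‖, fun x => ?_⟩
    rw [moll_eq hΩ, ← Real.norm_eq_abs]
    refine norm_integral_le_of_norm_le (hg.integrable.norm.const_mul D)
      (Filter.Eventually.of_forall fun y => ?_)
    rw [norm_mul]
    exact mul_le_mul_of_nonneg_right (hD _) (norm_nonneg _)
  have hmi : ∀ {f g : E3 → ℝ}, IntegrableOn f Ω → IntegrableOn g Ω →
      IntegrableOn (fun x => f x * moll Ω η g x) Ω := by
    intro f g hf hg
    obtain ⟨D, hD⟩ := hmc hg
    exact hf.integrable.mul_bdd (hmb hg).aestronglyMeasurable (Filter.Eventually.of_forall hD)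
  -- The definition of the weak curl of `A` admits only smooth test fields, so `A'` is mollified
  -- first. The curl of the result is the mollified `c'`, and evenness of the kernel moves the
  -- mollifier onto `c` on the other side. Bounded curls make both limits pass under the integral.
  have hψ : ContDiff ℝ ∞ fun x i => moll Ω η (fun y => A' y i) x :=
    contDiff_pi.2 fun i => contDiff_moll hΩ hη hηc (hA' i)
  have key := h _ hψ
  simp only [rot_moll hΩ hη hηc hA' h'] at key
  have k1 : ∫ x in Ω, A x ⬝ᵥ (fun i => moll Ω η (fun y => c' y i) x) =
      ∑ i, ∫ x in Ω, A x i * moll Ω η (fun y => c' y i) x :=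
    integral_finsetSum _ fun i _ => hmi (hA i) (hc' i)
  have k2 : ∫ x in Ω, c x ⬝ᵥ (fun i => moll Ω η (fun y => A' y i) x) =
      ∑ i, ∫ x in Ω, c x i * moll Ω η (fun y => A' y i) x :=
    integral_finsetSum _ fun i _ => hmi (hc i) (hA' i)
  rw [← k1, key, k2]
  refine Finset.sum_congr rfl fun i _ => ?_
  rw [setIntegral_mul_moll_comm hΩ hη.continuous hηc
    (fun x => (shrinkingBump n).normed_neg x) (hA' i) (hc i)]
  simp only [mul_comm]

end Mollification

namespace TetMesh

variable {M : TetMesh}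

/-! ### Bilinearity of the inner products -/

lemma ip_comm (f g : M.Scalar) : ip f g = ip g f := by rw [ip_eq, ip_eq, mul_comm]

lemma ip_sub_left (f g h : M.Scalar) : ip (f - g) h = ip f h - ip g h := by
  simp only [ip_eq, sub_mul, map_sub]

lemma ip_smul_left (c : ℝ) (f g : M.Scalar) : ip (c • f) g = c * ip f g := by
  simp only [ip_eq, smul_mul_assoc, map_smul, smul_eq_mul]

lemma ip_add_right (f g h : M.Scalar) : ip f (g + h) = ip f g + ip f h := by
  simp only [ip_eq, mul_add, map_add]

lemma ip_smul_right (c : ℝ) (f g : M.Scalar) : ip f (c • g) = c * ip f g := by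
  simp only [ip_eq, mul_smul_comm, map_smul, smul_eq_mul]

lemma vip_comm (u v : M.Vec) : vip u v = vip v u := by rw [vip_eq, vip_eq, dotProduct_comm]

lemma vip_add_left (u v w : M.Vec) : vip (u + v) w = vip u w + vip v w := by
  simp only [vip_eq, add_dotProduct, map_add]

lemma vip_sub_left (u v w : M.Vec) : vip (u - v) w = vip u w - vip v w := by
  simp only [vip_eq, sub_dotProduct, map_sub]

lemma vip_smul_left (c : ℝ) (u v : M.Vec) : vip (c • u) v = c * vip u v := by
  simp only [vip_eq, smul_dotProduct, map_smul, smul_eq_mul]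

lemma vip_add_right (u v w : M.Vec) : vip u (v + w) = vip u v + vip u w := by
  simp only [vip_eq, dotProduct_add, map_add]

lemma vip_smul_right (c : ℝ) (u v : M.Vec) : vip u (c • v) = c * vip u v := by
  simp only [vip_eq, dotProduct_smul, map_smul, smul_eq_mul]

lemma vip_scale (ρ : M.Scalar) (u v : M.Vec) : vip (scale ρ u) v = ip ρ (u ⬝ᵥ v) := by
  rw [vip_eq, ip_eq]
  congr 1
  simp only [dotProduct, scale, Finset.mul_sum, mul_assoc]

lemma vip_cross_self (u v : M.Vec) : vip (u ⨯₃ v) v = 0 := by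
  rw [vip_eq, dotProduct_comm, dot_cross_self, map_zero]

lemma vip_cross_swap (u v w : M.Vec) : vip (u ⨯₃ v) w = -vip (w ⨯₃ v) u := by
  rw [vip_eq, vip_eq, ← map_neg]
  congr 1
  simp only [dotProduct, Fin.sum_univ_three, cross_apply, Matrix.cons_val_zero,
    Matrix.cons_val_one, Matrix.cons_val]
  ring

lemma mid_mem_DG {m : ℕ} {f g : M.Scalar} (hf : f ∈ M.DG m) (hg : g ∈ M.DG m) :
    mid f g ∈ M.DG m := smul_mem_DG _ (add_mem_DG hf hg)

lemma diffQuot_mem_DG {m : ℕ} (Δt : ℝ) {f g : M.Scalar} (hf : f ∈ M.DG m) (hg : g ∈ M.DG m) :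
    diffQuot Δt f g ∈ M.DG m := by
  have : diffQuot Δt f g = Δt⁻¹ • (g + (-1 : ℝ) • f) := by
    rw [diffQuot, neg_one_smul, sub_eq_add_neg]
  rw [this]
  exact smul_mem_DG _ (add_mem_DG hg (smul_mem_DG _ hf))

lemma mid_mem_RT {s : ℕ} {u v : M.Vec} (hu : u ∈ M.RT s) (hv : v ∈ M.RT s) :
    mid u v ∈ M.RT s := smul_mem_RT _ (add_mem_RT hu hv)

lemma diffQuot_mem_RT {s : ℕ} (Δt : ℝ) {u v : M.Vec} (hu : u ∈ M.RT s) (hv : v ∈ M.RT s) :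
    diffQuot Δt u v ∈ M.RT s := by
  have : diffQuot Δt u v = Δt⁻¹ • (v + (-1 : ℝ) • u) := by
    rw [diffQuot, neg_one_smul, sub_eq_add_neg]
  rw [this]
  exact smul_mem_RT _ (add_mem_RT hv (smul_mem_RT _ hu))

lemma div_mid_eq_zero {u v : M.Vec} (hu : div u = 0) (hv : div v = 0) : div (mid u v) = 0 := by
  rw [mid, div_smul, div_add, hu, hv, add_zero, smul_zero]

/-! ### One step of the scheme -/

namespace IsStep

variable {s m : ℕ} {β : M.Upwinding} {Δt : ℝ} {u B : M.Vec} {ρ : M.Scalar}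
  {u' B' : M.Vec} {ρ' p' : M.Scalar} {w J : M.Vec} {θ : M.Scalar} {H U E α : M.Vec}

/-- The divergence of `u'` belongs to the pressure space, so it may be tested against itself. -/
lemma div_eq_zero (h : IsStep s m β Δt u B ρ u' B' ρ' p' w J θ H U E α) : div u' = 0 := by
  have h1 := h.incompressible _ (div_mem_DGZeroMean h.u_mem')
  rw [ip_eq] at h1
  exact eq_zero_of_integ_mul_self h1

/-- Since `curl E` lies in `RT s`, the whole residual of the induction equation is an admissible
test field; Faraday's law holds pointwise and not merely after projection. -/
lemma magnetic_eq (h : IsStep s m β Δt u B ρ u' B' ρ' p' w J θ H U E α) (hΔt : Δt ≠ 0) :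
    B' = B + (-Δt) • curl E := by
  have h1 := h.induction _ (add_mem_RT (diffQuot_mem_RT Δt h.B_mem h.B_mem')
    (curl_mem_RT h.E_mem))
  rw [← vip_add_left] at h1
  have h2 := eq_zero_of_vip_self h1
  rw [diffQuot] at h2
  have h3 : B' - B = (-Δt) • curl E := by
    have h4 := congrArg (fun v => Δt • v) (eq_neg_of_add_eq_zero_left h2)
    simp only [smul_smul, mul_inv_cancel₀ hΔt, one_smul] at h4
    rw [h4, smul_neg, neg_smul]
  rw [← h3]
  abel

lemma div_magnetic_eq_zero (h : IsStep s m β Δt u B ρ u' B' ρ' p' w J θ H U E α) (hΔt : Δt ≠ 0)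
    (hB : div B = 0) : div B' = 0 := by
  rw [h.magnetic_eq hΔt, div_add, div_smul, div_curl, hB, smul_zero, add_zero]

lemma mass (h : IsStep s m β Δt u B ρ u' B' ρ' p' w J θ H U E α) (hΔt : Δt ≠ 0) :
    integ ρ' = integ ρ := by
  have h1 := h.density 1 one_mem_DG
  rw [bUpwind_one_left, add_zero, diffQuot, ip_smul_left, ip_eq, mul_one, map_sub] at h1
  have := (mul_eq_zero.1 h1).resolve_left (inv_ne_zero hΔt)
  linarith

/-- The midpoint density as test function turns the difference quotient into a difference of
squares. -/
lemma square_density (h : IsStep s m β Δt u B ρ u' B' ρ' p' w J θ H U E α) (hΔt : Δt ≠ 0) :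
    integ (ρ' * ρ') - integ (ρ * ρ) = -(2 * Δt *
      bUpwind β (mid u u') (mid ρ ρ') (mid ρ ρ') (mid u u')) := by
  have h1 := h.density _ (mid_mem_DG h.ρ_mem h.ρ_mem')
  have h2 : ip (diffQuot Δt ρ ρ') (mid ρ ρ') = Δt⁻¹ * 2⁻¹ * (ip ρ' ρ' - ip ρ ρ) := by
    rw [diffQuot, mid, ip_smul_left, ip_smul_right, ip_sub_left, ip_add_right, ip_add_right,
      ip_comm ρ' ρ]
    ring
  rw [h2, ip_eq, ip_eq] at h1
  have h3 : bUpwind β (mid u u') (mid ρ ρ') (mid ρ ρ') (mid u u') =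
      -(Δt⁻¹ * 2⁻¹ * (integ (ρ' * ρ') - integ (ρ * ρ))) := by linarith
  rw [h3]
  field_simp

lemma square_density_le (h : IsStep s m β Δt u B ρ u' B' ρ' p' w J θ H U E α) (hΔt : 0 < Δt)
    (hu : div u = 0)
    (hβ : ∀ e ∈ M.interiorFaces, ∀ x ∈ convexHull ℝ (e : Set E3), 0 ≤ β e (mid u u') x) :
    integ (ρ' * ρ') ≤ integ (ρ * ρ) := by
  have h1 := h.square_density hΔt.ne'
  have h2 := bUpwind_self_nonneg (mid_mem_RT h.u_mem h.u_mem') (div_mid_eq_zero hu h.div_eq_zero)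
    hβ (mid ρ ρ')
  have h3 := mul_nonneg hΔt.le h2
  linarith

lemma square_density_eq (h : IsStep s m β Δt u B ρ u' B' ρ' p' w J θ H U E α) (hΔt : Δt ≠ 0)
    (hu : div u = 0)
    (hβ : ∀ e ∈ M.interiorFaces, ∀ x ∈ convexHull ℝ (e : Set E3), β e (mid u u') x = 0) :
    integ (ρ' * ρ') = integ (ρ * ρ) := by
  have h1 := h.square_density hΔt
  rw [bUpwind_self_eq_zero (mid_mem_RT h.u_mem h.u_mem') (div_mid_eq_zero hu h.div_eq_zero)
    hβ] at h1
  linarith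

/-- Conserved mass and a nonincreasing square give `∫ (ρ' - 1)² = ∫ ρ'² - 2 ∫ ρ' + ∫ 1 ≤ 0`. -/
lemma density_eq_one (h : IsStep s m β Δt u B ρ u' B' ρ' p' w J θ H U E α) (hΔt : 0 < Δt)
    (hu : div u = 0)
    (hβ : ∀ e ∈ M.interiorFaces, ∀ x ∈ convexHull ℝ (e : Set E3), 0 ≤ β e (mid u u') x)
    (hρ : ρ = 1) : ρ' = 1 := by
  have h1 := h.mass hΔt.ne'
  have h2 := h.square_density_le hΔt hu hβ
  have h3 := integ_sub_one_mul_self ρ'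
  have h4 := integ_mul_self_nonneg (ρ' - 1)
  rw [hρ, mul_one] at h2
  rw [hρ] at h1
  exact sub_eq_zero.1 (eq_zero_of_integ_mul_self (by linarith))

/-- The tests are `v = u_{k+1/2}`, `σ = θ` and `C = B_{k+1/2}`. The Lorentz force balances the
induction term: `⟨α, u_{k+1/2}⟩ = ⟨α, U⟩ = -⟨J × H, U⟩ = ⟨U × H, J⟩ = -⟨E, J⟩ = -⟨B_{k+1/2}, ∇ ×
E⟩`. -/
lemma energy (h : IsStep s m β Δt u B ρ u' B' ρ' p' w J θ H U E α) (hΔt : Δt ≠ 0)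
    (hu : div u = 0) :
    integ (ρ' * (u' ⬝ᵥ u') + B' ⬝ᵥ B') = integ (ρ * (u ⬝ᵥ u) + B ⬝ᵥ B) := by
  have hm := h.momentum _ (mid_mem_RT h.u_mem h.u_mem')
  rw [div_mid_eq_zero hu h.div_eq_zero, ip_eq p' 0, mul_zero, map_zero, sub_zero] at hm
  have hd := h.density θ h.θ_mem
  have hθ := h.θ_eq _ (diffQuot_mem_DG Δt h.ρ_mem h.ρ_mem')
  have hU := h.U_eq α h.α_mem
  have hα := h.α_eq U h.U_mem
  have hB := h.induction _ (mid_mem_RT h.B_mem h.B_mem')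
  have hJ := h.J_eq E h.E_mem
  have hE := h.E_eq J h.J_mem
  rw [vip_sub_left, vip_cross_self, vip_cross_swap J H U] at hα
  rw [ip_comm] at hθ
  rw [vip_comm] at hU
  rw [vip_comm α (mid u u')] at hm
  rw [vip_comm (curl E)] at hB
  rw [vip_comm E] at hE
  -- Besides the kinetic energies this contains the mixed terms in `u ⬝ᵥ u'`. They equal `⟨(ρ' -
  -- ρ)/Δt, θ⟩` by the definition of `θ`, and by the density equation they cancel the advection
  -- term.
  have e1 : vip (diffQuot Δt (scale ρ u) (scale ρ' u')) (mid u u') =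
      Δt⁻¹ * 2⁻¹ * (ip ρ' (u ⬝ᵥ u') + ip ρ' (u' ⬝ᵥ u') - ip ρ (u ⬝ᵥ u) - ip ρ (u ⬝ᵥ u')) := by
    rw [diffQuot, mid, vip_smul_left, vip_smul_right, vip_sub_left, vip_add_right, vip_add_right,
      vip_scale, vip_scale, vip_scale, vip_scale, dotProduct_comm u' u]
    ring
  have e2 : ip (u ⬝ᵥ u') (diffQuot Δt ρ ρ') = Δt⁻¹ * (ip ρ' (u ⬝ᵥ u') - ip ρ (u ⬝ᵥ u')) := by
    rw [ip_comm, diffQuot, ip_smul_left, ip_sub_left]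
  have e3 : vip (diffQuot Δt B B') (mid B B') = Δt⁻¹ * 2⁻¹ * (vip B' B' - vip B B) := by
    rw [diffQuot, mid, vip_smul_left, vip_smul_right, vip_sub_left, vip_add_right, vip_add_right,
      vip_comm B' B]
    ring
  rw [e1] at hm
  rw [e2] at hθ
  rw [e3] at hB
  rw [map_add, map_add, ← ip_eq, ← ip_eq, ← vip_eq, ← vip_eq]
  have key : Δt⁻¹ * 2⁻¹ * ((ip ρ' (u' ⬝ᵥ u') + vip B' B') - (ip ρ (u ⬝ᵥ u) + vip B B)) = 0 := by
    linarith
  have := (mul_eq_zero.1 key).resolve_left (mul_ne_zero (inv_ne_zero hΔt) (by norm_num))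
  linarith

/-- The tests are `v = B_{k+1/2}` and `C = u_{k+1/2}`. With unit density the advection term vanishes
because its second argument is `1`, and `⟨α, B_{k+1/2}⟩ = ⟨w × U, H⟩ = ⟨U × H, w⟩ = -⟨E, w⟩ =
-⟨u_{k+1/2}, ∇ × E⟩` cancels the induction term. -/
lemma cross_helicity (h : IsStep s m β Δt u B ρ u' B' ρ' p' w J θ H U E α) (hΔt : Δt ≠ 0)
    (hB : div B = 0) (hρ : ρ = 1) (hρ' : ρ' = 1) :
    vip u' B' = vip u B := by
  have hBm := mid_mem_RT h.B_mem h.B_mem'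
  have hBd := div_mid_eq_zero hB (h.div_magnetic_eq_zero hΔt hB)
  have hs : ∀ v : M.Vec, scale 1 v = v := fun v => funext fun i => one_mul _
  have hmid : mid (1 : M.Scalar) 1 = 1 := by
    rw [mid, ← two_smul ℝ (1 : M.Scalar), smul_smul]
    norm_num
  have hm := h.momentum _ hBm
  rw [hBd, ip_eq p' 0, mul_zero, map_zero, sub_zero, hρ, hρ', hmid, bUpwind_one_right hBm hBd,
    hs, hs, add_zero] at hm
  have hH := h.H_eq α h.α_mem
  have hα := h.α_eq H h.H_mem
  have hC := h.induction _ (mid_mem_RT h.u_mem h.u_mem')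
  have hw := h.w_eq E h.E_mem
  have hE := h.E_eq w h.w_mem
  rw [hρ, hρ', hs, hs] at hw
  rw [vip_sub_left, vip_cross_self, vip_eq (w ⨯₃ U)] at hα
  rw [vip_comm] at hH
  rw [vip_comm α (mid B B')] at hm
  rw [vip_comm (curl E)] at hC
  rw [vip_comm E, vip_eq (U ⨯₃ H)] at hE
  have ht : (w ⨯₃ U) ⬝ᵥ H = (U ⨯₃ H) ⬝ᵥ w := by
    simp only [dotProduct, Fin.sum_univ_three, cross_apply, Matrix.cons_val_zero,
      Matrix.cons_val_one, Matrix.cons_val]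
    ring
  rw [ht] at hα
  have e1 : vip (diffQuot Δt u u') (mid B B') + vip (diffQuot Δt B B') (mid u u') =
      Δt⁻¹ * (vip u' B' - vip u B) := by
    simp only [diffQuot, mid, vip_smul_left, vip_smul_right, vip_sub_left, vip_add_right]
    rw [vip_comm B' u, vip_comm B' u', vip_comm B u, vip_comm B u']
    ring
  have key : Δt⁻¹ * (vip u' B' - vip u B) = 0 := by linarith
  have := (mul_eq_zero.1 key).resolve_left (inv_ne_zero hΔt)
  linarith

/-- Symmetry of the curl gives `∫ A · B' = ∫ B · A'`, `∫ A · curl E = ⟨B, E⟩` and `∫ A' · curl E =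
⟨B', E⟩`. With `B' = B - Δt curl E` the helicity changes by `-Δt ⟨B + B', E⟩`, which vanishes since
`E` is orthogonal to `H`. Potentials need not be discrete, and no relation between the two is
required. -/
lemma magnetic_helicity (h : IsStep s m β Δt u B ρ u' B' ρ' p' w J θ H U E α) (hΔt : Δt ≠ 0)
    {A A' : E3 → Fin 3 → ℝ} (hA : IsPotential B A) (hA' : IsPotential B' A') :
    ∫ x in M.domain, A' x ⬝ᵥ vval B' x = ∫ x in M.domain, A x ⬝ᵥ vval B x := by
  have hΩ : MeasurableSet M.domain := isOpen_domain.measurableSet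
  have iA : ∀ i, IntegrableOn (fun x => A x i) M.domain := fun i =>
    (memLp_pi_iff.1 hA.1 i).integrable one_le_two
  have iA' : ∀ i, IntegrableOn (fun x => A' x i) M.domain := fun i =>
    (memLp_pi_iff.1 hA'.1 i).integrable one_le_two
  have iv : ∀ (v : M.Vec) (i : Fin 3), IntegrableOn (fun x => vval v x i) M.domain :=
    fun v i => integrableOn_val (v i)
  have bv : ∀ v : M.Vec, ∃ C, ∀ x i, |vval v x i| ≤ C := by
    intro v
    choose C hC using fun i => exists_bound_val (v i)
    exact ⟨∑ i, |C i|, fun x i => ((hC i x).trans (le_abs_self _)).trans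
      (Finset.single_le_sum (f := fun i => |C i|) (fun _ _ => abs_nonneg _) (Finset.mem_univ i))⟩
  obtain ⟨b, hb⟩ := bv B
  obtain ⟨b', hb'⟩ := bv B'
  obtain ⟨c, hc⟩ := bv (curl E)
  have hcE := hasCurlZeroTrace_curl h.E_mem
  have s1 := setIntegral_dotProduct_curl_comm hΩ iA iA' (iv B) (iv B') hb hb' hA.2 hA'.2
  have s2 := setIntegral_dotProduct_curl_comm hΩ iA (iv E) (iv B) (iv (curl E)) hb hc hA.2 hcE
  have s3 := setIntegral_dotProduct_curl_comm hΩ iA' (iv E) (iv B') (iv (curl E)) hb' hc hA'.2 hcE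
  have idot : ∀ {a : E3 → Fin 3 → ℝ}, (∀ i, IntegrableOn (fun x => a x i) M.domain) →
      ∀ v : M.Vec, IntegrableOn (fun x => a x ⬝ᵥ vval v x) M.domain := by
    intro a ha v
    obtain ⟨C, hC⟩ := bv v
    exact integrable_finsetSum _ fun i _ => (ha i).integrable.mul_bdd
      (iv v i).aestronglyMeasurable (Filter.Eventually.of_forall fun x => hC x i)
  have exp : ∀ {a : E3 → Fin 3 → ℝ}, (∀ i, IntegrableOn (fun x => a x i) M.domain) →
      ∫ x in M.domain, a x ⬝ᵥ vval B' x = (∫ x in M.domain, a x ⬝ᵥ vval B x) -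
        Δt * ∫ x in M.domain, a x ⬝ᵥ vval (curl E) x := by
    intro a ha
    rw [← integral_const_mul, ← integral_sub (idot ha B) ((idot ha (curl E)).integrable.const_mul Δt)]
    refine integral_congr_ae (Filter.Eventually.of_forall fun x => ?_)
    simp only [h.magnetic_eq hΔt, vval_add, vval_smul, dotProduct_add, dotProduct_smul, smul_eq_mul]
    ring
  have hH := h.H_eq E h.E_mem
  have hE := h.E_eq H h.H_mem
  rw [vip_cross_self, vip_comm] at hE
  rw [hE, mid, vip_smul_left, vip_add_left] at hH
  have e1 := exp iA
  have e2 := exp iA'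
  have e3 : ∫ x in M.domain, vval B x ⬝ᵥ A' x = ∫ x in M.domain, A' x ⬝ᵥ vval B x := by
    simp only [dotProduct_comm]
  change _ = vip B E at s2
  change _ = vip B' E at s3
  have e4 : vip B E + vip B' E = 0 := by linarith
  rw [s2] at e1
  rw [s3] at e2
  linear_combination e2 - s1 - e3 + e1 - Δt * e4

end IsStep

end TetMesh

end MHD

/-! ### Conservation laws along the whole time evolution -/

theorem mainTheorem1 (M : TetMesh) (s m : ℕ) (β : M.Upwinding)
    (hβ : ∀ e ∈ M.interiorFaces, ∀ v ∈ M.RT s, ∀ x ∈ convexHull ℝ (e : Set E3), 0 ≤ β e v x)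
    (Δt : ℝ) (hΔt : 0 < Δt) (N : ℕ)
    (u B : ℕ → M.Vec) (ρ p : ℕ → M.Scalar)
    (w J : ℕ → M.Vec) (θ : ℕ → M.Scalar) (H U E α : ℕ → M.Vec)
    (hstep : ∀ k < N, IsStep s m β Δt (u k) (B k) (ρ k) (u (k + 1)) (B (k + 1)) (ρ (k + 1))
      (p (k + 1)) (w k) (J k) (θ k) (H k) (U k) (E k) (α k))
    (hu0 : DivFree (u 0)) (hB0 : DivFree (B 0)) :
    (∀ k < N,
      (∫ x in M.domain, val (ρ (k + 1)) x = ∫ x in M.domain, val (ρ k) x) ∧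
      (∫ x in M.domain, val (ρ (k + 1)) x ^ 2 ≤ ∫ x in M.domain, val (ρ k) x ^ 2) ∧
      ((∀ e ∈ M.interiorFaces, ∀ x ∈ convexHull ℝ (e : Set E3),
          β e (mid (u k) (u (k + 1))) x = 0) →
        ∫ x in M.domain, val (ρ (k + 1)) x ^ 2 = ∫ x in M.domain, val (ρ k) x ^ 2) ∧
      (∫ x in M.domain, (val (ρ (k + 1)) x * (vval (u (k + 1)) x ⬝ᵥ vval (u (k + 1)) x)
            + vval (B (k + 1)) x ⬝ᵥ vval (B (k + 1)) x)
        = ∫ x in M.domain, (val (ρ k) x * (vval (u k) x ⬝ᵥ vval (u k) x)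
            + vval (B k) x ⬝ᵥ vval (B k) x)) ∧
      (ρ 0 = 1 →
        ∫ x in M.domain, vval (u (k + 1)) x ⬝ᵥ vval (B (k + 1)) x
          = ∫ x in M.domain, vval (u k) x ⬝ᵥ vval (B k) x) ∧
      (∀ A A' : E3 → Fin 3 → ℝ, IsPotential (B k) A → IsPotential (B (k + 1)) A' →
        ∫ x in M.domain, A' x ⬝ᵥ vval (B (k + 1)) x
          = ∫ x in M.domain, A x ⬝ᵥ vval (B k) x)) ∧
    (∀ k ≤ N, DivFree (u k) ∧ DivFree (B k)) := by
  -- The constraint on `u` is imposed anew in each step, whereas the one on `B` is inherited from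
  -- the step before.
  have hdiv : ∀ k ≤ N, div (u k) = 0 ∧ div (B k) = 0 := by
    intro k
    induction k with
    | zero => exact fun _ => ⟨hu0.div_eq_zero, hB0.div_eq_zero⟩
    | succ k ih =>
      exact fun hk => ⟨(hstep k hk).div_eq_zero,
        (hstep k hk).div_magnetic_eq_zero hΔt.ne' (ih (Nat.le_of_succ_le hk)).2⟩
  have hβ' : ∀ k < N, ∀ e ∈ M.interiorFaces, ∀ x ∈ convexHull ℝ (e : Set E3),
      0 ≤ β e (mid (u k) (u (k + 1))) x := fun k hk e he =>
    hβ e he _ (mid_mem_RT (hstep k hk).u_mem (hstep k hk).u_mem')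
  have hsq : ∀ f : M.Scalar, ∫ x in M.domain, val f x ^ 2 = integ (f * f) := fun f => by
    simp only [integ_def, val_mul, sq]
  have hen : ∀ (f : M.Scalar) (v b : M.Vec),
      ∫ x in M.domain, (val f x * (vval v x ⬝ᵥ vval v x) + vval b x ⬝ᵥ vval b x) =
        integ (f * (v ⬝ᵥ v) + b ⬝ᵥ b) := fun f v b => by
    simp only [integ_def, val_add, val_mul, val_dotProduct]
  have hone : ρ 0 = 1 → ∀ k ≤ N, ρ k = 1 := by
    intro h0 k
    induction k with
    | zero => exact fun _ => h0
    | succ k ih =>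
      exact fun hk => (hstep k hk).density_eq_one hΔt (hdiv k (Nat.le_of_succ_le hk)).1
        (hβ' k hk) (ih (Nat.le_of_succ_le hk))
  refine ⟨fun k hk => ⟨(hstep k hk).mass hΔt.ne', ?_, fun h0 => ?_, ?_, fun h0 => ?_,
    fun A A' hA hA' => (hstep k hk).magnetic_helicity hΔt.ne' hA hA'⟩, fun k hk => ?_⟩
  · rw [hsq, hsq]
    exact (hstep k hk).square_density_le hΔt (hdiv k hk.le).1 (hβ' k hk)
  · rw [hsq, hsq]
    exact (hstep k hk).square_density_eq hΔt.ne' (hdiv k hk.le).1 h0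
  · rw [hen, hen]
    exact (hstep k hk).energy hΔt.ne' (hdiv k hk.le).1
  · exact (hstep k hk).cross_helicity hΔt.ne' (hdiv k hk.le).2
      (hone h0 k hk.le) (hone h0 (k + 1) hk)
  · cases k with
    | zero => exact ⟨hu0, hB0⟩
    | succ k =>
      exact ⟨divFree_of_div_eq_zero (hstep k hk).u_mem' (hdiv _ hk).1,
        divFree_of_div_eq_zero (hstep k hk).B_mem' (hdiv _ hk).2⟩
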